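/- Let $q:\mathbb{R}^2\to\mathbb{C}$, $q(x,\xi)=a x^2+b\,x\xi+d\,\xi^2$, be a complex-valued quadratic form with Hamilton map $$F=\tfrac12\begin{pmatrix}\partial_\xi\partial_x q&\partial_\xi^2q\\-\partial_x^2q&-\partial_x\partial_\xi q\end{pmatrix}.$$ Assume that $\operatorname{Re} q(x,\xi)\ge 0$ for all $(x,\xi)\in\mathbb{R}^2$ and that the singular space is trivial: $$S=\bigcap_{k\ge 0}\ker\big((\operatorname{Re}F)(\operatorname{Im}F)^k\big)=\{0\}.$$ Then $F$ has exactly one eigenvalue $\lambda$ with $\operatorname{Im}\lambda>0$, and it is algebraically simple. Put $\mu_N=\frac{\lambda}{i}(2N+1)$, $N=0,1,2,\dots$. Let $$q^w(x,D_x)=a\,x^2+\tfrac b2\,(xD_x+D_xx)+d\,D_x^2,\qquad D_x=-i\,\tfrac{d}{dx},$$ be the Weyl quantization of $q$ as an operator on $L^2(\mathbb{R})$ with its maximal domain $\{u\in L^2(\mathbb{R}):q^w(x,D_x)u\in L^2(\mathbb{R})\}$. Each $\mu_N$ is an isolated point of its spectrum, and the spectral projection $$\Pi_N=\frac1{2\pi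 i}\oint_{|\zeta-\mu_N|=r}(\zeta-q^w(x,D_x))^{-1}\,d\zeta:L^2(\mathbb{R})\to L^2(\mathbb{R})$$ is well defined, where $r>0$ is such that the disc $\{|\zeta-\mu_N|\le r\}$ meets the spectrum only in $\mu_N$. Let $\Lambda^{\pm}\subset\mathbb{C}^2$ be the sum of the generalized eigenspaces of $F$ for eigenvalues with $\pm\operatorname{Im}>0$. There are a real linear canonical transformation $\kappa$ of $\mathbb{R}^2$ and a number $A_+\in\mathbb{C}$ with $\kappa(\Lambda^-)=\{(y,-iy):y\in\mathbb{C}\}$ and $\kappa(\Lambda^+)=\{(y,A_+y):y\in\mathbb{C}\}$; let $$C_+=(1-iA_+)^{-1}(1+iA_+).$$ For every such choice, $|C_+|<1$. If moreover $C_+\neq0$, then there is a complete asymptotic expansion $$\left(\frac{1-|C_+|}{1+|C_+|}\right)^{N/2}\|\Pi_N\|_{\mathcal L(L^2(\mathbb{R}))}\sim\sum_{j=0}^\infty c_jN^{-j-1/2},\qquad N\to\infty,$$ that is, for every $J\ge0$ the left-hand side minus $\sum_{j<J}c_jN^{-j-1/2}$ is $O(N^{-J-1/2})$ as $N\to\infty$.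 Here $(c_j)_{j\ge 0}$ is a sequence of real numbers depending only on $C_+$, and $$c_0=(2\pi|C_+|)^{-1/2}\left(\frac{1+|C_+|}{1-|C_+|}\right)^{1/4}.$$ -/

import Mathlib

open scoped SchwartzMap LinearPMap InnerProductSpace

noncomputable section

namespace QuadraticWeyl

/-- The Hilbert space `L²(ℝ; ℂ)` with Lebesgue measure. -/
abbrev L2R : Type := MeasureTheory.Lp ℂ 2 (MeasureTheory.volume : MeasureTheory.Measure ℝ)

/-! ### Quadratic symbols on the phase space `ℝ²`, with coordinates `(x, ξ)` -/

/-- The coefficient of `x²` in `q(x, ξ)`. -/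
def coeffXX (q : QuadraticMap ℝ (ℝ × ℝ) ℂ) : ℂ := q (1, 0)

/-- The coefficient of `xξ` in `q(x, ξ)`. -/
def coeffXXi (q : QuadraticMap ℝ (ℝ × ℝ) ℂ) : ℂ := QuadraticMap.polar q (1, 0) (0, 1)

/-- The coefficient of `ξ²` in `q(x, ξ)`. -/
def coeffXiXi (q : QuadraticMap ℝ (ℝ × ℝ) ℂ) : ℂ := q (0, 1)

theorem symbol_eq (q : QuadraticMap ℝ (ℝ × ℝ) ℂ) (x ξ : ℝ) :
    q (x, ξ) = coeffXX q * (x : ℂ) ^ 2 + coeffXXi q * ((x : ℂ) * ξ) + coeffXiXi q * (ξ : ℂ) ^ 2 := by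
  have h1 : ((x, ξ) : ℝ × ℝ) = x • ((1, 0) : ℝ × ℝ) + ξ • ((0, 1) : ℝ × ℝ) := by
    ext <;> simp
  rw [h1, QuadraticMap.map_add q, QuadraticMap.map_smul, QuadraticMap.map_smul,
    QuadraticMap.polar_smul_left, QuadraticMap.polar_smul_right]
  simp only [coeffXX, coeffXXi, coeffXiXi, Complex.real_smul]
  push_cast
  ring

/-- The Hamilton map (fundamental matrix)
`F = ½ [[∂_ξ ∂_x q, ∂_ξ² q], [-∂_x² q, -∂_x ∂_ξ q]]` of `q`. -/
def hamiltonMap (q : QuadraticMap ℝ (ℝ × ℝ) ℂ) : Matrix (Fin 2) (Fin 2) ℂ :=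
  !![coeffXXi q / 2, coeffXiXi q; -coeffXX q, -(coeffXXi q / 2)]

/-- The singular space `S = ⋂_{k ≥ 0} ker ((Re F) (Im F)^k) ⊆ ℝ²`. -/
def singularSpace (q : QuadraticMap ℝ (ℝ × ℝ) ℂ) : Submodule ℝ (Fin 2 → ℝ) :=
  ⨅ k : ℕ, LinearMap.ker (Matrix.toLin'
    ((hamiltonMap q).map Complex.re * (hamiltonMap q).map Complex.im ^ k))

/-- `Λ⁺`: the sum of the generalized eigenspaces of `F` for eigenvalues with `Im > 0`. -/
def lambdaPlus (q : QuadraticMap ℝ (ℝ × ℝ) ℂ) : Submodule ℂ (Fin 2 → ℂ) :=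
  ⨆ (z : ℂ) (_ : 0 < z.im), Module.End.maxGenEigenspace (Matrix.toLin' (hamiltonMap q)) z

/-- `Λ⁻`: the sum of the generalized eigenspaces of `F` for eigenvalues with `Im < 0`. -/
def lambdaMinus (q : QuadraticMap ℝ (ℝ × ℝ) ℂ) : Submodule ℂ (Fin 2 → ℂ) :=
  ⨆ (z : ℂ) (_ : z.im < 0), Module.End.maxGenEigenspace (Matrix.toLin' (hamiltonMap q)) z

/-- `C` is a value of the parameter `C₊` of `q`: there is a real linear canonical transformation
`κ` of `ℝ²` (in dimension one: a real matrix of determinant one) with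
`κ(Λ⁻) = {(y, -iy)}` and `κ(Λ⁺) = {(y, A₊ y)}`, and `C₊ = (1 - i A₊)⁻¹ (1 + i A₊)`.
The choice of `κ` affects `C₊` only by a factor of modulus one. -/
def IsCPlus (q : QuadraticMap ℝ (ℝ × ℝ) ℂ) (C : ℂ) : Prop :=
  ∃ (κ : Matrix.SpecialLinearGroup (Fin 2) ℝ) (A : ℂ),
    (lambdaMinus q).map (Matrix.toLin' ((κ : Matrix (Fin 2) (Fin 2) ℝ).map Complex.ofReal)) =
      Submodule.span ℂ {![1, -Complex.I]} ∧
    (lambdaPlus q).map (Matrix.toLin' ((κ : Matrix (Fin 2) (Fin 2) ℝ).map Complex.ofReal)) =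
      Submodule.span ℂ {![1, A]} ∧
    C = (1 - Complex.I * A)⁻¹ * (1 + Complex.I * A)

/-! ### The Weyl quantization as an unbounded operator on `L²(ℝ)` -/

/-- `D = -i d/dx` on Schwartz functions. -/
def opD : 𝓢(ℝ, ℂ) →L[ℂ] 𝓢(ℝ, ℂ) := (-Complex.I) • SchwartzMap.derivCLM ℂ ℂ

/-- Multiplication by `x` on Schwartz functions. -/
def opX : 𝓢(ℝ, ℂ) →L[ℂ] 𝓢(ℝ, ℂ) := SchwartzMap.smulLeftCLM ℂ (fun x : ℝ => (x : ℂ))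

theorem opD_apply (φ : 𝓢(ℝ, ℂ)) (x : ℝ) : opD φ x = -Complex.I * deriv φ x := by
  simp [opD]

theorem opX_apply (φ : 𝓢(ℝ, ℂ)) (x : ℝ) : opX φ x = (x : ℂ) * φ x := by
  have h : (fun x : ℝ => (x : ℂ)).HasTemperateGrowth := by fun_prop
  simp [opX, SchwartzMap.smulLeftCLM_apply_apply h]

/-- The Weyl quantization `a x² + b (xD + Dx)/2 + c D²` of `a x² + b xξ + c ξ²`, acting on
Schwartz functions. -/
def weylSchwartz (a b c : ℂ) : 𝓢(ℝ, ℂ) →L[ℂ] 𝓢(ℝ, ℂ) :=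
  a • (opX ∘L opX) + (b / 2) • (opX ∘L opD + opD ∘L opX) + c • (opD ∘L opD)

/-- The embedding of the Schwartz space into `L²(ℝ)`. -/
def schwartzToL2 : 𝓢(ℝ, ℂ) →ₗ[ℂ] L2R :=
  (SchwartzMap.toLpCLM ℂ ℂ 2 MeasureTheory.volume).toLinearMap

theorem schwartzToL2_injective : Function.Injective schwartzToL2 :=
  SchwartzMap.injective_toLp 2 MeasureTheory.volume

/-- The operator `a x² + b (xD + Dx)/2 + c D²` on `L²(ℝ)` with domain the Schwartz functions. -/
def weylCore (a b c : ℂ) : L2R →ₗ.[ℂ] L2R where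
  domain := LinearMap.range schwartzToL2
  toFun := schwartzToL2 ∘ₗ (weylSchwartz a b c).toLinearMap ∘ₗ
    (LinearEquiv.ofInjective schwartzToL2 schwartzToL2_injective).symm.toLinearMap

/-- The operator `q^w(x, D)` on `L²(ℝ)`, with its maximal domain: `u ∈ L²` is in the domain iff
`q^w(x, D) u`, in the sense of (tempered) distributions, is in `L²`. Equivalently it is the
Hilbert space adjoint of the formal adjoint `(q̄)^w(x, D)` acting on Schwartz functions;
see `mem_weylOp_graph_iff`. -/
def weylOp (q : QuadraticMap ℝ (ℝ × ℝ) ℂ) : L2R →ₗ.[ℂ] L2R :=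
  (weylCore (star (coeffXX q)) (star (coeffXXi q)) (star (coeffXiXi q)))†

theorem weylCore_dense (a b c : ℂ) : Dense ((weylCore a b c).domain : Set L2R) := by
  have h := SchwartzMap.denseRange_toLpCLM (E := ℝ) (F := ℂ) (p := 2)
    (μ := MeasureTheory.volume) (by simp)
  exact h

theorem mem_weylOp_graph_iff (q : QuadraticMap ℝ (ℝ × ℝ) ℂ) (u f : L2R) :
    (∃ h : u ∈ (weylOp q).domain, weylOp q ⟨u, h⟩ = f) ↔
      ∀ φ : 𝓢(ℝ, ℂ), ⟪f, schwartzToL2 φ⟫_ℂ =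
        ⟪u, schwartzToL2 (weylSchwartz (star (coeffXX q)) (star (coeffXXi q))
          (star (coeffXiXi q)) φ)⟫_ℂ := by
  set T := weylCore (star (coeffXX q)) (star (coeffXXi q)) (star (coeffXiXi q)) with hT
  have hd : Dense (T.domain : Set L2R) := weylCore_dense _ _ _
  have key : ∀ φ : 𝓢(ℝ, ℂ), ∀ h : schwartzToL2 φ ∈ T.domain, T ⟨schwartzToL2 φ, h⟩ =
      schwartzToL2 (weylSchwartz (star (coeffXX q)) (star (coeffXXi q))
          (star (coeffXiXi q)) φ) := by
    intro φ h
    have h2 : (LinearEquiv.ofInjective schwartzToL2 schwartzToL2_injective).symm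
        ⟨schwartzToL2 φ, h⟩ = φ := by
      rw [LinearEquiv.symm_apply_eq]
      rfl
    change schwartzToL2 (weylSchwartz _ _ _
      ((LinearEquiv.ofInjective schwartzToL2 schwartzToL2_injective).symm
        ⟨schwartzToL2 φ, h⟩)) = _
    rw [h2]
  constructor
  · rintro ⟨h, rfl⟩ φ
    have := LinearPMap.adjoint_isFormalAdjoint hd ⟨u, h⟩ ⟨schwartzToL2 φ, φ, rfl⟩
    exact this.trans (congrArg (inner ℂ u) (key φ ⟨φ, rfl⟩))
  · intro hf
    have hx : ∀ x : T.domain, ⟪f, (x : L2R)⟫_ℂ = ⟪u, T x⟫_ℂ := by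
      rintro ⟨_, φ, rfl⟩
      exact (hf φ).trans (congrArg (inner ℂ u) (key φ ⟨φ, rfl⟩)).symm
    have hm : u ∈ T†.domain := LinearPMap.mem_adjoint_domain_of_exists u ⟨f, hx⟩
    exact ⟨hm, LinearPMap.adjoint_apply_eq hd ⟨u, hm⟩ hx⟩

/-! ### Resolvents and spectral projections of unbounded operators -/

/-- `R = (ζ - A)⁻¹` as an everywhere defined bounded operator. -/
def IsResolventAt (A : L2R →ₗ.[ℂ] L2R) (ζ : ℂ) (R : L2R →L[ℂ] L2R) : Prop :=
  (∀ f : L2R, ∃ h : R f ∈ A.domain, ζ • R f - A ⟨R f, h⟩ = f) ∧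
    ∀ u : A.domain, R (ζ • (u : L2R) - A u) = u

/-- The spectrum of an unbounded operator. -/
def spec (A : L2R →ₗ.[ℂ] L2R) : Set ℂ := {ζ | ¬ ∃ R, IsResolventAt A ζ R}

/-- `P` is the spectral (Riesz) projection `(2πi)⁻¹ ∮_Γ (ζ - A)⁻¹ dζ` for `A` and the isolated
point `z` of its spectrum, with `Γ` a positively oriented circle about `z`, the closed disc in
which meets the spectrum only in `z`. -/
def IsSpectralProjection (A : L2R →ₗ.[ℂ] L2R) (z : ℂ) (P : L2R →L[ℂ] L2R) : Prop :=
  ∃ r : ℝ, 0 < r ∧ Metric.closedBall z r ∩ spec A = {z} ∧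
    ∃ R : ℂ → (L2R →L[ℂ] L2R), (∀ ζ ∈ Metric.sphere z r, IsResolventAt A ζ (R ζ)) ∧
      CircleIntegrable R z r ∧
      P = (2 * (Real.pi : ℂ) * Complex.I)⁻¹ • ∮ ζ in C(z, r), R ζ

end QuadraticWeyl

end

open QuadraticWeyl

noncomputable section

namespace QuadraticWeyl

open MeasureTheory

section

/-! ### Complex Gaussians are Schwartz functions -/

/-! The whole problem reduces to one explicit lower triangular matrix. If `F X = z X`, then `q(Re X)
+ q(Im X) = 2 i z Im(X₀ X̄₁)`. Since `Re q ≥ 0` and `S = 0`, this forces `Im z · Im(X₀ X̄₁) < 0`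
(`im_mul_im_neg`). Hence no eigenvalue is real and the eigenvalues are `±λ`; the same sign yields
`κ`, `Im A₊ > 0` and `|C₊| < 1`. Because `q` vanishes on both eigenlines it factors, and in terms of
`ℓ = αx + βξ` read off from `κ` it equals `c (|ℓ|² - C₊ ℓ̄²)` with `c = 2λ/i`
(`NormalizedData.coeff_eq`).

Quantization turns `ℓ` into an annihilation operator `a` with `[a, a*] = 1`, so the operator is `c
(a*a + 1/2 - C₊ a*²)`. In the Hermite basis of `a` it has diagonal entries `c (n + 1/2)` and entries
`-c C₊ √(n(n-1))` two places below (`weylOp_graph_iff`). As `|C₊| < 1`, the resolvent exists off the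
diagonal entries, so the spectrum is `{μ_N}` (`spec_eq`), and each `Π_N` has rank one, built from
explicit right and left eigenvectors (`IsSpectralProjection.eq_rankOne`). Therefore `‖Π_N‖²` is a
product of two explicit sums depending only on `ρ = |C₊|`.

The sums are the integrals of `(1 + ρ cos θ)^N / π` and `(1 - ρ cos θ)^(-N-1) / π` over `[0, π]`. A
Möbius substitution makes them proportional (`leftSum_eq`), so the normalized norm is exactly `(1 -
ρ²)^(-1/4) / π` times the integral of `((1 + ρ cos θ)/(1 + ρ))^N` (`normalized_norm_eq`). Taking
`e^(-t)` for the base turns this into a Laplace integral with amplitude `t^(-1/2)` times an analytic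
function, and Watson's lemma (`watson`) gives the expansion and `c₀`. -/

theorem abs_pow_mul_exp_neg_sq_bounded {b : ℝ} (hb : 0 < b) (k : ℕ) :
    ∃ M : ℝ, ∀ x : ℝ, |x| ^ k * Real.exp (-(b * x ^ 2)) ≤ M := by
  refine ⟨1 + k.factorial / b ^ k, fun x => ?_⟩
  have h1 : |x| ^ k ≤ 1 + (x ^ 2) ^ k := by
    rcases le_total |x| 1 with h | h
    · have : |x| ^ k ≤ 1 := pow_le_one₀ (abs_nonneg x) h
      have : 0 ≤ (x ^ 2) ^ k := by positivity
      linarith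
    · have : |x| ^ k ≤ (x ^ 2) ^ k := by
        rw [← sq_abs]
        gcongr
        nlinarith
      linarith
  have h2 : (b * x ^ 2) ^ k / k.factorial ≤ Real.exp (b * x ^ 2) :=
    Real.pow_div_factorial_le_exp _ (by positivity) k
  have hE : 0 < Real.exp (-(b * x ^ 2)) := Real.exp_pos _
  have h3 : Real.exp (-(b * x ^ 2)) ≤ 1 := Real.exp_le_one_iff.2 (by nlinarith [sq_nonneg x])
  have h4 : (x ^ 2) ^ k * Real.exp (-(b * x ^ 2)) ≤ k.factorial / b ^ k := by
    have hf : (0 : ℝ) < k.factorial := by positivity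
    rw [div_le_iff₀ hf] at h2
    rw [Real.exp_neg, ← div_eq_mul_inv, div_le_div_iff₀ (Real.exp_pos _) (by positivity)]
    calc (x ^ 2) ^ k * b ^ k = (b * x ^ 2) ^ k := by rw [mul_pow]; ring
      _ ≤ _ := by linarith
  calc |x| ^ k * Real.exp (-(b * x ^ 2))
      ≤ (1 + (x ^ 2) ^ k) * Real.exp (-(b * x ^ 2)) := by gcongr
    _ ≤ _ := by linarith

theorem polynomial_gaussian_bounded {γ : ℂ} (hγ : 0 < γ.re) (k : ℕ) (p : Polynomial ℂ) :
    ∃ M : ℝ, ∀ x : ℝ, |x| ^ k * ‖p.eval (x : ℂ) * Complex.exp (-γ * (x : ℂ) ^ 2 / 2)‖ ≤ M := by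
  have hn : ∀ x : ℝ, ‖Complex.exp (-γ * (x : ℂ) ^ 2 / 2)‖ = Real.exp (-(γ.re / 2 * x ^ 2)) := by
    intro x
    rw [Complex.norm_exp]
    congr 1
    have : -γ * (x : ℂ) ^ 2 / 2 = -γ * ((x ^ 2 / 2 : ℝ) : ℂ) := by push_cast; ring
    rw [this, Complex.re_mul_ofReal, Complex.neg_re]
    ring
  induction p using Polynomial.induction_on' with
  | add p q hp hq =>
    obtain ⟨M, hM⟩ := hp
    obtain ⟨M', hM'⟩ := hq
    refine ⟨M + M', fun x => ?_⟩
    rw [Polynomial.eval_add, add_mul]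
    calc _ ≤ |x| ^ k * (‖p.eval (x : ℂ) * Complex.exp (-γ * (x : ℂ) ^ 2 / 2)‖ +
        ‖q.eval (x : ℂ) * Complex.exp (-γ * (x : ℂ) ^ 2 / 2)‖) := by
          gcongr; exact norm_add_le _ _
      _ ≤ _ := by rw [mul_add]; exact add_le_add (hM x) (hM' x)
  | monomial n a =>
    obtain ⟨M, hM⟩ := abs_pow_mul_exp_neg_sq_bounded (half_pos hγ) (k + n)
    refine ⟨‖a‖ * M, fun x => ?_⟩
    have : |x| ^ k * ‖(Polynomial.monomial n a).eval (x : ℂ) * Complex.exp (-γ * (x : ℂ) ^ 2 / 2)‖ =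
        ‖a‖ * (|x| ^ (k + n) * Real.exp (-(γ.re / 2 * x ^ 2))) := by
      rw [norm_mul, hn, Polynomial.eval_monomial, norm_mul, norm_pow, Complex.norm_real,
        Real.norm_eq_abs, pow_add]
      ring
    rw [this]
    gcongr
    exact hM x

theorem hasDerivAt_polynomial_gaussian (γ : ℂ) (p : Polynomial ℂ) (x : ℝ) :
    HasDerivAt (fun x : ℝ => p.eval (x : ℂ) * Complex.exp (-γ * (x : ℂ) ^ 2 / 2))
      ((p.derivative - Polynomial.C γ * Polynomial.X * p).eval (x : ℂ) *
        Complex.exp (-γ * (x : ℂ) ^ 2 / 2)) x := by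
  have h1 : HasDerivAt (fun z : ℂ => p.eval z * Complex.exp (-γ * z ^ 2 / 2))
      (p.derivative.eval (x : ℂ) * Complex.exp (-γ * (x : ℂ) ^ 2 / 2) +
        p.eval (x : ℂ) * (Complex.exp (-γ * (x : ℂ) ^ 2 / 2) *
          (-γ * ((2 : ℕ) * (x : ℂ) ^ (2 - 1)) / 2))) (x : ℂ) :=
    (p.hasDerivAt _).mul ((((hasDerivAt_pow 2 (x : ℂ)).const_mul (-γ)).div_const 2).cexp)
  convert h1.comp_ofReal using 1
  simp only [Polynomial.eval_sub, Polynomial.eval_mul, Polynomial.eval_C, Polynomial.eval_X]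
  push_cast
  ring

/-- Differentiation keeps the class of polynomials times a fixed Gaussian, so each Schwartz seminorm
is controlled by `polynomial_gaussian_bounded`. -/
theorem iteratedDeriv_gaussian (γ : ℂ) (n : ℕ) : ∃ p : Polynomial ℂ,
    iteratedDeriv n (fun x : ℝ => Complex.exp (-γ * (x : ℂ) ^ 2 / 2)) =
      fun x : ℝ => p.eval (x : ℂ) * Complex.exp (-γ * (x : ℂ) ^ 2 / 2) := by
  induction n with
  | zero => exact ⟨1, by simp⟩
  | succ n ih =>
    obtain ⟨p, hp⟩ := ih
    refine ⟨p.derivative - Polynomial.C γ * Polynomial.X * p, ?_⟩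
    rw [iteratedDeriv_succ, hp]
    ext x
    exact (hasDerivAt_polynomial_gaussian γ p x).deriv

/-- The Gaussian `exp(-γ x² / 2)` with `Re γ > 0` as a Schwartz function. -/
def gaussianSchwartz (γ : ℂ) (hγ : 0 < γ.re) : 𝓢(ℝ, ℂ) where
  toFun x := Complex.exp (-γ * (x : ℂ) ^ 2 / 2)
  smooth' := by
    have : ContDiff ℝ (⊤ : ℕ∞) (fun x : ℝ => (x : ℂ)) := Complex.ofRealCLM.contDiff
    fun_prop
  decay' k n := by
    obtain ⟨p, hp⟩ := iteratedDeriv_gaussian γ n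
    obtain ⟨M, hM⟩ := polynomial_gaussian_bounded hγ k p
    refine ⟨M, fun x => ?_⟩
    rw [norm_iteratedFDeriv_eq_norm_iteratedDeriv, hp]
    exact hM x

theorem gaussianSchwartz_apply (γ : ℂ) (hγ : 0 < γ.re) (x : ℝ) :
    gaussianSchwartz γ hγ x = Complex.exp (-γ * (x : ℂ) ^ 2 / 2) := rfl

/-! ### Ladder operators -/

/-- The canonical commutation relation; all the operator algebra below rests on it. -/
theorem opD_opX (φ : 𝓢(ℝ, ℂ)) : opD (opX φ) = opX (opD φ) - Complex.I • φ := by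
  ext x
  have hd : HasDerivAt (fun y : ℝ => (y : ℂ) * φ y) (1 * φ x + (x : ℂ) * deriv φ x) x :=
    (Complex.ofRealCLM.hasDerivAt (x := x)).mul (φ.hasDerivAt x)
  have hf : (opX φ : ℝ → ℂ) = fun y : ℝ => (y : ℂ) * φ y := funext (opX_apply φ)
  rw [opD_apply, hf, hd.deriv]
  simp only [sub_apply, smul_apply, opX_apply, opD_apply, smul_eq_mul]
  ring

theorem inner_schwartz (φ ψ : 𝓢(ℝ, ℂ)) :
    ⟪schwartzToL2 φ, schwartzToL2 ψ⟫_ℂ = ∫ x, (starRingEnd ℂ) (φ x) * ψ x := by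
  have := SchwartzMap.inner_toL2_toL2_eq φ ψ (volume : Measure ℝ)
  simp only [RCLike.inner_apply'] at this
  exact this

theorem inner_opX (φ ψ : 𝓢(ℝ, ℂ)) :
    ⟪schwartzToL2 (opX φ), schwartzToL2 ψ⟫_ℂ = ⟪schwartzToL2 φ, schwartzToL2 (opX ψ)⟫_ℂ := by
  rw [inner_schwartz, inner_schwartz]
  congr 1
  ext x
  rw [opX_apply, opX_apply, map_mul, Complex.conj_ofReal]
  ring

theorem inner_opD (φ ψ : 𝓢(ℝ, ℂ)) :
    ⟪schwartzToL2 (opD φ), schwartzToL2 ψ⟫_ℂ = ⟪schwartzToL2 φ, schwartzToL2 (opD ψ)⟫_ℂ := by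
  rw [inner_schwartz, inner_schwartz]
  have h := SchwartzMap.integral_bilinear_deriv_right_eq_neg_left φ ψ
    ((ContinuousLinearMap.mul ℝ ℂ).comp (Complex.conjCLE : ℂ →L[ℝ] ℂ))
  simp only [ContinuousLinearMap.comp_apply, ContinuousLinearMap.mul_apply',
    ContinuousLinearEquiv.coe_coe, Complex.conjCLE_apply] at h
  simp only [opD_apply, map_mul, map_neg, Complex.conj_I]
  have e1 : (fun x => (starRingEnd ℂ) (φ x) * (-Complex.I * deriv ψ x)) =
      fun x => -Complex.I * ((starRingEnd ℂ) (φ x) * deriv ψ x) := by ext x; ring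
  have e2 : (fun x => -(-Complex.I) * (starRingEnd ℂ) (deriv φ x) * ψ x) =
      fun x => Complex.I * ((starRingEnd ℂ) (deriv φ x) * ψ x) := by ext x; ring
  rw [e1, e2, integral_const_mul, integral_const_mul, h]
  ring

/-- The first order operator `α x + β D`. -/
def ladder (α β : ℂ) : 𝓢(ℝ, ℂ) →L[ℂ] 𝓢(ℝ, ℂ) := α • opX + β • opD

theorem ladder_apply (α β : ℂ) (φ : 𝓢(ℝ, ℂ)) : ladder α β φ = α • opX φ + β • opD φ := rfl

theorem inner_ladder (α β : ℂ) (φ ψ : 𝓢(ℝ, ℂ)) :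
    ⟪schwartzToL2 (ladder (star α) (star β) φ), schwartzToL2 ψ⟫_ℂ =
      ⟪schwartzToL2 φ, schwartzToL2 (ladder α β ψ)⟫_ℂ := by
  simp only [ladder_apply, map_add, map_smul, inner_add_left, inner_add_right, inner_smul_left,
    inner_smul_right, inner_opX, inner_opD, RCLike.star_def, RCLike.conj_conj]

theorem inner_ladder' (α β : ℂ) (φ ψ : 𝓢(ℝ, ℂ)) :
    ⟪schwartzToL2 (ladder α β φ), schwartzToL2 ψ⟫_ℂ =
      ⟪schwartzToL2 φ, schwartzToL2 (ladder (star α) (star β) ψ)⟫_ℂ := by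
  simpa using inner_ladder (star α) (star β) φ ψ

/-- The commutator is `i (αβ̄ - ᾱβ) = -2 Im(αβ̄)`; the normalization of `α, β` is exactly what makes
it equal to one. -/
theorem ladder_comm {α β : ℂ} (h : (α * star β).im = -1 / 2) (φ : 𝓢(ℝ, ℂ)) :
    ladder α β (ladder (star α) (star β) φ) = ladder (star α) (star β) (ladder α β φ) + φ := by
  have hc : α * star β - star α * β = -Complex.I := by
    have : star α * β = star (α * star β) := by simp [mul_comm]
    rw [this]
    apply Complex.ext
    · simp
    · simp only [Complex.sub_im, RCLike.star_def, Complex.conj_im, Complex.neg_im, Complex.I_im] at h ⊢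
      rw [h]; norm_num
  have hc' : -Complex.I * (β * star α) + Complex.I * (star β * α) = 1 := by
    linear_combination Complex.I * hc - Complex.I_mul_I
  simp only [ladder_apply, map_add, map_smul, opD_opX, smul_add, smul_sub, smul_smul]
  ext x
  simp only [add_apply, sub_apply, smul_apply, smul_eq_mul]
  linear_combination (φ x) * hc'

end

section

/-! ### Completeness of Hermite functions -/

/-- A function with vanishing Fourier transform vanishes almost everywhere. -/
theorem ae_eq_zero_of_fourier_eq_zero {F : ℝ → ℂ} (hF : Integrable F)
    (h : ∀ t : ℝ, FourierTransform.fourier F t = 0) : ∀ᵐ x, F x = 0 := by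
  -- The multiplication formula moves the Fourier transform from `φ` to `F`. Every test function is
  -- a Fourier transform of a Schwartz function, so this suffices.
  have key : ∀ φ : 𝓢(ℝ, ℂ), ∫ x, F x * FourierTransform.fourier φ x = 0 := by
    intro φ
    have := VectorFourier.integral_bilin_fourierIntegral_eq_flip (μ := volume) (ν := volume)
      (ContinuousLinearMap.mul ℂ ℂ) (L := innerₗ ℝ) Real.continuous_fourierChar
      continuous_inner hF φ.integrable
    have h0 : ∀ t, VectorFourier.fourierIntegral Real.fourierChar volume (innerₗ ℝ) F t = 0 := h
    simp only [h0, ContinuousLinearMap.mul_apply', zero_mul, integral_zero] at this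
    rw [this]
    congr 1
    ext x
    congr 1
    simp [SchwartzMap.fourier_coe]
    rfl
  refine ae_eq_zero_of_integral_contDiff_smul_eq_zero hF.locallyIntegrable fun g hg hc => ?_
  have hc' : HasCompactSupport (fun x => (g x : ℂ)) := hc.comp_left (g := Complex.ofReal) rfl
  have hg' : ContDiff ℝ (⊤ : ℕ∞) (fun x => (g x : ℂ)) := Complex.ofRealCLM.contDiff.comp hg
  have := key (FourierTransformInv.fourierInv (hc'.toSchwartzMap hg'))
  rw [FourierTransform.fourier_fourierInv_eq] at this
  rw [← this]
  congr 1
  ext x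
  rw [HasCompactSupport.toSchwartzMap_toFun, Complex.real_smul, mul_comm]

/-- A function with exponential decay all of whose moments vanish is zero. -/
theorem ae_eq_zero_of_moments_eq_zero {F : ℝ → ℂ} (hF : AEStronglyMeasurable F)
    (hi : ∀ s : ℝ, Integrable fun x => Real.exp (s * |x|) * ‖F x‖)
    (h : ∀ n : ℕ, ∫ x : ℝ, (x : ℂ) ^ n * F x = 0) : ∀ᵐ x, F x = 0 := by
  have hFi : Integrable F := by
    rw [← integrable_norm_iff hF]
    simpa using hi 0
  refine ae_eq_zero_of_fourier_eq_zero hFi fun t => ?_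
  -- The Fourier kernel is expanded in powers of `x`, dominated by `exp(2π|t||x|) |F|`; the
  -- integrated terms are multiples of the moments.
  have hs := hasSum_integral_of_dominated_convergence (μ := (volume : Measure ℝ))
    (F := fun (n : ℕ) (x : ℝ) => ((-(2 * Real.pi * t) * Complex.I) * x) ^ n / n.factorial * F x)
    (f := fun x : ℝ => Complex.exp ((-(2 * Real.pi * t) * Complex.I) * x) * F x)
    (fun n x => (2 * Real.pi * |t| * |x|) ^ n / n.factorial * ‖F x‖)
    (fun n => by
      refine AEStronglyMeasurable.mul ?_ hF
      exact Continuous.aestronglyMeasurable (by fun_prop))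
    (fun n => Filter.Eventually.of_forall fun x => by
      rw [norm_mul, norm_div, norm_pow]
      simp [abs_of_pos Real.pi_pos, mul_assoc])
    (Filter.Eventually.of_forall fun x =>
      (Real.summable_pow_div_factorial _).mul_right _)
    (by
      have : (fun x => ∑' n : ℕ, (2 * Real.pi * |t| * |x|) ^ n / n.factorial * ‖F x‖) =
          fun x => Real.exp ((2 * Real.pi * |t|) * |x|) * ‖F x‖ := by
        ext x
        rw [tsum_mul_right, Real.exp_eq_exp_ℝ, NormedSpace.exp_eq_tsum_div]
      rw [this]
      exact hi _)
    (Filter.Eventually.of_forall fun x => by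
      refine HasSum.mul_right _ ?_
      rw [Complex.exp_eq_exp_ℂ]
      exact NormedSpace.expSeries_div_hasSum_exp _)
  have hz : ∀ n : ℕ, ∫ x : ℝ, ((-(2 * Real.pi * t) * Complex.I) * x) ^ n / n.factorial * F x = 0 := by
    intro n
    have : (fun x : ℝ => ((-(2 * Real.pi * t) * Complex.I) * x) ^ n / n.factorial * F x) =
        fun x : ℝ => ((-(2 * Real.pi * t) * Complex.I) ^ n / n.factorial) * ((x : ℂ) ^ n * F x) := by
      ext x
      rw [mul_pow]
      ring
    rw [this, integral_const_mul, h n, mul_zero]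
  simp only [hz] at hs
  rw [Real.fourier_real_eq_integral_exp_smul]
  rw [← hs.unique hasSum_zero]
  congr 1
  ext x
  rw [smul_eq_mul]
  congr 2
  push_cast
  ring

/-! ### Hermite functions adapted to a pair of ladder operators -/

/-- The exponent `γ = iα/β` is the one for which `αx + βD` annihilates `exp(-γx²/2)`. Its real part
is `-Im(αβ̄)/|β|²`, so the normalization makes the ground state square integrable. -/
theorem gaussian_param_pos {α β : ℂ} (h : (α * star β).im = -1 / 2) :
    0 < (Complex.I * α / β).re := by
  have hβ : β ≠ 0 := by
    rintro rfl
    simp at h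
    norm_num at h
  have h2 : Complex.I * α / β = Complex.I * (α * star β) * ((Complex.normSq β)⁻¹ : ℝ) := by
    rw [div_eq_mul_inv, Complex.inv_def]
    simp only [RCLike.star_def]
    ring
  rw [h2, Complex.re_mul_ofReal, Complex.I_mul_re, h]
  have := Complex.normSq_pos.2 hβ
  positivity

/-- The normalized ground state of `α x + β D`. -/
def groundState {α β : ℂ} (h : (α * star β).im = -1 / 2) : 𝓢(ℝ, ℂ) :=
  ((‖schwartzToL2 (gaussianSchwartz _ (gaussian_param_pos h))‖⁻¹ : ℝ) : ℂ) •
    gaussianSchwartz _ (gaussian_param_pos h)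

/-- The Hermite functions generated by `ᾱ x + β̄ D` from the ground state of `α x + β D`. -/
def hermiteFn {α β : ℂ} (h : (α * star β).im = -1 / 2) : ℕ → 𝓢(ℝ, ℂ)
  | 0 => groundState h
  | n + 1 => ((Real.sqrt (n + 1))⁻¹ : ℂ) • ladder (star α) (star β) (hermiteFn h n)

variable {α β : ℂ} (h : (α * star β).im = -1 / 2)

theorem ladder_groundState : ladder α β (groundState h) = 0 := by
  have hβ : β ≠ 0 := by
    rintro rfl
    simp at h
    norm_num at h
  rw [groundState, map_smul]
  have : ladder α β (gaussianSchwartz _ (gaussian_param_pos h)) = 0 := by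
    ext x
    have hd := hasDerivAt_polynomial_gaussian (Complex.I * α / β) 1 x
    simp only [Polynomial.eval_one, one_mul] at hd
    rw [ladder_apply, add_apply, smul_apply, smul_apply, opX_apply, opD_apply,
      gaussianSchwartz_apply, smul_eq_mul, smul_eq_mul]
    change _ + β * (-Complex.I * deriv (fun x : ℝ => Complex.exp (-(Complex.I * α / β) * (x : ℂ) ^ 2 / 2)) x) = 0
    rw [hd.deriv]
    simp only [Polynomial.derivative_one, zero_sub, mul_one, Polynomial.eval_neg,
      Polynomial.eval_mul, Polynomial.eval_C, Polynomial.eval_X]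
    have e : β * (Complex.I * α / β) = Complex.I * α := by field_simp
    linear_combination (Complex.I * x * Complex.exp (-(Complex.I * α / β) * (x : ℂ) ^ 2 / 2)) * e +
      (α * x * Complex.exp (-(Complex.I * α / β) * (x : ℂ) ^ 2 / 2)) * Complex.I_mul_I
  rw [this, smul_zero]

theorem norm_groundState : ‖schwartzToL2 (groundState h)‖ = 1 := by
  have hne : gaussianSchwartz _ (gaussian_param_pos h) ≠ 0 := by
    intro h0
    have := DFunLike.congr_fun h0 0
    simp [gaussianSchwartz_apply] at this
  have hne' : ‖schwartzToL2 (gaussianSchwartz _ (gaussian_param_pos h))‖ ≠ 0 := by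
    rw [norm_ne_zero_iff]
    intro h0
    exact hne (schwartzToL2_injective (by rw [h0, map_zero]))
  rw [groundState, map_smul, norm_smul, Complex.norm_real, norm_inv, norm_norm,
    inv_mul_cancel₀ hne']

theorem sqrt_succ_ne (n : ℕ) : ((Real.sqrt (n + 1) : ℝ) : ℂ) ≠ 0 := by
  rw [Complex.ofReal_ne_zero]
  positivity

theorem sqrt_succ_mul (n : ℕ) :
    ((Real.sqrt (n + 1) : ℝ) : ℂ) * ((Real.sqrt (n + 1) : ℝ) : ℂ) = (n : ℂ) + 1 := by
  rw [← Complex.ofReal_mul, Real.mul_self_sqrt (by positivity)]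
  push_cast
  rfl

theorem creation_hermiteFn (n : ℕ) : ladder (star α) (star β) (hermiteFn h n) =
    ((Real.sqrt (n + 1) : ℝ) : ℂ) • hermiteFn h (n + 1) := by
  rw [hermiteFn, smul_smul, mul_inv_cancel₀ (sqrt_succ_ne n), one_smul]

theorem annihilation_hermiteFn_succ (n : ℕ) : ladder α β (hermiteFn h (n + 1)) =
    ((Real.sqrt (n + 1) : ℝ) : ℂ) • hermiteFn h n := by
  -- From `a a* = a* a + 1`, the eigenvalue `n` of `a* a` on the `n`-th function gives the lowering
  -- relation one level up; that relation in turn yields the eigenvalue `n + 1`.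
  have key : ∀ n : ℕ,
      ladder (star α) (star β) (ladder α β (hermiteFn h n)) = (n : ℂ) • hermiteFn h n →
      ladder α β (hermiteFn h (n + 1)) = ((Real.sqrt (n + 1) : ℝ) : ℂ) • hermiteFn h n := by
    intro n hn
    rw [hermiteFn, map_smul, ladder_comm h, hn]
    have : (n : ℂ) • hermiteFn h n + hermiteFn h n = ((n : ℂ) + 1) • hermiteFn h n := by
      rw [add_smul, one_smul]
    rw [this, smul_smul, ← sqrt_succ_mul, ← mul_assoc, inv_mul_cancel₀ (sqrt_succ_ne n), one_mul]
  induction n with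
  | zero =>
    apply key
    rw [hermiteFn, ladder_groundState, map_zero, Nat.cast_zero, zero_smul]
  | succ n ih =>
    apply key
    rw [ih, map_smul, creation_hermiteFn, smul_smul, sqrt_succ_mul]
    push_cast
    rfl

theorem inner_hermiteFn (m n : ℕ) :
    ⟪schwartzToL2 (hermiteFn h m), schwartzToL2 (hermiteFn h n)⟫_ℂ = if m = n then 1 else 0 := by
  induction m generalizing n with
  | zero =>
    cases n with
    | zero =>
      rw [hermiteFn, inner_self_eq_norm_sq_to_K, norm_groundState]
      simp
    | succ k =>
      rw [hermiteFn, hermiteFn, map_smul, inner_smul_right, ← inner_ladder', ladder_groundState]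
      simp
  | succ m ih =>
    rw [hermiteFn, map_smul, inner_smul_left, inner_ladder]
    cases n with
    | zero =>
      rw [hermiteFn, ladder_groundState]
      simp
    | succ k =>
      rw [annihilation_hermiteFn_succ, map_smul, inner_smul_right, ih]
      by_cases hmk : m = k
      · subst hmk
        simp only [if_true, mul_one]
        rw [map_inv₀, Complex.conj_ofReal, inv_mul_cancel₀ (sqrt_succ_ne m)]
      · simp [hmk]

theorem orthonormal_hermiteFn : Orthonormal ℂ fun n => schwartzToL2 (hermiteFn h n) := by
  rw [orthonormal_iff_ite]
  exact inner_hermiteFn h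

/-- The span of the Hermite functions is stable under both ladder operators, hence under
multiplication by `x`, which is a combination of them. This converts orthogonality to Hermite
functions into vanishing moments. -/
theorem opX_pow_groundState_mem (n : ℕ) :
    (opX ^ n) (groundState h) ∈ Submodule.span ℂ (Set.range (hermiteFn h)) := by
  have hA : ∀ φ ∈ Submodule.span ℂ (Set.range (hermiteFn h)),
      ladder α β φ ∈ Submodule.span ℂ (Set.range (hermiteFn h)) := by
    intro φ hφ
    induction hφ using Submodule.span_induction with
    | mem x hx =>
      obtain ⟨k, rfl⟩ := hx
      cases k with
      | zero => rw [hermiteFn, ladder_groundState]; exact Submodule.zero_mem _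
      | succ k =>
        rw [annihilation_hermiteFn_succ]
        exact Submodule.smul_mem _ _ (Submodule.subset_span ⟨k, rfl⟩)
    | zero => rw [map_zero]; exact Submodule.zero_mem _
    | add x y _ _ hx hy => rw [map_add]; exact Submodule.add_mem _ hx hy
    | smul a x _ hx => rw [map_smul]; exact Submodule.smul_mem _ _ hx
  have hB : ∀ φ ∈ Submodule.span ℂ (Set.range (hermiteFn h)),
      ladder (star α) (star β) φ ∈ Submodule.span ℂ (Set.range (hermiteFn h)) := by
    intro φ hφ
    induction hφ using Submodule.span_induction with
    | mem x hx =>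
      obtain ⟨k, rfl⟩ := hx
      rw [creation_hermiteFn]
      exact Submodule.smul_mem _ _ (Submodule.subset_span ⟨k + 1, rfl⟩)
    | zero => rw [map_zero]; exact Submodule.zero_mem _
    | add x y _ _ hx hy => rw [map_add]; exact Submodule.add_mem _ hx hy
    | smul a x _ hx => rw [map_smul]; exact Submodule.smul_mem _ _ hx
  have hc : α * star β - star α * β = -Complex.I := by
    have : star α * β = star (α * star β) := by simp [mul_comm]
    rw [this]
    apply Complex.ext
    · simp
    · simp only [Complex.sub_im, RCLike.star_def, Complex.conj_im, Complex.neg_im, Complex.I_im] at h ⊢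
      rw [h]; norm_num
  have hX : ∀ φ : 𝓢(ℝ, ℂ), opX φ = (Complex.I * star β) • ladder α β φ -
      (Complex.I * β) • ladder (star α) (star β) φ := by
    intro φ
    ext x
    simp only [ladder_apply, sub_apply, smul_apply, add_apply, smul_eq_mul]
    linear_combination (-Complex.I * opX φ x) * hc + (opX φ x) * Complex.I_mul_I
  induction n with
  | zero => exact Submodule.subset_span ⟨0, rfl⟩
  | succ n ih =>
    rw [pow_succ', mul_apply_eq_comp, hX]
    exact Submodule.sub_mem _ (Submodule.smul_mem _ _ (hA _ ih)) (Submodule.smul_mem _ _ (hB _ ih))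

/-- Completing the square absorbs the exponential into half of the Gaussian; the other half remains
for the Cauchy–Schwarz inequality. -/
theorem exp_mul_gaussian_le {b : ℝ} (hb : 0 < b) (s x : ℝ) :
    Real.exp (s * |x|) * Real.exp (-(b * x ^ 2)) ≤
      Real.exp (s ^ 2 / (2 * b)) * Real.exp (-(b / 2) * x ^ 2) := by
  rw [← Real.exp_add, ← Real.exp_add, Real.exp_le_exp]
  have h1 : 0 ≤ b / 2 * (|x| - s / b) ^ 2 := by positivity
  have h2 : b / 2 * (|x| - s / b) ^ 2 = b / 2 * x ^ 2 - s * |x| + s ^ 2 / (2 * b) := by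
    rw [sub_sq, sq_abs]
    field_simp
  nlinarith

/-- If `f` is orthogonal to every Hermite function, all moments of `Ḡ f` vanish, where `G` is the
Gaussian. This product is integrable against every exponential, hence zero, and `G` has no zeros. -/
theorem orthogonal_hermiteFn :
    (Submodule.span ℂ (Set.range fun n => schwartzToL2 (hermiteFn h n)))ᗮ = ⊥ := by
  rw [Submodule.eq_bot_iff]
  intro f hf
  set γ := Complex.I * α / β with hγ
  have hγp : 0 < γ.re := gaussian_param_pos h
  set G := gaussianSchwartz γ hγp with hG
  have hspan : ∀ φ ∈ Submodule.span ℂ (Set.range (hermiteFn h)), ⟪schwartzToL2 φ, f⟫_ℂ = 0 := by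
    intro φ hφ
    refine (Submodule.mem_orthogonal _ f).1 hf _ ?_
    have : Set.range (fun n => schwartzToL2 (hermiteFn h n)) =
        schwartzToL2 '' Set.range (hermiteFn h) := by
      rw [← Set.range_comp]; rfl
    rw [this, Submodule.span_image]
    exact Submodule.mem_map_of_mem hφ
  have hpow : ∀ (n : ℕ) (φ : 𝓢(ℝ, ℂ)) (x : ℝ), (opX ^ n) φ x = (x : ℂ) ^ n * φ x := by
    intro n φ x
    induction n with
    | zero => simp
    | succ n ih => rw [pow_succ', mul_apply_eq_comp, opX_apply, ih]; ring
  have hinner : ∀ φ : 𝓢(ℝ, ℂ), ⟪schwartzToL2 φ, f⟫_ℂ = ∫ x, (starRingEnd ℂ) (φ x) * f x := by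
    intro φ
    rw [L2.inner_def]
    refine integral_congr_ae ?_
    filter_upwards [φ.coeFn_toLp 2 volume] with x hx
    rw [RCLike.inner_apply']
    change (starRingEnd ℂ) ((φ.toLp 2 volume : ℝ → ℂ) x) * f x = _
    rw [hx]
  have hN : (‖schwartzToL2 G‖ : ℝ) ≠ 0 := by
    have := norm_groundState h
    intro h0
    rw [groundState, map_smul, norm_smul] at this
    change _ * ‖schwartzToL2 G‖ = 1 at this
    rw [h0] at this
    simp at this
  have hmom : ∀ n : ℕ, ∫ x : ℝ, (x : ℂ) ^ n * ((starRingEnd ℂ) (G x) * f x) = 0 := by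
    intro n
    have := hspan _ (opX_pow_groundState_mem h n)
    rw [groundState, map_smul, map_smul, inner_smul_left] at this
    have h1 : ⟪schwartzToL2 ((opX ^ n) G), f⟫_ℂ = 0 := by
      refine (mul_eq_zero.1 this).resolve_left ?_
      simpa using hN
    rw [hinner] at h1
    rw [← h1]
    congr 1
    ext x
    rw [hpow, map_mul, map_pow, Complex.conj_ofReal]
    ring
  have hmeas : AEStronglyMeasurable (fun x => (starRingEnd ℂ) (G x) * f x) := by
    refine AEStronglyMeasurable.mul ?_ (Lp.aestronglyMeasurable f)
    exact (Complex.continuous_conj.comp G.continuous).aestronglyMeasurable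
  have hnG : ∀ x : ℝ, ‖G x‖ = Real.exp (-(γ.re / 2 * x ^ 2)) := by
    intro x
    rw [hG, gaussianSchwartz_apply, Complex.norm_exp]
    congr 1
    have : -γ * (x : ℂ) ^ 2 / 2 = -γ * ((x ^ 2 / 2 : ℝ) : ℂ) := by push_cast; ring
    rw [this, Complex.re_mul_ofReal, Complex.neg_re]
    ring
  have hzero := ae_eq_zero_of_moments_eq_zero hmeas (fun s => ?_) hmom
  · rw [Lp.eq_zero_iff_ae_eq_zero]
    filter_upwards [hzero] with x hx
    refine (mul_eq_zero.1 hx).resolve_left ?_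
    change _ ≠ _
    rw [← norm_ne_zero_iff, RCLike.norm_conj, hnG]
    exact (Real.exp_pos _).ne'
  · set b := γ.re / 2 with hb
    have hbp : 0 < b := half_pos hγp
    have hg4 : 0 < ((b : ℝ) : ℂ).re := by simpa using hbp
    -- With `b = Re γ / 2` this Gaussian is `exp(-b x²/2)`, the factor left over by
    -- `exp_mul_gaussian_le` from `|G| = exp(-b x²)`.
    have hint : Integrable fun x => ‖gaussianSchwartz ((b : ℝ) : ℂ) hg4 x‖ * ‖f x‖ := by
      refine MemLp.integrable_mul (p := 2) (q := 2) ?_ ?_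
      · exact ((gaussianSchwartz ((b : ℝ) : ℂ) hg4).memLp 2 volume).norm
      · exact (Lp.memLp f).norm
    refine Integrable.mono' (hint.const_mul (Real.exp (s ^ 2 / (2 * b)))) ?_ ?_
    · refine AEStronglyMeasurable.mul ?_ hmeas.norm
      exact Continuous.aestronglyMeasurable (by fun_prop)
    · refine Filter.Eventually.of_forall fun x => ?_
      rw [Real.norm_eq_abs, abs_of_nonneg (by positivity), norm_mul, RCLike.norm_conj, hnG,
        ← mul_assoc, ← mul_assoc]
      refine mul_le_mul_of_nonneg_right ?_ (norm_nonneg _)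
      refine (exp_mul_gaussian_le hbp s x).trans (le_of_eq ?_)
      rw [gaussianSchwartz_apply, Complex.norm_exp]
      congr 2
      have : -((b : ℝ) : ℂ) * (x : ℂ) ^ 2 / 2 = ((-(b / 2) * x ^ 2 : ℝ) : ℂ) := by push_cast; ring
      rw [this, Complex.ofReal_re]

/-- The Hilbert basis of Hermite functions. -/
def hermiteBasis : HilbertBasis ℕ ℂ L2R :=
  HilbertBasis.mkOfOrthogonalEqBot (orthonormal_hermiteFn h) (orthogonal_hermiteFn h)

theorem hermiteBasis_apply (n : ℕ) : hermiteBasis h n = schwartzToL2 (hermiteFn h n) := by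
  simp [hermiteBasis]

end

section

/-! ### The Weyl operator in the Hermite basis -/

/-- The weight `√(n (n - 1))` of the squared creation operator. -/
def shiftWeight (n : ℕ) : ℝ := Real.sqrt (n * ((n : ℝ) - 1))

theorem shiftWeight_add_two (n : ℕ) :
    shiftWeight (n + 2) = Real.sqrt (n + 1) * Real.sqrt ((n + 1 : ℕ) + 1) := by
  rw [shiftWeight, ← Real.sqrt_mul (by positivity)]
  congr 1
  push_cast
  ring

/-- The weight vanishes for `n < 2`, just where the truncated index `n - 2` is meaningless, so no
boundary cases arise in the matrix. -/
theorem shiftWeight_zero : shiftWeight 0 = 0 := by simp [shiftWeight]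

theorem shiftWeight_one : shiftWeight 1 = 0 := by simp [shiftWeight]

variable {α β : ℂ} (h : (α * star β).im = -1 / 2)

/-- Weyl quantization of `|ℓ|²` is the symmetrization `(a*a + aa*)/2 = a*a + 1/2`. The square is
`ℓ²` and not `ℓ̄²` because the identity is applied to the formal adjoint. -/
theorem weylSchwartz_eq_ladder {α β : ℂ} (h : (α * star β).im = -1 / 2) (c C : ℂ) (φ : 𝓢(ℝ, ℂ)) :
    weylSchwartz (c * (α * star α - C * α ^ 2)) (c * (α * star β + star α * β - 2 * C * α * β))
      (c * (β * star β - C * β ^ 2)) φ =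
    c • (ladder (star α) (star β) (ladder α β φ) + (1 / 2 : ℂ) • φ -
      C • ladder α β (ladder α β φ)) := by
  have hc : α * star β - star α * β = -Complex.I := by
    have : star α * β = star (α * star β) := by simp [mul_comm]
    rw [this]
    apply Complex.ext
    · simp
    · simp only [Complex.sub_im, RCLike.star_def, Complex.conj_im, Complex.neg_im, Complex.I_im] at h ⊢
      rw [h]; norm_num
  have e : weylSchwartz (c * (α * star α - C * α ^ 2))
      (c * (α * star β + star α * β - 2 * C * α * β)) (c * (β * star β - C * β ^ 2)) φ =
      (c * (α * star α - C * α ^ 2)) • opX (opX φ) +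
      (c * (α * star β + star α * β - 2 * C * α * β) / 2) • (opX (opD φ) + opD (opX φ)) +
      (c * (β * star β - C * β ^ 2)) • opD (opD φ) := rfl
  rw [e]
  simp only [ladder_apply, map_add, map_smul, opD_opX]
  ext x
  simp only [add_apply, sub_apply, smul_apply, smul_eq_mul]
  linear_combination (c * (φ x) * Complex.I / 2) * hc - (c * φ x / 2) * Complex.I_mul_I

theorem inner_hermiteFn_number (n : ℕ) (φ : 𝓢(ℝ, ℂ)) :
    ⟪schwartzToL2 (hermiteFn h n), schwartzToL2 (ladder (star α) (star β) (ladder α β φ))⟫_ℂ =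
      n * ⟪schwartzToL2 (hermiteFn h n), schwartzToL2 φ⟫_ℂ := by
  rw [← inner_ladder', ← inner_ladder]
  cases n with
  | zero => rw [hermiteFn, ladder_groundState]; simp
  | succ n =>
    rw [annihilation_hermiteFn_succ, map_smul, creation_hermiteFn, smul_smul, sqrt_succ_mul,
      map_smul, inner_smul_left]
    simp

theorem inner_hermiteFn_annihilation_sq (n : ℕ) (φ : 𝓢(ℝ, ℂ)) :
    ⟪schwartzToL2 (hermiteFn h n), schwartzToL2 (ladder α β (ladder α β φ))⟫_ℂ =
      shiftWeight (n + 2) * ⟪schwartzToL2 (hermiteFn h (n + 2)), schwartzToL2 φ⟫_ℂ := by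
  rw [← inner_ladder, ← inner_ladder, creation_hermiteFn, map_smul, creation_hermiteFn, smul_smul,
    map_smul, inner_smul_left, map_mul, Complex.conj_ofReal, Complex.conj_ofReal,
    shiftWeight_add_two]
  push_cast
  rfl

theorem number_hermiteFn (n : ℕ) :
    ladder (star α) (star β) (ladder α β (hermiteFn h n)) = (n : ℂ) • hermiteFn h n := by
  cases n with
  | zero => rw [hermiteFn, ladder_groundState]; simp
  | succ n =>
    rw [annihilation_hermiteFn_succ, map_smul, creation_hermiteFn, smul_smul, sqrt_succ_mul]
    push_cast
    rfl

theorem annihilation_sq_hermiteFn (n : ℕ) :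
    ladder α β (ladder α β (hermiteFn h n)) = (shiftWeight n : ℂ) • hermiteFn h (n - 2) := by
  match n with
  | 0 => rw [hermiteFn, ladder_groundState, shiftWeight_zero]; simp
  | 1 =>
    rw [annihilation_hermiteFn_succ, map_smul, hermiteFn, ladder_groundState, shiftWeight_one]
    simp
  | n + 2 =>
    rw [annihilation_hermiteFn_succ, map_smul, annihilation_hermiteFn_succ, smul_smul,
      shiftWeight_add_two, mul_comm]
    push_cast
    rfl

variable {q : QuadraticMap ℝ (ℝ × ℝ) ℂ} {c C : ℂ}

/-- On the maximal domain, `weylOp q u = f` is a weak equation against Schwartz functions. Testing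
on Hermite functions gives the coordinate equations; conversely Parseval recovers every Schwartz
test function. No core or closure argument is needed. -/
theorem weylOp_graph_iff
    (hxx : coeffXX q = c * (α * star α - C * star α ^ 2))
    (hxxi : coeffXXi q = c * (α * star β + star α * β - 2 * C * star α * star β))
    (hxixi : coeffXiXi q = c * (β * star β - C * star β ^ 2)) (u f : L2R) :
    (∃ hu : u ∈ (weylOp q).domain, weylOp q ⟨u, hu⟩ = f) ↔
      ∀ n : ℕ, (hermiteBasis h).repr f n = c * ((n + 1 / 2) * (hermiteBasis h).repr u n -
        C * shiftWeight n * (hermiteBasis h).repr u (n - 2)) := by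
  rw [mem_weylOp_graph_iff]
  have hT : ∀ φ : 𝓢(ℝ, ℂ), weylSchwartz (star (coeffXX q)) (star (coeffXXi q))
      (star (coeffXiXi q)) φ = star c • (ladder (star α) (star β) (ladder α β φ) +
        (1 / 2 : ℂ) • φ - star C • ladder α β (ladder α β φ)) := by
    intro φ
    rw [← weylSchwartz_eq_ladder h, hxx, hxxi, hxixi]
    simp only [star_mul', star_sub, star_add, star_star, star_pow, star_ofNat]
    congr 3 <;> ring
  simp only [hT]
  constructor
  · intro hf n
    have hn := hf (hermiteFn h n)
    rw [number_hermiteFn, annihilation_sq_hermiteFn] at hn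
    simp only [map_smul, map_add, map_sub, inner_smul_right, inner_add_right, inner_sub_right,
      ← hermiteBasis_apply] at hn
    have hn' := congrArg (starRingEnd ℂ) hn
    simp only [map_mul, map_add, map_sub, inner_conj_symm, RCLike.star_def, RCLike.conj_conj,
      Complex.conj_ofReal, map_natCast, map_div₀, map_one, map_ofNat] at hn'
    simp only [HilbertBasis.repr_apply_apply]
    rw [hn']
    ring
  · intro hf φ
    set b := hermiteBasis h with hb
    have H0 := b.hasSum_inner_mul_inner u (schwartzToL2 φ)
    have H1 := b.hasSum_inner_mul_inner u
      (schwartzToL2 (ladder (star α) (star β) (ladder α β φ)))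
    have H2 := b.hasSum_inner_mul_inner u (schwartzToL2 (ladder α β (ladder α β φ)))
    simp only [hb, hermiteBasis_apply, inner_hermiteFn_number] at H1
    simp only [hb, hermiteBasis_apply, inner_hermiteFn_annihilation_sq] at H2
    -- Reindexing by two places is free, since the two new terms carry the weights at `0` and `1`,
    -- which vanish.
    have H2' : HasSum (fun n : ℕ => ⟪u, b (n - 2)⟫_ℂ * (shiftWeight n * ⟪b n, schwartzToL2 φ⟫_ℂ))
        ⟪u, schwartzToL2 (ladder α β (ladder α β φ))⟫_ℂ := by
      rw [← hasSum_nat_add_iff' 2]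
      simpa [Finset.sum_range_succ, shiftWeight_zero, shiftWeight_one, hb, hermiteBasis_apply]
        using H2
    have H := b.hasSum_inner_mul_inner f (schwartzToL2 φ)
    simp only [← hermiteBasis_apply, ← hb] at H1
    have HT := ((H1.add (H0.mul_left (1 / 2 : ℂ))).sub (H2'.mul_left (star C))).mul_left (star c)
    have hterm : (fun n : ℕ => ⟪f, b n⟫_ℂ * ⟪b n, schwartzToL2 φ⟫_ℂ) = fun n : ℕ => star c *
        (⟪u, b n⟫_ℂ * (n * ⟪b n, schwartzToL2 φ⟫_ℂ) + 1 / 2 * (⟪u, b n⟫_ℂ * ⟪b n, schwartzToL2 φ⟫_ℂ)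
        - star C * (⟪u, b (n - 2)⟫_ℂ * (shiftWeight n * ⟪b n, schwartzToL2 φ⟫_ℂ))) := by
      ext n
      have hn := congrArg (starRingEnd ℂ) (hf n)
      simp only [HilbertBasis.repr_apply_apply, map_mul, map_add, map_sub, inner_conj_symm,
        Complex.conj_ofReal, map_natCast, map_div₀, map_one, map_ofNat] at hn
      rw [hn]
      simp only [RCLike.star_def]
      ring
    rw [hterm] at H
    rw [H.unique HT]
    simp only [map_smul, map_add, map_sub, inner_smul_right, inner_add_right, inner_sub_right]

end

section

/-! ### Weighted shifts on `ℓ²` -/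

/-- The Hilbert space `ℓ²(ℕ; ℂ)`. -/
abbrev Ell2 : Type := lp (fun _ : ℕ => ℂ) 2

theorem ell2_summable_norm_sq (x : Ell2) : Summable fun n => ‖x n‖ ^ 2 := by
  have := (lp.hasSum_norm (p := 2) (by simp) x).summable
  simpa using this

theorem ell2_norm_sq (x : Ell2) : ‖x‖ ^ 2 = ∑' n, ‖x n‖ ^ 2 := by
  have := lp.norm_rpow_eq_tsum (p := 2) (by simp) x
  simpa using this

theorem memℓp_two_of_summable {x : ℕ → ℂ} (hx : Summable fun n => ‖x n‖ ^ 2) : Memℓp x 2 :=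
  memℓp_gen (by simpa using hx)

theorem weighted_shift_summable {w : ℕ → ℂ} {k : ℕ} {M : ℝ} (hw : ∀ n, ‖w n‖ ≤ M) (x : Ell2) :
    Summable fun n => ‖w n * x (n - k)‖ ^ 2 := by
  rw [← summable_nat_add_iff k]
  refine Summable.of_nonneg_of_le (fun n => by positivity) (fun n => ?_)
    ((ell2_summable_norm_sq x).mul_left (M ^ 2))
  rw [Nat.add_sub_cancel, norm_mul, mul_pow]
  gcongr
  exact hw _

/-- The bounded operator `(x_n) ↦ (w_n x_{n-k})` on `ℓ²`, for a bounded weight vanishing for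
`n < k`. -/
def weightedShift (w : ℕ → ℂ) (k : ℕ) (M : ℝ) (hw : ∀ n, ‖w n‖ ≤ M) (hk : ∀ n < k, w n = 0) :
    Ell2 →L[ℂ] Ell2 :=
  LinearMap.mkContinuous
    { toFun := fun x => ⟨fun n => w n * x (n - k),
        memℓp_two_of_summable (weighted_shift_summable hw x)⟩
      map_add' := fun x y => by
        ext n
        exact mul_add _ _ _
      map_smul' := fun a x => by
        ext n
        exact mul_left_comm _ _ _ } M (fun x => by
      have hM : 0 ≤ M := (norm_nonneg _).trans (hw 0)
      refine le_of_sq_le_sq ?_ (by positivity)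
      rw [ell2_norm_sq, mul_pow, ell2_norm_sq, ← tsum_mul_left]
      have hs := weighted_shift_summable (k := k) hw x
      change ∑' n, ‖w n * x (n - k)‖ ^ 2 ≤ _
      rw [← hs.sum_add_tsum_nat_add k, Finset.sum_eq_zero, zero_add]
      · refine ((summable_nat_add_iff k).2 hs).tsum_le_tsum (fun n => ?_)
          ((ell2_summable_norm_sq x).mul_left (M ^ 2))
        rw [Nat.add_sub_cancel, norm_mul, mul_pow]
        gcongr
        exact hw _
      · intro n hn
        rw [hk n (Finset.mem_range.1 hn)]
        simp)

theorem norm_weightedShift_le (w : ℕ → ℂ) (k : ℕ) (M : ℝ) (hw : ∀ n, ‖w n‖ ≤ M)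
    (hk : ∀ n < k, w n = 0) : ‖weightedShift w k M hw hk‖ ≤ M :=
  LinearMap.mkContinuous_norm_le _ ((norm_nonneg _).trans (hw 0)) _

/-- A weighted shift by two whose weights are eventually less than one has `1 - E` invertible. -/
theorem isUnit_one_sub_weightedShift {w : ℕ → ℂ} {M r : ℝ} (hw : ∀ n, ‖w n‖ ≤ M)
    (hk : ∀ n < 2, w n = 0) (hr : r < 1) {K : ℕ} (hK : ∀ n, K ≤ n → ‖w n‖ ≤ r) :
    IsUnit (1 - weightedShift w 2 M hw hk) := by
  have hM : 0 ≤ M := (norm_nonneg _).trans (hw 0)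
  have hr0 : 0 ≤ r := (norm_nonneg _).trans (hK K le_rfl)
  -- Conjugation by the diagonal `g n = t ^ min n K` multiplies `w n` by `t²` when `2 ≤ n < K`, and
  -- `t` is chosen so that `t² M ≤ 1/2`. Beyond `K` it does not increase the weights, and both `g`
  -- and `1/g` stay bounded. The conjugated shift has norm below one, so a Neumann series applies.
  set t : ℝ := 1 / (2 * (M + 1)) with ht
  have ht0 : 0 < t := by positivity
  have ht1 : t ≤ 1 := by
    rw [ht, div_le_one (by positivity)]
    linarith
  have htM : t ^ 2 * M ≤ 1 / 2 := by
    have h1 : t * M ≤ 1 / 2 := by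
      rw [ht, div_mul_eq_mul_div, div_le_div_iff₀ (by positivity) (by positivity)]
      linarith
    nlinarith [mul_nonneg ht0.le hM]
  set g : ℕ → ℂ := fun n => ((t ^ min n K : ℝ) : ℂ) with hg
  have hg0 : ∀ n, g n ≠ 0 := fun n => by
    rw [hg, Complex.ofReal_ne_zero]
    positivity
  have hgn : ∀ n, ‖g n‖ = t ^ min n K := fun n => by
    rw [hg, Complex.norm_real, Real.norm_of_nonneg (by positivity)]
  have hgb : ∀ n, ‖g n‖ ≤ 1 := fun n => by
    rw [hgn]
    exact pow_le_one₀ ht0.le ht1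
  have hgib : ∀ n, ‖(g n)⁻¹‖ ≤ (t ^ K)⁻¹ := fun n => by
    rw [norm_inv, hgn]
    refine inv_anti₀ (by positivity) ?_
    exact pow_le_pow_of_le_one ht0.le ht1 (min_le_right _ _)
  set G := weightedShift g 0 1 hgb (by simp) with hG
  set Gi := weightedShift (fun n => (g n)⁻¹) 0 (t ^ K)⁻¹ hgib (by simp) with hGi
  have hw' : ∀ n, ‖g n * w n * (g (n - 2))⁻¹‖ ≤ max r (1 / 2) := by
    intro n
    rw [norm_mul, norm_mul, norm_inv, hgn, hgn]
    rcases lt_or_ge n 2 with h2 | h2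
    · rw [hk n h2]
      simp [hr0]
    rcases le_or_gt K n with hn | hn
    · refine le_trans ?_ (le_max_left _ _)
      have : t ^ min n K ≤ t ^ min (n - 2) K :=
        pow_le_pow_of_le_one ht0.le ht1 (by omega)
      rw [mul_inv_le_iff₀ (by positivity), mul_comm r]
      exact mul_le_mul this (hK n hn) (norm_nonneg _) (by positivity)
    · refine le_trans ?_ (le_max_right _ _)
      have h3 : min n K = min (n - 2) K + 2 := by omega
      rw [h3, mul_inv_le_iff₀ (by positivity), pow_add]
      calc t ^ min (n - 2) K * t ^ 2 * ‖w n‖ ≤ t ^ min (n - 2) K * t ^ 2 * M := by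
            gcongr; exact hw n
        _ = t ^ min (n - 2) K * (t ^ 2 * M) := by ring
        _ ≤ t ^ min (n - 2) K * (1 / 2) := by gcongr
        _ = _ := by ring
  have hk' : ∀ n < 2, g n * w n * (g (n - 2))⁻¹ = 0 := fun n hn => by rw [hk n hn]; simp
  set E' := weightedShift (fun n => g n * w n * (g (n - 2))⁻¹) 2 _ hw' hk' with hE'
  have hlt : ‖E'‖ < 1 := (norm_weightedShift_le _ _ _ _ _).trans_lt (max_lt hr (by norm_num))
  have hu : IsUnit (1 - E') := isUnit_one_sub_of_norm_lt_one hlt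
  have h1 : G * Gi = 1 := by
    ext x n
    change g n * ((g n)⁻¹ * x n) = x n
    rw [mul_inv_cancel_left₀ (hg0 n)]
  have h2 : Gi * G = 1 := by
    ext x n
    change (g n)⁻¹ * (g n * x n) = x n
    rw [inv_mul_cancel_left₀ (hg0 n)]
  have hconj : 1 - weightedShift w 2 M hw hk = Gi * (1 - E') * G := by
    rw [mul_sub, sub_mul, mul_one, h2]
    congr 1
    ext x n
    change w n * x (n - 2) = (g n)⁻¹ * (g n * w n * (g (n - 2))⁻¹ * (g (n - 2) * x (n - 2)))
    have := hg0 n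
    have := hg0 (n - 2)
    field_simp
  rw [hconj]
  exact (IsUnit.mul ⟨⟨Gi, G, h2, h1⟩, rfl⟩ hu).mul ⟨⟨G, Gi, h1, h2⟩, rfl⟩

/-! ### Resolvents of lower triangular operators -/

/-- In the Hilbert basis `b`, the operator `A` acts with its maximal domain as the lower triangular
matrix with diagonal entries `c (n + 1/2)` and entries `-c C √(n (n - 1))` at `(n, n - 2)`. -/
def IsTriangular (b : HilbertBasis ℕ ℂ L2R) (c C : ℂ) (A : L2R →ₗ.[ℂ] L2R) : Prop :=
  ∀ u f : L2R, (∃ hu : u ∈ A.domain, A ⟨u, hu⟩ = f) ↔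
    ∀ n : ℕ, b.repr f n = c * ((n + 1 / 2) * b.repr u n - C * shiftWeight n * b.repr u (n - 2))

variable {b : HilbertBasis ℕ ℂ L2R} {c C : ℂ} {A : L2R →ₗ.[ℂ] L2R}

theorem shiftWeight_nonneg (n : ℕ) : 0 ≤ shiftWeight n := Real.sqrt_nonneg _

theorem shiftWeight_le (n : ℕ) : shiftWeight n ≤ n := by
  rw [shiftWeight]
  refine Real.sqrt_le_iff.2 ⟨by positivity, ?_⟩
  have : (0 : ℝ) ≤ n := by positivity
  nlinarith

/-- The diagonal grows like `|c| n` and the subdiagonal is at most `|c||C| n`, so the limsup of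
their ratio is at most `|C|`; the bound `(1 + |C|)/2` leaves room below one. -/
theorem resolvent_weight_eventually_le (hc : c ≠ 0) (hC : ‖C‖ < 1) (ζ : ℂ) :
    ∃ K : ℕ, ∀ n, K ≤ n →
      ‖-(c * C * shiftWeight n) / (ζ - c * (n + 1 / 2))‖ ≤ (1 + ‖C‖) / 2 := by
  set r := (1 + ‖C‖) / 2 with hr
  set z := ‖ζ / c‖ with hz
  have hrC : 0 < r - ‖C‖ := by rw [hr]; linarith
  obtain ⟨K, hK⟩ := exists_nat_gt (max z (r * z / (r - ‖C‖)))
  refine ⟨K, fun n hn => ?_⟩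
  have hn1 : max z (r * z / (r - ‖C‖)) < n := hK.trans_le (by exact_mod_cast hn)
  have hzn : z < n := (le_max_left _ _).trans_lt hn1
  have hrn : r * z < n * (r - ‖C‖) := by
    rw [← div_lt_iff₀ hrC]
    exact (le_max_right _ _).trans_lt hn1
  have e : -(c * C * shiftWeight n) / (ζ - c * (n + 1 / 2)) =
      C * shiftWeight n / (((n : ℝ) + 1 / 2 : ℝ) - ζ / c) := by
    have : ζ - c * (n + 1 / 2) = -c * ((((n : ℝ) + 1 / 2 : ℝ) : ℂ) - ζ / c) := by
      push_cast
      field_simp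
      ring
    rw [this, show -(c * C * (shiftWeight n : ℂ)) = -c * (C * shiftWeight n) by ring,
      mul_div_mul_left _ _ (neg_ne_zero.2 hc)]
  have hden : (n : ℝ) - z ≤ ‖(((n : ℝ) + 1 / 2 : ℝ) : ℂ) - ζ / c‖ := by
    have h1 := norm_sub_norm_le (((n : ℝ) + 1 / 2 : ℝ) : ℂ) (ζ / c)
    rw [Complex.norm_real, Real.norm_of_nonneg (by positivity)] at h1
    linarith
  rw [e, norm_div, norm_mul, Complex.norm_real, Real.norm_of_nonneg (shiftWeight_nonneg n),
    div_le_iff₀ (by linarith)]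
  have h1 : ‖C‖ * shiftWeight n ≤ ‖C‖ * n := by gcongr; exact shiftWeight_le n
  have hr0 : 0 < r := by rw [hr]; positivity
  have h2 : r * (n - z) ≤ r * ‖(((n : ℝ) + 1 / 2 : ℝ) : ℂ) - ζ / c‖ := by gcongr
  nlinarith

theorem bounded_of_eventually_bounded {w : ℕ → ℂ} {r : ℝ} {K : ℕ} (hK : ∀ n, K ≤ n → ‖w n‖ ≤ r) :
    ∃ M, ∀ n, ‖w n‖ ≤ M := by
  refine ⟨r + ∑ n ∈ Finset.range K, ‖w n‖, fun n => ?_⟩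
  have hr0 : 0 ≤ r := (norm_nonneg _).trans (hK K le_rfl)
  rcases le_or_gt K n with hn | hn
  · have : 0 ≤ ∑ n ∈ Finset.range K, ‖w n‖ := Finset.sum_nonneg fun _ _ => norm_nonneg _
    linarith [hK n hn]
  · have := Finset.single_le_sum (f := fun n => ‖w n‖) (fun _ _ => norm_nonneg _)
      (Finset.mem_range.2 hn)
    linarith

theorem inverse_diagonal_bounded (hc : c ≠ 0) (ζ : ℂ) :
    ∃ M, ∀ n : ℕ, ‖(ζ - c * (n + 1 / 2))⁻¹‖ ≤ M := by
  have hc0 : 0 < ‖c‖ := norm_pos_iff.2 hc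
  obtain ⟨K, hK⟩ := exists_nat_gt ((‖ζ‖ + 1) / ‖c‖)
  refine bounded_of_eventually_bounded (r := 1) (K := K) fun n hn => ?_
  have hn1 : (‖ζ‖ + 1) / ‖c‖ < n := hK.trans_le (by exact_mod_cast hn)
  rw [div_lt_iff₀ hc0] at hn1
  have h1 := norm_sub_norm_le (c * ((n : ℂ) + 1 / 2)) ζ
  have h2 : ‖c * ((n : ℂ) + 1 / 2)‖ = ‖c‖ * (n + 1 / 2) := by
    rw [norm_mul]
    congr 1
    have : (n : ℂ) + 1 / 2 = ((n + 1 / 2 : ℝ) : ℂ) := by push_cast; rfl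
    rw [this, Complex.norm_real, Real.norm_of_nonneg (by positivity)]
  rw [h2, norm_sub_rev] at h1
  rw [norm_inv]
  refine inv_le_one_of_one_le₀ ?_
  nlinarith

/-- Dividing row `n` of `ζ - A` by its diagonal entry `d n` leaves `1 - E`, with `E` a shift by two
whose weights are eventually below one. The resolvent is `(1 - E)⁻¹ D` with `D = diag(1 / d n)`. -/
theorem exists_isResolventAt (hA : IsTriangular b c C A) (hc : c ≠ 0) (hC : ‖C‖ < 1) {ζ : ℂ}
    (hζ : ∀ n : ℕ, ζ ≠ c * (n + 1 / 2)) : ∃ R, IsResolventAt A ζ R := by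
  set d : ℕ → ℂ := fun n => ζ - c * (n + 1 / 2) with hd
  have hd0 : ∀ n, d n ≠ 0 := fun n => sub_ne_zero.2 (hζ n)
  set e : ℕ → ℂ := fun n => -(c * C * shiftWeight n) / d n with he
  obtain ⟨K, hK⟩ := resolvent_weight_eventually_le hc hC ζ
  obtain ⟨M, hM⟩ := bounded_of_eventually_bounded (w := e) hK
  obtain ⟨M', hM'⟩ := inverse_diagonal_bounded hc ζ
  have hk : ∀ n < 2, e n = 0 := by
    intro n hn
    interval_cases n <;> simp [he, shiftWeight_zero, shiftWeight_one]
  obtain ⟨U, hU⟩ := isUnit_one_sub_weightedShift hM hk (r := (1 + ‖C‖) / 2) (by linarith) hK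
  set E := weightedShift e 2 M hM hk with hE
  set D := weightedShift (fun n => (d n)⁻¹) 0 M' hM' (by simp) with hD
  have hU1 : ∀ x, (1 - E) ((↑U⁻¹ : Ell2 →L[ℂ] Ell2) x) = x := fun x => by
    rw [← hU, ← mul_apply_eq_comp, Units.mul_inv]
    rfl
  have hU2 : ∀ x, (↑U⁻¹ : Ell2 →L[ℂ] Ell2) ((1 - E) x) = x := fun x => by
    rw [← hU, ← mul_apply_eq_comp, Units.inv_mul]
    rfl
  -- This equivalence serves in both directions: one proves that the candidate maps into the domain
  -- and inverts on the right, the other that it inverts on the left.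
  have hcoef : ∀ (x y : Ell2), (1 - E) x = D y ↔
      ∀ n, ζ * x n - y n = c * ((n + 1 / 2) * x n - C * shiftWeight n * x (n - 2)) := by
    intro x y
    rw [lp.ext_iff, funext_iff]
    refine forall_congr' fun n => ?_
    change x n - e n * x (n - 2) = (d n)⁻¹ * y n ↔ _
    rw [he, eq_inv_mul_iff_mul_eq₀ (hd0 n), mul_sub, ← mul_assoc, mul_div_cancel₀ _ (hd0 n)]
    simp only [hd]
    constructor <;> intro h <;> linear_combination h
  have hsub : ∀ (u f : L2R) (n : ℕ), b.repr (ζ • u - f) n = ζ * b.repr u n - b.repr f n := by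
    intro u f n
    rw [map_sub, map_smul]
    rfl
  refine ⟨(b.repr.symm.toContinuousLinearEquiv : Ell2 →L[ℂ] L2R) ∘L
    (↑U⁻¹ : Ell2 →L[ℂ] Ell2) ∘L D ∘L (b.repr.toContinuousLinearEquiv : L2R →L[ℂ] Ell2), ?_, ?_⟩
  · intro f
    set u := ((b.repr.symm.toContinuousLinearEquiv : Ell2 →L[ℂ] L2R) ∘L
      (↑U⁻¹ : Ell2 →L[ℂ] Ell2) ∘L D ∘L (b.repr.toContinuousLinearEquiv : L2R →L[ℂ] Ell2)) f with hu
    have hru : b.repr u = (↑U⁻¹ : Ell2 →L[ℂ] Ell2) (D (b.repr f)) :=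
      b.repr.apply_symm_apply _
    have h1 : (1 - E) (b.repr u) = D (b.repr f) := by rw [hru, hU1]
    obtain ⟨hdom, hval⟩ := (hA u (ζ • u - f)).2 (by
      intro n
      rw [← (hcoef _ _).1 h1 n, hsub])
    exact ⟨hdom, by rw [hval]; abel⟩
  · rintro ⟨u, hu⟩
    have h1 := (hA u (A ⟨u, hu⟩)).1 ⟨hu, rfl⟩
    have h2 : (1 - E) (b.repr u) = D (b.repr (ζ • u - A ⟨u, hu⟩)) := by
      rw [hcoef]
      intro n
      rw [← h1 n, hsub, sub_sub_cancel]
    change b.repr.symm ((↑U⁻¹ : Ell2 →L[ℂ] Ell2) (D (b.repr (ζ • u - A ⟨u, hu⟩)))) = u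
    rw [← h2, hU2, b.repr.symm_apply_apply]

/-! ### Continuity of the resolvent -/

/-- The first resolvent identity: the left inverse property at `ζ` is applied to the vector `R' f`.
-/
theorem IsResolventAt.sub_eq {A : L2R →ₗ.[ℂ] L2R} {ζ ζ' : ℂ} {R R' : L2R →L[ℂ] L2R}
    (h : IsResolventAt A ζ R) (h' : IsResolventAt A ζ' R') :
    R - R' = (ζ' - ζ) • (R * R') := by
  ext1 f
  obtain ⟨hd, hv⟩ := h'.1 f
  have h2 := h.2 ⟨R' f, hd⟩
  have aux : ∀ v g w : L2R, ζ' • v - g = w → ζ • v - g = w - (ζ' - ζ) • v := by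
    rintro v g _ rfl
    rw [sub_smul]
    abel
  have h3 := aux _ _ _ hv
  simp only at h2
  rw [h3, map_sub, map_smul] at h2
  change R f - R' f = (ζ' - ζ) • R (R' f)
  rw [sub_eq_iff_eq_add] at h2 ⊢
  rw [h2, add_comm]

/-- The resolvent identity bootstraps: close to `ζ'` it first bounds `‖R ζ‖` by `2 ‖R ζ'‖`, and then
bounds the difference linearly in `|ζ - ζ'|`. Continuity supplies the integrability in the contour
integral. -/
theorem continuousOn_resolvent {A : L2R →ₗ.[ℂ] L2R} {s : Set ℂ} {R : ℂ → (L2R →L[ℂ] L2R)}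
    (h : ∀ ζ ∈ s, IsResolventAt A ζ (R ζ)) : ContinuousOn R s := by
  intro ζ' hζ'
  rw [ContinuousWithinAt, tendsto_iff_norm_sub_tendsto_zero]
  set m := ‖R ζ'‖ with hm
  have hm0 : 0 ≤ m := norm_nonneg _
  have hlim : Filter.Tendsto (fun ζ : ℂ => ‖ζ' - ζ‖ * (2 * m * m)) (nhdsWithin ζ' s) (nhds 0) := by
    have : Continuous fun ζ : ℂ => ‖ζ' - ζ‖ * (2 * m * m) := by fun_prop
    have h1 := (this.tendsto ζ').mono_left (nhdsWithin_le_nhds (s := s))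
    simpa using h1
  refine squeeze_zero' (Filter.Eventually.of_forall fun _ => norm_nonneg _) ?_ hlim
  have hev : ∀ᶠ ζ in nhdsWithin ζ' s, ‖ζ' - ζ‖ * m ≤ 1 / 2 := by
    have : Continuous fun ζ : ℂ => ‖ζ' - ζ‖ * m := by fun_prop
    have h1 := (this.tendsto ζ').mono_left (nhdsWithin_le_nhds (s := s))
    simp only [sub_self, norm_zero, zero_mul] at h1
    exact h1.eventually (ge_mem_nhds (by norm_num))
  filter_upwards [hev, self_mem_nhdsWithin] with ζ hζ hζs
  have e := (h ζ hζs).sub_eq (h ζ' hζ')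
  have hle : ‖R ζ - R ζ'‖ ≤ ‖ζ' - ζ‖ * (‖R ζ‖ * m) := by
    rw [e, norm_smul]
    gcongr
    exact norm_mul_le _ _
  have h1 : ‖R ζ‖ ≤ ‖R ζ - R ζ'‖ + m := by
    calc ‖R ζ‖ = ‖(R ζ - R ζ') + R ζ'‖ := by rw [sub_add_cancel]
      _ ≤ _ := norm_add_le _ _
  have h2 : ‖R ζ‖ ≤ 2 * m := by nlinarith [norm_nonneg (R ζ)]
  calc ‖R ζ - R ζ'‖ ≤ ‖ζ' - ζ‖ * (‖R ζ‖ * m) := hle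
    _ ≤ ‖ζ' - ζ‖ * (2 * m * m) := by gcongr

end

section

/-! ### Left and right eigenvectors of the triangular operator -/

/-- Coefficients of the left eigenvector for the eigenvalue `c (M + 1/2)`. -/
def leftCoeff (C : ℂ) (M : ℕ) : ℕ → ℂ
  | 0 => 1
  | j + 1 => -(C * shiftWeight (M - 2 * j)) / (2 * (j + 1)) * leftCoeff C M j

/-- Coefficients of the right eigenvector for the eigenvalue `c (N + 1/2)`. -/
def rightCoeff (C : ℂ) (N : ℕ) : ℕ → ℂ
  | 0 => 1
  | j + 1 => C * shiftWeight (N + 2 * j + 2) / (2 * (j + 1)) * rightCoeff C N j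

theorem shiftWeight_add_two_sq (n : ℕ) : shiftWeight (n + 2) ^ 2 = (n + 2) * (n + 1) := by
  rw [shiftWeight, Real.sq_sqrt] <;> push_cast <;> ring_nf
  positivity

theorem leftCoeff_succ_of_lt {C : ℂ} {M j : ℕ} (h : M < 2 * (j + 1)) :
    leftCoeff C M (j + 1) = 0 := by
  have : shiftWeight (M - 2 * j) = 0 := by
    have h' : M - 2 * j = 0 ∨ M - 2 * j = 1 := by omega
    rcases h' with h' | h' <;> rw [h']
    · exact shiftWeight_zero
    · exact shiftWeight_one
  rw [leftCoeff, this]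
  simp

theorem norm_leftCoeff_sq (C : ℂ) {M j : ℕ} (h : 2 * j ≤ M) :
    ‖leftCoeff C M j‖ ^ 2 = (‖C‖ / 2) ^ (2 * j) * (M.factorial /
      ((j.factorial : ℝ) ^ 2 * (M - 2 * j).factorial)) := by
  induction j with
  | zero =>
    have : (M.factorial : ℝ) ≠ 0 := by positivity
    simp [leftCoeff, this]
  | succ j ih =>
    obtain ⟨k, rfl⟩ := Nat.exists_eq_add_of_le' h
    have e1 : k + 2 * (j + 1) - 2 * j = k + 2 := by omega
    have e2 : k + 2 * (j + 1) - 2 * (j + 1) = k := by omega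
    have ih' := ih (by omega)
    rw [e1] at ih'
    have hn : ‖(2 * ((j : ℂ) + 1))‖ = 2 * (j + 1) := by
      have : (2 * ((j : ℂ) + 1)) = ((2 * (j + 1) : ℝ) : ℂ) := by push_cast; rfl
      rw [this, Complex.norm_real, Real.norm_of_nonneg (by positivity)]
    rw [leftCoeff, e1, e2, norm_mul, norm_div, norm_neg, norm_mul, hn, Complex.norm_real,
      Real.norm_of_nonneg (shiftWeight_nonneg _), mul_pow, ih', div_pow, mul_pow,
      shiftWeight_add_two_sq, Nat.factorial_succ j, show k + 2 = (k + 1) + 1 from rfl,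
      Nat.factorial_succ (k + 1), Nat.factorial_succ k]
    have h1 : (k.factorial : ℝ) ≠ 0 := by positivity
    have h2 : (j.factorial : ℝ) ≠ 0 := by positivity
    have h3 : (k : ℝ) + 1 ≠ 0 := by positivity
    have h4 : (k : ℝ) + 2 ≠ 0 := by positivity
    have h5 : (j : ℝ) + 1 ≠ 0 := by positivity
    push_cast
    rw [show ((k : ℝ) + 1 + 1) = k + 2 by ring]
    field_simp
    ring

theorem norm_rightCoeff_sq (C : ℂ) (N j : ℕ) :
    ‖rightCoeff C N j‖ ^ 2 = (‖C‖ / 2) ^ (2 * j) * ((N + 2 * j).factorial /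
      ((j.factorial : ℝ) ^ 2 * N.factorial)) := by
  induction j with
  | zero =>
    have : (N.factorial : ℝ) ≠ 0 := by positivity
    simp [rightCoeff, this]
  | succ j ih =>
    have hn : ‖(2 * ((j : ℂ) + 1))‖ = 2 * (j + 1) := by
      have : (2 * ((j : ℂ) + 1)) = ((2 * (j + 1) : ℝ) : ℂ) := by push_cast; rfl
      rw [this, Complex.norm_real, Real.norm_of_nonneg (by positivity)]
    rw [rightCoeff, norm_mul, norm_div, norm_mul, hn, Complex.norm_real,
      Real.norm_of_nonneg (shiftWeight_nonneg _), mul_pow, ih, div_pow, mul_pow,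
      shiftWeight_add_two_sq, Nat.factorial_succ j, show N + 2 * (j + 1) = (N + 2 * j + 1) + 1 by ring,
      Nat.factorial_succ (N + 2 * j + 1), Nat.factorial_succ (N + 2 * j)]
    have h1 : (N.factorial : ℝ) ≠ 0 := by positivity
    have h2 : (j.factorial : ℝ) ≠ 0 := by positivity
    have h5 : (j : ℝ) + 1 ≠ 0 := by positivity
    push_cast
    field_simp
    ring

/-- The terms equal `binom(N + 2j, N) binom(2j, j) (|C|/2)^(2j)`, and `binom(2j, j) ≤ 4^j` leaves a
negative binomial series in `|C| < 1`. -/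
theorem summable_rightCoeff_sq {C : ℂ} (hC : ‖C‖ < 1) (N : ℕ) :
    Summable fun j => ‖rightCoeff C N j‖ ^ 2 := by
  have h1 := summable_choose_mul_geometric_of_norm_lt_one N (r := ‖C‖) (by simpa using hC)
  have h2 := h1.comp_injective (i := fun j : ℕ => 2 * j) (fun a b h => by simpa using h)
  refine Summable.of_nonneg_of_le (fun j => by positivity) (fun j => ?_) h2
  rw [norm_rightCoeff_sq, Function.comp_apply]
  have e : ((N + 2 * j).factorial : ℝ) / ((j.factorial : ℝ) ^ 2 * N.factorial) =
      ((2 * j + N).choose N : ℝ) * Nat.centralBinom j := by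
    have a1 := Nat.add_choose_mul_factorial_mul_factorial (2 * j) N
    have a2 := Nat.add_choose_mul_factorial_mul_factorial j j
    rw [← two_mul, ← Nat.centralBinom_eq_two_mul_choose] at a2
    rw [div_eq_iff (by positivity), add_comm N, ← a1, ← a2]
    push_cast
    ring
  have h4 : (Nat.centralBinom j : ℝ) ≤ 4 ^ j := by
    rw [Nat.centralBinom_eq_two_mul_choose]
    have := Nat.choose_le_two_pow (2 * j) j
    rw [pow_mul] at this
    exact_mod_cast this
  rw [e, div_pow, pow_mul (2 : ℝ)]
  norm_num
  rw [div_mul_eq_mul_div, div_le_iff₀ (by positivity)]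
  calc ‖C‖ ^ (2 * j) * (((2 * j + N).choose N : ℝ) * Nat.centralBinom j)
      ≤ ‖C‖ ^ (2 * j) * (((2 * j + N).choose N : ℝ) * 4 ^ j) := by gcongr
    _ = _ := by ring

/-- The left eigenvector. -/
def leftVec (b : HilbertBasis ℕ ℂ L2R) (C : ℂ) (M : ℕ) : L2R :=
  ∑ j ∈ Finset.range (M / 2 + 1), star (leftCoeff C M j) • b (M - 2 * j)

theorem inner_leftVec (b : HilbertBasis ℕ ℂ L2R) (C : ℂ) (M : ℕ) (f : L2R) :
    ⟪leftVec b C M, f⟫_ℂ =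
      ∑ j ∈ Finset.range (M / 2 + 1), leftCoeff C M j * b.repr f (M - 2 * j) := by
  rw [leftVec, sum_inner]
  refine Finset.sum_congr rfl fun j _ => ?_
  rw [inner_smul_left, HilbertBasis.repr_apply_apply]
  simp

theorem norm_leftVec_sq (b : HilbertBasis ℕ ℂ L2R) (C : ℂ) (M : ℕ) :
    ‖leftVec b C M‖ ^ 2 = ∑ j ∈ Finset.range (M / 2 + 1), ‖leftCoeff C M j‖ ^ 2 := by
  have horth : Orthonormal ℂ fun j : Finset.range (M / 2 + 1) => b (M - 2 * (j : ℕ)) := by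
    refine b.orthonormal.comp _ ?_
    intro x y hxy
    have hx := Finset.mem_range.1 x.2
    have hy := Finset.mem_range.1 y.2
    ext
    simp only at hxy
    omega
  have h1 := horth.inner_sum (fun j => star (leftCoeff C M j)) (fun j => star (leftCoeff C M j))
    Finset.univ
  have hv : leftVec b C M = ∑ j : Finset.range (M / 2 + 1),
      star (leftCoeff C M j) • b (M - 2 * (j : ℕ)) := by
    rw [leftVec, Finset.sum_coe_sort (Finset.range (M / 2 + 1))
      (fun j => star (leftCoeff C M j) • b (M - 2 * j))]
  rw [← hv, inner_self_eq_norm_sq_to_K] at h1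
  rw [← Finset.sum_coe_sort]
  have h2 : ((‖leftVec b C M‖ ^ 2 : ℝ) : ℂ) =
      ((∑ j : Finset.range (M / 2 + 1), ‖leftCoeff C M j‖ ^ 2 : ℝ) : ℂ) := by
    push_cast
    refine h1.trans (Finset.sum_congr rfl fun j _ => ?_)
    simp [Complex.mul_conj, Complex.normSq_eq_norm_sq]
  exact_mod_cast h2

/-- The coordinates of the right eigenvector. -/
def rightSeq (C : ℂ) (N n : ℕ) : ℂ :=
  if N ≤ n ∧ Even (n - N) then rightCoeff C N ((n - N) / 2) else 0

theorem rightSeq_add (C : ℂ) (N j : ℕ) : rightSeq C N (N + 2 * j) = rightCoeff C N j := by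
  rw [rightSeq, if_pos ⟨by omega, by rw [Nat.add_sub_cancel_left]; exact even_two_mul j⟩,
    Nat.add_sub_cancel_left, Nat.mul_div_cancel_left _ two_pos]

theorem rightSeq_support (C : ℂ) (N n : ℕ) (hn : n ∉ Set.range fun j => N + 2 * j) :
    rightSeq C N n = 0 := by
  rw [rightSeq, if_neg]
  rintro ⟨h1, k, hk⟩
  exact hn ⟨k, by simp only; omega⟩

theorem injective_add_two_mul (N : ℕ) : Function.Injective fun j : ℕ => N + 2 * j :=
  fun a b h => by simp only at h; omega

theorem summable_rightSeq {C : ℂ} (hC : ‖C‖ < 1) (N : ℕ) :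
    Summable fun n => ‖rightSeq C N n‖ ^ 2 := by
  rw [← (injective_add_two_mul N).summable_iff]
  · convert summable_rightCoeff_sq hC N using 2 with j
    rw [Function.comp_apply, rightSeq_add]
  · intro n hn
    rw [rightSeq_support C N n hn]
    simp

/-- The right eigenvector. -/
def rightVec (b : HilbertBasis ℕ ℂ L2R) {C : ℂ} (hC : ‖C‖ < 1) (N : ℕ) : L2R :=
  b.repr.symm ⟨rightSeq C N, memℓp_two_of_summable (summable_rightSeq hC N)⟩

theorem repr_rightVec (b : HilbertBasis ℕ ℂ L2R) {C : ℂ} (hC : ‖C‖ < 1) (N n : ℕ) :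
    b.repr (rightVec b hC N) n = rightSeq C N n := by
  rw [rightVec, b.repr.apply_symm_apply]

theorem norm_rightVec_sq (b : HilbertBasis ℕ ℂ L2R) {C : ℂ} (hC : ‖C‖ < 1) (N : ℕ) :
    ‖rightVec b hC N‖ ^ 2 = ∑' j, ‖rightCoeff C N j‖ ^ 2 := by
  rw [← b.repr.norm_map, ell2_norm_sq]
  simp only [repr_rightVec]
  rw [← (injective_add_two_mul N).tsum_eq]
  · simp only [rightSeq_add]
  · intro n hn
    by_contra hn'
    exact hn (by simp [rightSeq_support C N n hn'])

variable {b : HilbertBasis ℕ ℂ L2R} {c C : ℂ} {A : L2R →ₗ.[ℂ] L2R}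

/-- This is row `n` of the eigenvector equation divided by `c`; along `n = N + 2j` it is the
recursion defining `rightCoeff`. -/
theorem rightSeq_eigen (C : ℂ) (N n : ℕ) :
    ((n : ℂ) - N) * rightSeq C N n = C * shiftWeight n * rightSeq C N (n - 2) := by
  by_cases hn : n ∈ Set.range fun j => N + 2 * j
  · obtain ⟨j, rfl⟩ := hn
    simp only
    cases j with
    | zero =>
      rw [Nat.mul_zero, Nat.add_zero, sub_self, zero_mul]
      match N with
      | 0 => simp [shiftWeight_zero]
      | 1 => simp [shiftWeight_one]
      | N + 2 => rw [Nat.add_sub_cancel, rightSeq, if_neg (by omega), mul_zero]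
    | succ j =>
      rw [rightSeq_add, show N + 2 * (j + 1) - 2 = N + 2 * j by omega, rightSeq_add, rightCoeff,
        show N + 2 * (j + 1) = N + 2 * j + 2 by ring]
      have : (j : ℂ) + 1 ≠ 0 := Nat.cast_add_one_ne_zero j
      push_cast
      field_simp
      ring
  · rw [rightSeq_support C N n hn, mul_zero]
    match n with
    | 0 => simp [shiftWeight_zero]
    | 1 => simp [shiftWeight_one]
    | n + 2 =>
      rw [Nat.add_sub_cancel, rightSeq_support, mul_zero]
      rintro ⟨j, hj⟩
      exact hn ⟨j + 1, by simp only at hj ⊢; omega⟩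

/-- The left eigenvector has finite support, so pairing it with `A u` is a finite sum of
coordinates, legitimate for every `u` in the maximal domain. -/
theorem inner_leftVec_apply (hA : IsTriangular b c C A) (M : ℕ) (u : A.domain) :
    ⟪leftVec b C M, A u⟫_ℂ = c * (M + 1 / 2) * ⟪leftVec b C M, (u : L2R)⟫_ℂ := by
  have h1 := (hA u (A u)).1 ⟨u.2, rfl⟩
  rw [inner_leftVec, inner_leftVec]
  simp only [h1]
  rw [← sub_eq_zero, Finset.mul_sum, ← Finset.sum_sub_distrib]
  set x : ℕ → ℂ := fun n => b.repr (u : L2R) n with hx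
  -- The difference telescopes through `2 c j · leftCoeff C M j · x (M - 2j)`. The lower end
  -- vanishes by the factor `j`, the upper by `leftCoeff_succ_of_lt`.
  have hstep : ∀ j ∈ Finset.range (M / 2 + 1),
      leftCoeff C M j * (c * ((((M - 2 * j : ℕ) : ℂ) + 1 / 2) * x (M - 2 * j) -
        C * shiftWeight (M - 2 * j) * x (M - 2 * j - 2))) -
      c * (M + 1 / 2) * (leftCoeff C M j * x (M - 2 * j)) =
      (fun j : ℕ => 2 * c * j * leftCoeff C M j * x (M - 2 * j)) (j + 1) -
      (fun j : ℕ => 2 * c * j * leftCoeff C M j * x (M - 2 * j)) j := by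
    intro j hj
    have hj' := Finset.mem_range.1 hj
    have h2 : ((M - 2 * j : ℕ) : ℂ) = M - 2 * j := by
      rw [Nat.cast_sub (by omega)]
      push_cast
      rfl
    have h3 : M - 2 * (j + 1) = M - 2 * j - 2 := by omega
    simp only
    rw [h2, h3, leftCoeff]
    have : (j : ℂ) + 1 ≠ 0 := Nat.cast_add_one_ne_zero j
    push_cast
    field_simp
    ring
  rw [Finset.sum_congr rfl hstep,
    Finset.sum_range_sub (fun j : ℕ => 2 * c * j * leftCoeff C M j * x (M - 2 * j)),
    leftCoeff_succ_of_lt (by omega)]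
  simp

/-- For `M ≠ N` the eigenvalues differ. For `M = N` one vector lives on indices at most `M`, the
other on indices at least `M`, and both have coordinate one at `M`. -/
theorem inner_leftVec_rightVec (hC : ‖C‖ < 1) (hc : c ≠ 0) (hA : IsTriangular b c C A) (M N : ℕ) :
    ⟪leftVec b C M, rightVec b hC N⟫_ℂ = if M = N then 1 else 0 := by
  split_ifs with h
  · subst h
    rw [inner_leftVec, Finset.sum_eq_single 0]
    · rw [repr_rightVec, leftCoeff, one_mul]
      have := rightSeq_add C M 0
      rwa [rightCoeff] at this
    · intro j hj hj0
      have := Finset.mem_range.1 hj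
      rw [repr_rightVec, rightSeq, if_neg (by omega), mul_zero]
    · simp
  · obtain ⟨hd, hv⟩ := (hA (rightVec b hC N) ((c * (N + 1 / 2)) • rightVec b hC N)).2 (by
      intro n
      rw [map_smul]
      change c * (N + 1 / 2) * b.repr (rightVec b hC N) n = _
      simp only [repr_rightVec]
      linear_combination (-c) * rightSeq_eigen C N n)
    have h1 := inner_leftVec_apply hA M ⟨_, hd⟩
    rw [hv, inner_smul_right] at h1
    simp only at h1
    have h2 : c * ((N : ℂ) - M) * ⟪leftVec b C M, rightVec b hC N⟫_ℂ = 0 := by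
      linear_combination h1
    refine (mul_eq_zero.1 h2).resolve_left (mul_ne_zero hc ?_)
    rw [sub_ne_zero]
    intro h'
    exact h (by exact_mod_cast h'.symm)

/-- The left eigenvectors are unitriangular in the basis, so pairings with them determine the
coordinates recursively. -/
theorem eq_of_inner_leftVec_eq {f g : L2R}
    (h : ∀ M, ⟪leftVec b C M, f⟫_ℂ = ⟪leftVec b C M, g⟫_ℂ) : f = g := by
  have key : ∀ n, b.repr f n = b.repr g n := by
    intro n
    induction n using Nat.strong_induction_on with
    | _ n ih =>
      have h1 := h n
      rw [inner_leftVec, inner_leftVec, Finset.sum_range_succ', Finset.sum_range_succ'] at h1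
      have h2 : ∀ j ∈ Finset.range (n / 2),
          leftCoeff C n (j + 1) * b.repr f (n - 2 * (j + 1)) =
          leftCoeff C n (j + 1) * b.repr g (n - 2 * (j + 1)) := by
        intro j hj
        have := Finset.mem_range.1 hj
        rw [ih (n - 2 * (j + 1)) (by omega)]
      rw [Finset.sum_congr rfl h2] at h1
      simpa [leftCoeff] using h1
  apply b.repr.injective
  ext n
  exact key n

/-! ### Spectrum and spectral projections -/

theorem leftVec_ne_zero (hC : ‖C‖ < 1) (hc : c ≠ 0) (hA : IsTriangular b c C A) (M : ℕ) :
    leftVec b C M ≠ 0 := by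
  intro h0
  have := inner_leftVec_rightVec hC hc hA M M
  rw [h0] at this
  simp at this

theorem IsResolventAt.inner_leftVec (hA : IsTriangular b c C A) {ζ : ℂ} {R : L2R →L[ℂ] L2R}
    (h : IsResolventAt A ζ R) (M : ℕ) (f : L2R) :
    (ζ - c * (M + 1 / 2)) * ⟪leftVec b C M, R f⟫_ℂ = ⟪leftVec b C M, f⟫_ℂ := by
  obtain ⟨hd, hv⟩ := h.1 f
  have h1 := inner_leftVec_apply hA M ⟨R f, hd⟩
  have h2 := congrArg (fun w => ⟪leftVec b C M, w⟫_ℂ) hv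
  simp only [inner_sub_right, inner_smul_right, h1] at h2
  rw [← h2]
  ring

/-- At a diagonal entry the left eigenvector is orthogonal to the range of `ζ - A`, so a resolvent
would force its norm to be zero. -/
theorem spec_eq (hA : IsTriangular b c C A) (hc : c ≠ 0) (hC : ‖C‖ < 1) :
    spec A = Set.range fun n : ℕ => c * ((n : ℂ) + 1 / 2) := by
  ext ζ
  constructor
  · intro h
    by_contra h'
    exact h (exists_isResolventAt hA hc hC fun n hn => h' ⟨n, hn.symm⟩)
  · rintro ⟨n, rfl⟩ ⟨R, hR⟩
    have h1 := hR.inner_leftVec hA n (leftVec b C n)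
    rw [sub_self, zero_mul] at h1
    exact leftVec_ne_zero hC hc hA n (inner_self_eq_zero.1 h1.symm)

theorem exists_isSpectralProjection (hA : IsTriangular b c C A) (hc : c ≠ 0) (hC : ‖C‖ < 1)
    (N : ℕ) : ∃ P, IsSpectralProjection A (c * (N + 1 / 2)) P := by
  have hc0 : 0 < ‖c‖ := norm_pos_iff.2 hc
  -- Distinct points of the spectrum are at least `|c|` apart, so the radius `|c|/2` isolates each
  -- of them.
  have hdist : ∀ n : ℕ, ‖c * ((n : ℂ) + 1 / 2) - c * (N + 1 / 2)‖ ≤ ‖c‖ / 2 → n = N := by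
    intro n hn
    rw [← mul_sub, norm_mul, add_sub_add_right_eq_sub] at hn
    by_contra hne
    have h1 : (1 : ℝ) ≤ ‖(n : ℂ) - N‖ := by
      have : (n : ℂ) - N = (((n : ℤ) - N : ℤ) : ℂ) := by push_cast; rfl
      rw [this, Complex.norm_intCast]
      have h2 : (n : ℤ) - N ≠ 0 := by
        rw [sub_ne_zero]
        exact_mod_cast hne
      exact_mod_cast Int.one_le_abs h2
    nlinarith
  have hinter : Metric.closedBall (c * ((N : ℂ) + 1 / 2)) (‖c‖ / 2) ∩ spec A =
      {c * ((N : ℂ) + 1 / 2)} := by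
    rw [spec_eq hA hc hC]
    ext ζ
    simp only [Set.mem_inter_iff, Metric.mem_closedBall, dist_eq_norm, Set.mem_range,
      Set.mem_singleton_iff]
    constructor
    · rintro ⟨h1, n, rfl⟩
      rw [hdist n h1]
    · rintro rfl
      exact ⟨by rw [sub_self, norm_zero]; positivity, N, rfl⟩
  have hres : ∀ ζ ∈ Metric.sphere (c * ((N : ℂ) + 1 / 2)) (‖c‖ / 2), ∃ R, IsResolventAt A ζ R := by
    intro ζ hζ
    by_contra h
    have h1 : ζ ∈ ({c * ((N : ℂ) + 1 / 2)} : Set ℂ) := by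
      rw [← hinter]
      exact ⟨Metric.sphere_subset_closedBall hζ, h⟩
    rw [Set.mem_singleton_iff] at h1
    rw [h1, Metric.mem_sphere, dist_self] at hζ
    linarith
  choose! R hR using hres
  exact ⟨_, ‖c‖ / 2, by positivity, hinter, R, hR,
    (continuousOn_resolvent hR).circleIntegrable (by positivity), rfl⟩

/-- Pairing with a left eigenvector replaces the resolvent by the scalar `(ζ - w)⁻¹`, and Cauchy's
formula gives one or zero according to whether `w` is the centre. The choice of contour thus drops
out. -/
theorem IsSpectralProjection.inner_leftVec (hA : IsTriangular b c C A) (hc : c ≠ 0)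
    (hC : ‖C‖ < 1) {N : ℕ} {P : L2R →L[ℂ] L2R}
    (hP : IsSpectralProjection A (c * (N + 1 / 2)) P) (M : ℕ) (f : L2R) :
    ⟪leftVec b C M, P f⟫_ℂ = if M = N then ⟪leftVec b C M, f⟫_ℂ else 0 := by
  obtain ⟨r, hr, hinter, R, hR, hint, rfl⟩ := hP
  set z := c * ((N : ℂ) + 1 / 2) with hz
  set w := c * ((M : ℂ) + 1 / 2) with hw
  have hsp := spec_eq hA hc hC
  let L : (L2R →L[ℂ] L2R) →L[ℂ] ℂ :=
    (innerSL ℂ (leftVec b C M)) ∘L (ContinuousLinearMap.apply ℂ L2R f)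
  have hL : ∀ T : L2R →L[ℂ] L2R, L T = ⟪leftVec b C M, T f⟫_ℂ := fun T => rfl
  rw [← hL, map_smul]
  have hcomm : L (∮ ζ in C(z, r), R ζ) = ∮ ζ in C(z, r), L (R ζ) := by
    rw [circleIntegral, circleIntegral, ← ContinuousLinearMap.intervalIntegral_comp_comm]
    · simp
    · exact hint.out
  have hne : ∀ ζ ∈ Metric.sphere z r, ζ - w ≠ 0 := by
    intro ζ hζ h0
    rw [sub_eq_zero] at h0
    have h1 : ζ ∈ spec A := by rw [hsp, h0]; exact ⟨M, rfl⟩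
    have h2 : ζ ∈ ({z} : Set ℂ) := by
      rw [← hinter]
      exact ⟨Metric.sphere_subset_closedBall hζ, h1⟩
    rw [Set.mem_singleton_iff] at h2
    rw [h2, Metric.mem_sphere, dist_self] at hζ
    linarith
  have hval : ∮ ζ in C(z, r), L (R ζ) =
      ∮ ζ in C(z, r), (ζ - w)⁻¹ * ⟪leftVec b C M, f⟫_ℂ := by
    refine circleIntegral.integral_congr hr.le fun ζ hζ => ?_
    rw [hL, ← (hR ζ hζ).inner_leftVec hA M f, inv_mul_cancel_left₀ (hne ζ hζ)]
  have hmul : (∮ ζ in C(z, r), (ζ - w)⁻¹ * ⟪leftVec b C M, f⟫_ℂ) =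
      (∮ ζ in C(z, r), (ζ - w)⁻¹) * ⟪leftVec b C M, f⟫_ℂ := by
    rw [circleIntegral, circleIntegral, ← intervalIntegral.integral_mul_const]
    simp only [smul_eq_mul, mul_assoc]
  rw [hcomm, hval, hmul]
  split_ifs with hMN
  · subst hMN
    rw [circleIntegral.integral_sub_inv_of_mem_ball (Metric.mem_ball_self hr), smul_eq_mul,
      ← mul_assoc, inv_mul_cancel₀ Complex.two_pi_I_ne_zero, one_mul]
  · have hwz : w ∉ Metric.closedBall z r := by
      intro hmem
      have h2 : w ∈ ({z} : Set ℂ) := by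
        rw [← hinter, hsp]
        exact ⟨hmem, M, rfl⟩
      rw [Set.mem_singleton_iff, hw, hz] at h2
      have h3 := mul_left_cancel₀ hc h2
      rw [add_left_inj] at h3
      exact hMN (by exact_mod_cast h3)
    have hzero : (∮ ζ in C(z, r), (ζ - w)⁻¹) = 0 := by
      have hne' : ∀ ζ ∈ Metric.closedBall z r, ζ - w ≠ 0 := fun ζ hζ h0 =>
        hwz (by rwa [← sub_eq_zero.1 h0])
      refine Complex.circleIntegral_eq_zero_of_differentiable_on_off_countable hr.le
        (s := ∅) Set.countable_empty ?_ ?_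
      · exact ContinuousOn.inv₀ (by fun_prop) hne'
      · intro ζ hζ
        exact DifferentiableAt.inv (by fun_prop) (hne' ζ (Metric.ball_subset_closedBall hζ.1))
    rw [hzero, zero_mul, smul_zero]

/-- By biorthogonality both sides have the same pairings with all left eigenvectors, and these
separate vectors. -/
theorem IsSpectralProjection.eq_rankOne (hA : IsTriangular b c C A) (hc : c ≠ 0)
    (hC : ‖C‖ < 1) {N : ℕ} {P : L2R →L[ℂ] L2R}
    (hP : IsSpectralProjection A (c * (N + 1 / 2)) P) :
    P = InnerProductSpace.rankOne ℂ (rightVec b hC N) (leftVec b C N) := by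
  ext1 f
  refine eq_of_inner_leftVec_eq (b := b) (C := C) fun M => ?_
  rw [hP.inner_leftVec hA hc hC, InnerProductSpace.rankOne_apply, inner_smul_right,
    inner_leftVec_rightVec hC hc hA]
  split_ifs with h
  · rw [h, mul_one]
  · rw [mul_zero]

/-- The squared norm of the left eigenvector. -/
def leftSum (ρ : ℝ) (N : ℕ) : ℝ :=
  ∑ j ∈ Finset.range (N / 2 + 1), (ρ / 2) ^ (2 * j) * (N.factorial /
      ((j.factorial : ℝ) ^ 2 * (N - 2 * j).factorial))

/-- The squared norm of the right eigenvector. -/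
def rightSum (ρ : ℝ) (N : ℕ) : ℝ :=
  ∑' j : ℕ, (ρ / 2) ^ (2 * j) * ((N + 2 * j).factorial / ((j.factorial : ℝ) ^ 2 * N.factorial))

theorem IsSpectralProjection.norm_sq (hA : IsTriangular b c C A) (hc : c ≠ 0)
    (hC : ‖C‖ < 1) {N : ℕ} {P : L2R →L[ℂ] L2R}
    (hP : IsSpectralProjection A (c * (N + 1 / 2)) P) :
    ‖P‖ ^ 2 = rightSum ‖C‖ N * leftSum ‖C‖ N := by
  rw [hP.eq_rankOne hA hc hC, InnerProductSpace.norm_rankOne, mul_pow, norm_rightVec_sq,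
    norm_leftVec_sq, rightSum, leftSum]
  congr 1
  · simp only [norm_rightCoeff_sq]
  · refine Finset.sum_congr rfl fun j hj => ?_
    have := Finset.mem_range.1 hj
    rw [norm_leftCoeff_sq C (by omega)]

end

section

/-! ### Integral representations of the norms -/

theorem integral_cos_pow_even (j : ℕ) :
    ∫ θ in (0 : ℝ)..Real.pi, Real.cos θ ^ (2 * j) = Real.pi * (Nat.centralBinom j / 4 ^ j) := by
  induction j with
  | zero => simp
  | succ j ih =>
    rw [show 2 * (j + 1) = 2 * j + 2 by ring, integral_cos_pow, ih]
    have h := Nat.succ_mul_centralBinom_succ j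
    have h' : ((j : ℝ) + 1) * Nat.centralBinom (j + 1) = 2 * (2 * j + 1) * Nat.centralBinom j := by
      exact_mod_cast h
    have hj : (j : ℝ) + 1 ≠ 0 := by positivity
    have h2 : (Nat.centralBinom (j + 1) : ℝ) = 2 * (2 * j + 1) * Nat.centralBinom j / (j + 1) := by
      rw [eq_div_iff hj, mul_comm, h']
    rw [h2, Real.sin_pi, Real.sin_zero]
    push_cast
    field_simp
    ring

theorem integral_cos_pow_odd (j : ℕ) :
    ∫ θ in (0 : ℝ)..Real.pi, Real.cos θ ^ (2 * j + 1) = 0 := by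
  induction j with
  | zero => simp
  | succ j ih =>
    rw [show 2 * (j + 1) + 1 = (2 * j + 1) + 2 by ring, integral_cos_pow, ih]
    simp

theorem injective_two_mul : Function.Injective fun j : ℕ => 2 * j :=
  fun a b h => by simp only at h; omega

/-- Binomial expansion: the odd moments of the cosine vanish and the even ones are Wallis integrals,
producing the central binomial coefficients. -/
theorem integral_one_add_cos_pow (ρ : ℝ) (N : ℕ) :
    ∫ θ in (0 : ℝ)..Real.pi, (1 + ρ * Real.cos θ) ^ N = Real.pi * leftSum ρ N := by
  have h1 : ∀ θ : ℝ, (1 + ρ * Real.cos θ) ^ N =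
      ∑ k ∈ Finset.range (N + 1), (N.choose k * ρ ^ k) * Real.cos θ ^ k := by
    intro θ
    rw [add_comm, add_pow]
    refine Finset.sum_congr rfl fun k _ => ?_
    rw [mul_pow, one_pow]
    ring
  simp only [h1]
  rw [intervalIntegral.integral_finsetSum
    (fun k _ => (Continuous.intervalIntegrable (by fun_prop) _ _))]
  simp only [intervalIntegral.integral_const_mul]
  have h2 : ∑ k ∈ (Finset.range (N / 2 + 1)).image (fun j => 2 * j),
      (N.choose k * ρ ^ k) * ∫ θ in (0 : ℝ)..Real.pi, Real.cos θ ^ k =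
      ∑ k ∈ Finset.range (N + 1), (N.choose k * ρ ^ k) *
        ∫ θ in (0 : ℝ)..Real.pi, Real.cos θ ^ k := by
    refine Finset.sum_subset ?_ ?_
    · intro k hk
      obtain ⟨j, hj, rfl⟩ := Finset.mem_image.1 hk
      rw [Finset.mem_range] at hj ⊢
      omega
    · intro k hk hk'
      rcases Nat.even_or_odd' k with ⟨j, rfl | rfl⟩
      · exfalso
        refine hk' (Finset.mem_image.2 ⟨j, ?_, rfl⟩)
        rw [Finset.mem_range] at hk ⊢
        omega
      · rw [integral_cos_pow_odd, mul_zero]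
  rw [← h2, Finset.sum_image (fun a _ b _ h => injective_two_mul h), leftSum, Finset.mul_sum]
  refine Finset.sum_congr rfl fun j hj => ?_
  have hj' : 2 * j ≤ N := by
    have := Finset.mem_range.1 hj
    omega
  rw [integral_cos_pow_even, Nat.cast_choose ℝ hj']
  have a2 := Nat.add_choose_mul_factorial_mul_factorial j j
  rw [← two_mul, ← Nat.centralBinom_eq_two_mul_choose] at a2
  rw [← a2]
  have c0 : (Nat.centralBinom j : ℝ) ≠ 0 := by exact_mod_cast Nat.centralBinom_ne_zero j
  have c1 : (j.factorial : ℝ) ≠ 0 := by positivity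
  push_cast
  rw [div_pow, pow_mul (2 : ℝ)]
  norm_num
  field_simp

/-- The same computation with the negative binomial series, integrated termwise under the summable
majorant obtained from `|cos θ| ≤ 1`. -/
theorem integral_one_sub_cos_pow {ρ : ℝ} (h0 : 0 ≤ ρ) (h1 : ρ < 1) (N : ℕ) :
    ∫ θ in (0 : ℝ)..Real.pi, ((1 - ρ * Real.cos θ) ^ (N + 1))⁻¹ = Real.pi * rightSum ρ N := by
  have hs := summable_choose_mul_geometric_of_norm_lt_one N (r := ρ)
    (by rwa [Real.norm_of_nonneg h0])
  have hsum := intervalIntegral.hasSum_integral_of_dominated_convergence (μ := volume)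
    (a := 0) (b := Real.pi)
    (F := fun (k : ℕ) (θ : ℝ) => ((k + N).choose N : ℝ) * (ρ * Real.cos θ) ^ k)
    (f := fun θ : ℝ => ((1 - ρ * Real.cos θ) ^ (N + 1))⁻¹)
    (fun k _ => ((k + N).choose N : ℝ) * ρ ^ k)
    (fun k => Continuous.aestronglyMeasurable (by fun_prop))
    (fun k => Filter.Eventually.of_forall fun θ _ => by
      rw [norm_mul, norm_pow, norm_mul, Real.norm_of_nonneg h0, Real.norm_natCast]
      gcongr
      exact mul_le_of_le_one_right h0 (Real.abs_cos_le_one θ))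
    (Filter.Eventually.of_forall fun θ _ => hs)
    (by simp)
    (Filter.Eventually.of_forall fun θ _ => by
      have := hasSum_choose_mul_geometric_of_norm_lt_one N (r := ρ * Real.cos θ) (by
        rw [norm_mul, Real.norm_of_nonneg h0]
        exact (mul_le_of_le_one_right h0 (Real.abs_cos_le_one θ)).trans_lt h1)
      rwa [one_div] at this)
  rw [← hsum.tsum_eq, rightSum, ← tsum_mul_left]
  simp only [mul_pow, ← mul_assoc, intervalIntegral.integral_const_mul]
  rw [← injective_two_mul.tsum_eq]
  · refine tsum_congr fun j => ?_
    rw [integral_cos_pow_even]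
    have a1 := Nat.add_choose_mul_factorial_mul_factorial (2 * j) N
    have a2 := Nat.add_choose_mul_factorial_mul_factorial j j
    rw [← two_mul, ← Nat.centralBinom_eq_two_mul_choose] at a2
    rw [add_comm N, ← a1, ← a2]
    have c1 : (j.factorial : ℝ) ≠ 0 := by positivity
    have c2 : (N.factorial : ℝ) ≠ 0 := by positivity
    push_cast
    rw [div_pow, pow_mul (2 : ℝ)]
    norm_num
    field_simp
  · intro k hk
    rcases Nat.even_or_odd' k with ⟨j, rfl | rfl⟩
    · exact ⟨j, rfl⟩
    · exfalso
      refine hk ?_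
      simp only [integral_cos_pow_odd, mul_zero]

theorem one_sub_mul_cos_pos {ρ : ℝ} (h0 : 0 ≤ ρ) (h1 : ρ < 1) (θ : ℝ) :
    0 < 1 - ρ * Real.cos θ := by
  nlinarith [Real.cos_le_one θ, Real.neg_one_le_cos θ]

/-- The Möbius change of variables relating the two integrals. -/
theorem integral_one_add_cos_pow_eq {ρ : ℝ} (h0 : 0 ≤ ρ) (h1 : ρ < 1) (N : ℕ) :
    ∫ θ in (0 : ℝ)..Real.pi, (1 + ρ * Real.cos θ) ^ N =
      (1 - ρ ^ 2) ^ N * Real.sqrt (1 - ρ ^ 2) *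
        ∫ θ in (0 : ℝ)..Real.pi, ((1 - ρ * Real.cos θ) ^ (N + 1))⁻¹ := by
  -- With `cos θ = m φ` one has `1 + ρ cos θ = (1 - ρ²)/(1 - ρ cos φ)` and `dθ = √(1 - ρ²)/(1 - ρ
  -- cos φ) dφ`, which accounts for all the factors. The endpoints `0` and `π` are fixed.
  set m : ℝ → ℝ := fun φ => (Real.cos φ - ρ) / (1 - ρ * Real.cos φ) with hm
  have hpos := one_sub_mul_cos_pos h0 h1
  have hr2 : 0 < 1 - ρ ^ 2 := by nlinarith
  have hmle : ∀ φ, m φ ≤ 1 := fun φ => by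
    rw [hm, div_le_one (hpos φ)]
    nlinarith [Real.cos_le_one φ]
  have hmge : ∀ φ, -1 ≤ m φ := fun φ => by
    rw [hm, le_div_iff₀ (hpos φ)]
    nlinarith [Real.neg_one_le_cos φ]
  have hmcont : Continuous m := by
    refine Continuous.div (by fun_prop) (by fun_prop) fun φ => (hpos φ).ne'
  have hderiv : ∀ φ ∈ Set.Ioo (0 : ℝ) Real.pi, HasDerivAt (fun φ => Real.arccos (m φ))
      (Real.sqrt (1 - ρ ^ 2) / (1 - ρ * Real.cos φ)) φ := by
    intro φ hφ
    have hsin : 0 < Real.sin φ := Real.sin_pos_of_mem_Ioo hφ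
    have hsq := Real.sin_sq_add_cos_sq φ
    have hm2 : 1 - m φ ^ 2 = (1 - ρ ^ 2) * (Real.sin φ / (1 - ρ * Real.cos φ)) ^ 2 := by
      have := (hpos φ).ne'
      simp only [hm]
      rw [div_pow, div_pow, mul_div_assoc', eq_div_iff (pow_ne_zero 2 this), sub_mul,
        div_mul_cancel₀ _ (pow_ne_zero 2 this)]
      linear_combination -(1 - ρ ^ 2) * hsq
    have hsqrt : Real.sqrt (1 - m φ ^ 2) =
        Real.sqrt (1 - ρ ^ 2) * (Real.sin φ / (1 - ρ * Real.cos φ)) := by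
      rw [hm2, Real.sqrt_mul hr2.le, Real.sqrt_sq (div_nonneg hsin.le (hpos φ).le)]
    have hm2pos : 0 < 1 - m φ ^ 2 := by
      rw [hm2]
      have := hpos φ
      positivity
    have hmd : HasDerivAt m (-(Real.sin φ * (1 - ρ ^ 2)) / (1 - ρ * Real.cos φ) ^ 2) φ := by
      have := ((Real.hasDerivAt_cos φ).sub_const ρ).div
        (((Real.hasDerivAt_cos φ).const_mul ρ).const_sub 1) (hpos φ).ne'
      refine this.congr_deriv ?_
      congr 1
      ring
    have := (Real.hasDerivAt_arccos (x := m φ) (by nlinarith) (by nlinarith)).comp φ hmd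
    refine this.congr_deriv ?_
    rw [hsqrt]
    have a1 := (hpos φ).ne'
    have a2 := (Real.sqrt_pos.2 hr2).ne'
    have a3 : Real.sqrt (1 - ρ ^ 2) ^ 2 = 1 - ρ ^ 2 := Real.sq_sqrt hr2.le
    field_simp
    rw [a3]
  have hsub := intervalIntegral.integral_comp_mul_deriv'' (a := 0) (b := Real.pi)
    (f := fun φ => Real.arccos (m φ))
    (f' := fun φ => Real.sqrt (1 - ρ ^ 2) / (1 - ρ * Real.cos φ))
    (g := fun θ => (1 + ρ * Real.cos θ) ^ N)
    (Real.continuous_arccos.comp hmcont).continuousOn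
    (fun φ hφ => by
      rw [min_eq_left Real.pi_pos.le, max_eq_right Real.pi_pos.le] at hφ
      exact (hderiv φ hφ).hasDerivWithinAt)
    (Continuous.continuousOn (Continuous.div (by fun_prop) (by fun_prop) fun φ => (hpos φ).ne'))
    (Continuous.continuousOn (by fun_prop))
  have e0 : Real.arccos (m 0) = 0 := by
    have : m 0 = 1 := by
      simp only [hm, Real.cos_zero, mul_one]
      exact div_self (by linarith)
    rw [this, Real.arccos_one]
  have e1 : Real.arccos (m Real.pi) = Real.pi := by
    have : m Real.pi = -1 := by
      simp only [hm, Real.cos_pi]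
      rw [div_eq_iff (by linarith)]
      ring
    rw [this, Real.arccos_neg_one]
  simp only [e0, e1, Function.comp_apply] at hsub
  rw [← hsub, ← intervalIntegral.integral_const_mul]
  congr 1
  ext φ
  rw [Real.cos_arccos (hmge φ) (hmle φ)]
  have a1 := (hpos φ).ne'
  have : 1 + ρ * m φ = (1 - ρ ^ 2) / (1 - ρ * Real.cos φ) := by
    simp only [hm]
    field_simp
    ring
  rw [this, div_pow]
  field_simp
  ring

theorem leftSum_eq {ρ : ℝ} (h0 : 0 ≤ ρ) (h1 : ρ < 1) (N : ℕ) :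
    leftSum ρ N = (1 - ρ ^ 2) ^ N * Real.sqrt (1 - ρ ^ 2) * rightSum ρ N := by
  have h := integral_one_add_cos_pow_eq h0 h1 N
  rw [integral_one_add_cos_pow, integral_one_sub_cos_pow h0 h1] at h
  have hpi := Real.pi_ne_zero
  apply mul_left_cancel₀ hpi
  rw [h]
  ring

theorem leftSum_nonneg {ρ : ℝ} (h0 : 0 ≤ ρ) (N : ℕ) : 0 ≤ leftSum ρ N :=
  Finset.sum_nonneg fun _ _ => by positivity

/-- The normalized Laplace integral. -/
def laplaceInt (ρ : ℝ) (N : ℕ) : ℝ :=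
  ∫ θ in (0 : ℝ)..Real.pi, ((1 + ρ * Real.cos θ) / (1 + ρ)) ^ N

theorem leftSum_eq_laplaceInt {ρ : ℝ} (h0 : 0 ≤ ρ) (N : ℕ) :
    leftSum ρ N = (1 + ρ) ^ N * laplaceInt ρ N / Real.pi := by
  have h : laplaceInt ρ N = ((1 + ρ) ^ N)⁻¹ * (Real.pi * leftSum ρ N) := by
    rw [laplaceInt, ← integral_one_add_cos_pow, ← intervalIntegral.integral_const_mul]
    congr 1
    ext θ
    rw [div_pow]
    field_simp
  rw [h]
  have : (1 + ρ) ^ N ≠ 0 := by positivity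
  have := Real.pi_ne_zero
  field_simp

/-- The normalized norm in terms of the Laplace integral. -/
theorem normalized_norm_eq {ρ x : ℝ} (h0 : 0 ≤ ρ) (h1 : ρ < 1) (N : ℕ) (hx : 0 ≤ x)
    (hxe : x ^ 2 = rightSum ρ N * leftSum ρ N) :
    ((1 - ρ) / (1 + ρ)) ^ ((N : ℝ) / 2) * x =
      (1 - ρ ^ 2) ^ (-(1 / 4) : ℝ) / Real.pi * laplaceInt ρ N := by
  have hr2 : 0 < 1 - ρ ^ 2 := by nlinarith
  have hm : 0 < 1 - ρ := by linarith
  have hp : 0 < 1 + ρ := by linarith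
  have hl := leftSum_nonneg h0 N
  have hJ : laplaceInt ρ N / Real.pi = leftSum ρ N / (1 + ρ) ^ N := by
    rw [leftSum_eq_laplaceInt h0]
    have : (1 + ρ) ^ N ≠ 0 := by positivity
    field_simp
  have hR : 0 ≤ (1 - ρ ^ 2) ^ (-(1 / 4) : ℝ) / Real.pi * laplaceInt ρ N := by
    rw [div_mul_eq_mul_div, mul_div_assoc, hJ]
    positivity
  refine (pow_left_inj₀ (by positivity) hR two_ne_zero).1 ?_
  rw [div_mul_eq_mul_div, mul_div_assoc, hJ, mul_pow, mul_pow, hxe]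
  have e1 : (((1 - ρ) / (1 + ρ)) ^ ((N : ℝ) / 2)) ^ 2 = ((1 - ρ) / (1 + ρ)) ^ N := by
    rw [← Real.rpow_natCast, ← Real.rpow_mul (by positivity), ← Real.rpow_natCast]
    congr 1
    push_cast
    ring
  have e2 : ((1 - ρ ^ 2) ^ (-(1 / 4) : ℝ)) ^ 2 = (Real.sqrt (1 - ρ ^ 2))⁻¹ := by
    rw [← Real.rpow_natCast, ← Real.rpow_mul hr2.le, Real.sqrt_eq_rpow, ← Real.rpow_neg hr2.le]
    norm_num
  have hs : 0 < Real.sqrt (1 - ρ ^ 2) := Real.sqrt_pos.2 hr2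
  -- Eliminating `rightSum` turns the product of the two sums into the square of `leftSum` up to
  -- explicit factors.
  have hright : rightSum ρ N = leftSum ρ N / ((1 - ρ ^ 2) ^ N * Real.sqrt (1 - ρ ^ 2)) := by
    rw [leftSum_eq h0 h1]
    field_simp
  rw [e1, e2, hright, show 1 - ρ ^ 2 = (1 - ρ) * (1 + ρ) by ring] at *
  rw [div_pow, mul_pow]
  field_simp

end

section

/-! ### Watson's lemma -/

theorem integrableOn_rpow_mul_exp {s r : ℝ} (hs : -1 < s) (hr : 0 < r) :
    IntegrableOn (fun t : ℝ => t ^ s * Real.exp (-(r * t))) (Set.Ioi 0) := by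
  have := integrableOn_rpow_mul_exp_neg_mul_rpow hs one_pos hr
  simpa using this

/-- A function that is `O(t^s)` at zero has Laplace transform `O(N^(-s-1))`. -/
theorem laplace_isBigO {h : ℝ → ℝ} {s δ K : ℝ} (hs : -1 < s) (hδ : 0 < δ)
    (hi : IntegrableOn (fun t => Real.exp (-t) * h t) (Set.Ioi 0))
    (hb : ∀ t ∈ Set.Ioo 0 δ, |h t| ≤ K * t ^ s) :
    (fun N : ℕ => ∫ t in Set.Ioi (0 : ℝ), Real.exp (-(N * t)) * h t)
      =O[Filter.atTop] fun N : ℕ => (N : ℝ) ^ (-s - 1) := by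
  have hK : 0 ≤ K := by
    have h1 := hb (δ / 2) ⟨by linarith, by linarith⟩
    have h2 : 0 < (δ / 2) ^ s := Real.rpow_pos_of_pos (by linarith) _
    by_contra hneg
    have := abs_nonneg (h (δ / 2))
    nlinarith
  set M := ∫ t in Set.Ioi (0 : ℝ), ‖Real.exp (-t) * h t‖ with hM
  have hbound : ∀ᶠ N : ℕ in Filter.atTop,
      ‖∫ t in Set.Ioi (0 : ℝ), Real.exp (-(N * t)) * h t‖ ≤
        1 * ‖K * Real.Gamma (s + 1) * (N : ℝ) ^ (-s - 1) +
          Real.exp δ * M * Real.exp (-δ * (N : ℝ))‖ := by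
    filter_upwards [Filter.eventually_ge_atTop 1] with N hN
    have hN0 : (0 : ℝ) < N := by exact_mod_cast hN
    have hN1 : (1 : ℝ) ≤ N := by exact_mod_cast hN
    have i1 : IntegrableOn (fun t : ℝ => K * (t ^ s * Real.exp (-(N * t)))) (Set.Ioi 0) :=
      (integrableOn_rpow_mul_exp hs hN0).const_mul K
    have i2 : IntegrableOn (fun t : ℝ => Real.exp (-δ * (N - 1)) * ‖Real.exp (-t) * h t‖)
        (Set.Ioi 0) := hi.norm.const_mul _
    have hle : ‖∫ t in Set.Ioi (0 : ℝ), Real.exp (-(N * t)) * h t‖ ≤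
        ∫ t in Set.Ioi (0 : ℝ), (K * (t ^ s * Real.exp (-(N * t))) +
          Real.exp (-δ * (N - 1)) * ‖Real.exp (-t) * h t‖) := by
      refine norm_integral_le_of_norm_le (i1.add i2) ?_
      rw [ae_restrict_iff' measurableSet_Ioi]
      refine Filter.Eventually.of_forall fun t ht => ?_
      have ht0 : 0 < t := ht
      rcases lt_or_ge t δ with htδ | htδ
      · have h1 := hb t ⟨ht0, htδ⟩
        rw [norm_mul, Real.norm_of_nonneg (Real.exp_pos _).le, Real.norm_eq_abs]
        calc Real.exp (-(N * t)) * |h t| ≤ Real.exp (-(N * t)) * (K * t ^ s) := by gcongr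
          _ = K * (t ^ s * Real.exp (-(N * t))) := by ring
          _ ≤ _ := le_add_of_nonneg_right (by positivity)
      -- One factor `exp(-t)` is kept for integrability; the remaining `N - 1` give `exp(-δ(N -
      -- 1))`, negligible against every power of `N`.
      · have e : Real.exp (-(N * t)) * h t = Real.exp (-t * (N - 1)) * (Real.exp (-t) * h t) := by
          rw [← mul_assoc, ← Real.exp_add]
          congr 2
          ring
        rw [e, norm_mul, Real.norm_of_nonneg (Real.exp_pos _).le]
        refine le_add_of_nonneg_of_le ?_ ?_
        · have := Real.rpow_nonneg ht0.le s
          positivity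
        · refine mul_le_mul_of_nonneg_right ?_ (norm_nonneg _)
          rw [Real.exp_le_exp]
          nlinarith
    rw [integral_add i1 i2, integral_const_mul, integral_const_mul] at hle
    have hG := Real.integral_rpow_mul_exp_neg_mul_Ioi (a := s + 1) (by linarith) hN0
    rw [add_sub_cancel_right] at hG
    rw [hG, ← hM] at hle
    rw [one_mul]
    refine hle.trans (le_of_eq_of_le ?_ (le_abs_self _))
    have e1 : (1 / (N : ℝ)) ^ (s + 1) = (N : ℝ) ^ (-s - 1) := by
      rw [one_div, Real.inv_rpow hN0.le, ← Real.rpow_neg hN0.le]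
      congr 1
      ring
    have e2 : Real.exp (-δ * (N - 1)) = Real.exp δ * Real.exp (-δ * N) := by
      rw [← Real.exp_add]
      congr 1
      ring
    rw [e1, e2]
    ring
  refine (Asymptotics.IsBigO.of_bound 1 hbound).trans ?_
  refine Asymptotics.IsBigO.add ((Asymptotics.isBigO_refl _ _).const_mul_left _) ?_
  refine Asymptotics.IsBigO.const_mul_left ?_ _
  exact ((isLittleO_exp_neg_mul_rpow_atTop hδ (-s - 1)).comp_tendsto
    tendsto_natCast_atTop_atTop).isBigO

/-- **Watson's lemma** for an amplitude `t^(-1/2) G(t)` on a finite interval, `G` analytic at `0`. -/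
theorem watson {g G : ℝ → ℝ} {T : ℝ} (hT : 0 < T) (hg : IntegrableOn g (Set.Ioo 0 T))
    (hgG : ∀ t ∈ Set.Ioo 0 T, g t = t ^ (-(1 / 2) : ℝ) * G t) (hG : AnalyticAt ℝ G 0) (J : ℕ) :
    (fun N : ℕ => (∫ t in Set.Ioo 0 T, Real.exp (-(N * t)) * g t) -
      ∑ j ∈ Finset.range J, (iteratedDeriv j G 0 / j.factorial * Real.Gamma (j + 1 / 2)) *
        (N : ℝ) ^ (-(j : ℝ) - 1 / 2))
      =O[Filter.atTop] fun N : ℕ => (N : ℝ) ^ (-(J : ℝ) - 1 / 2) := by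
  set a : ℕ → ℝ := fun j => iteratedDeriv j G 0 / j.factorial with ha
  obtain ⟨K, hK⟩ := (hG.hasFPowerSeriesAt.isBigO_sub_partialSum_pow J).bound
  rw [Metric.eventually_nhds_iff] at hK
  obtain ⟨ε, hε, hK⟩ := hK
  have hpart : ∀ t, |t| < ε → |G t - ∑ j ∈ Finset.range J, a j * t ^ j| ≤ K * |t| ^ J := by
    intro t ht
    have := hK (y := t) (by rwa [Real.dist_eq, sub_zero])
    rw [zero_add, norm_pow, norm_norm, Real.norm_eq_abs, Real.norm_eq_abs] at this
    convert this using 3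
    rw [FormalMultilinearSeries.partialSum]
    refine Finset.sum_congr rfl fun j _ => ?_
    rw [FormalMultilinearSeries.apply_eq_pow_smul_coeff, FormalMultilinearSeries.coeff_ofScalars,
      smul_eq_mul, mul_comm]
  -- The Taylor terms are integrated over the whole half line, where they give exact Gamma values.
  -- The difference `h` is `O(t^(J - 1/2))` at zero, so `laplace_isBigO` bounds the error.
  set P : ℝ → ℝ := fun t => ∑ j ∈ Finset.range J, a j * t ^ ((j : ℝ) - 1 / 2) with hP
  set h : ℝ → ℝ := fun t => (Set.Ioo 0 T).indicator g t - P t with hh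
  have hsub : Set.Ioo 0 T ⊆ Set.Ioi 0 := Set.Ioo_subset_Ioi_self
  have hexpg : ∀ r : ℝ, 0 ≤ r → IntegrableOn (fun t => Real.exp (-(r * t)) * g t) (Set.Ioo 0 T) := by
    intro r hr
    refine Integrable.mono hg ?_ ?_
    · exact (Continuous.aestronglyMeasurable (by fun_prop)).mul hg.aestronglyMeasurable
    · rw [ae_restrict_iff' measurableSet_Ioo]
      refine Filter.Eventually.of_forall fun t ht => ?_
      rw [norm_mul, Real.norm_of_nonneg (Real.exp_pos _).le]
      refine mul_le_of_le_one_left (norm_nonneg _) (Real.exp_le_one_iff.2 ?_)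
      have := mul_nonneg hr ht.1.le
      linarith
  have hind : ∀ r : ℝ, (fun t => Real.exp (-(r * t)) * (Set.Ioo 0 T).indicator g t) =
      (Set.Ioo 0 T).indicator fun t => Real.exp (-(r * t)) * g t := by
    intro r
    ext t
    by_cases ht : t ∈ Set.Ioo 0 T
    · rw [Set.indicator_of_mem ht, Set.indicator_of_mem ht]
    · rw [Set.indicator_of_notMem ht, Set.indicator_of_notMem ht, mul_zero]
  have hi1 : ∀ r : ℝ, 0 ≤ r →
      IntegrableOn (fun t => Real.exp (-(r * t)) * (Set.Ioo 0 T).indicator g t) (Set.Ioi 0) := by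
    intro r hr
    rw [hind r]
    exact (integrable_indicator_iff measurableSet_Ioo).2 (hexpg r hr) |>.integrableOn
  have hv1 : ∀ r : ℝ, ∫ t in Set.Ioi (0 : ℝ), Real.exp (-(r * t)) * (Set.Ioo 0 T).indicator g t =
      ∫ t in Set.Ioo 0 T, Real.exp (-(r * t)) * g t := by
    intro r
    rw [hind r, setIntegral_indicator measurableSet_Ioo, Set.inter_eq_self_of_subset_right hsub]
  have hterm : ∀ (r : ℝ), 0 < r → ∀ j ∈ Finset.range J, IntegrableOn
      (fun t : ℝ => a j * (t ^ ((j : ℝ) - 1 / 2) * Real.exp (-(r * t)))) (Set.Ioi 0) := by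
    intro r hr j _
    refine (integrableOn_rpow_mul_exp ?_ hr).const_mul _
    have : (0 : ℝ) ≤ j := by positivity
    linarith
  have hPe : ∀ r : ℝ, (fun t => Real.exp (-(r * t)) * P t) = fun t => ∑ j ∈ Finset.range J,
      a j * (t ^ ((j : ℝ) - 1 / 2) * Real.exp (-(r * t))) := by
    intro r
    ext t
    rw [hP, Finset.mul_sum]
    exact Finset.sum_congr rfl fun j _ => by ring
  have hi2 : ∀ r : ℝ, 0 < r → IntegrableOn (fun t => Real.exp (-(r * t)) * P t) (Set.Ioi 0) := by
    intro r hr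
    rw [hPe r]
    exact integrable_finsetSum _ (hterm r hr)
  have hv2 : ∀ r : ℝ, 0 < r → ∫ t in Set.Ioi (0 : ℝ), Real.exp (-(r * t)) * P t =
      ∑ j ∈ Finset.range J, (a j * Real.Gamma (j + 1 / 2)) * r ^ (-(j : ℝ) - 1 / 2) := by
    intro r hr
    rw [hPe r, integral_finsetSum _ (hterm r hr)]
    refine Finset.sum_congr rfl fun j _ => ?_
    have hj : (0 : ℝ) ≤ j := by positivity
    have hG := Real.integral_rpow_mul_exp_neg_mul_Ioi (a := (j : ℝ) + 1 / 2) (by linarith) hr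
    rw [show (j : ℝ) + 1 / 2 - 1 = j - 1 / 2 by ring] at hG
    rw [integral_const_mul, hG, one_div r, Real.inv_rpow hr.le, ← Real.rpow_neg hr.le,
      show -((j : ℝ) + 1 / 2) = -(j : ℝ) - 1 / 2 by ring]
    ring
  have hmain := laplace_isBigO (h := h) (s := (J : ℝ) - 1 / 2) (δ := min ε T) (K := K)
    (by
      have : (0 : ℝ) ≤ J := by positivity
      linarith) (lt_min hε hT)
    (by
      have h1 := (hi1 1 zero_le_one).sub (hi2 1 one_pos)
      refine h1.congr (Filter.Eventually.of_forall fun t => ?_)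
      simp only [Pi.sub_apply, hh, one_mul]
      ring)
    (by
      rintro t ⟨ht0, ht1⟩
      have htT : t ∈ Set.Ioo 0 T := ⟨ht0, ht1.trans_le (min_le_right _ _)⟩
      have htε : |t| < ε := by
        rw [abs_of_pos ht0]
        exact ht1.trans_le (min_le_left _ _)
      have e : h t = t ^ (-(1 / 2) : ℝ) * (G t - ∑ j ∈ Finset.range J, a j * t ^ j) := by
        simp only [hh, hP]
        rw [Set.indicator_of_mem htT, hgG t htT, mul_sub, Finset.mul_sum]
        congr 1
        refine Finset.sum_congr rfl fun j _ => ?_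
        rw [show (j : ℝ) - 1 / 2 = -(1 / 2) + j by ring, Real.rpow_add ht0, Real.rpow_natCast]
        ring
      have hb := hpart t htε
      rw [abs_of_pos ht0] at hb
      rw [e, abs_mul, abs_of_pos (Real.rpow_pos_of_pos ht0 _)]
      calc t ^ (-(1 / 2) : ℝ) * |G t - ∑ j ∈ Finset.range J, a j * t ^ j|
          ≤ t ^ (-(1 / 2) : ℝ) * (K * t ^ J) := by
            gcongr
        _ = K * t ^ ((J : ℝ) - 1 / 2) := by
            rw [show (J : ℝ) - 1 / 2 = -(1 / 2) + J by ring, Real.rpow_add ht0, Real.rpow_natCast]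
            ring)
  rw [show -((J : ℝ) - 1 / 2) - 1 = -(J : ℝ) - 1 / 2 by ring] at hmain
  refine hmain.congr' ?_ Filter.EventuallyEq.rfl
  filter_upwards [Filter.eventually_ge_atTop 1] with N hN
  have hN0 : (0 : ℝ) < N := by exact_mod_cast hN
  rw [← hv1, ← hv2 N hN0, ← integral_sub (hi1 N hN0.le) (hi2 N hN0)]
  congr 1
  ext t
  simp only [hh]
  ring

/-! ### Expansion of the Laplace integral -/

/-- `(1 - e^{-t}) / t`. -/
def expQuot : ℝ → ℝ := dslope (fun t => 1 - Real.exp (-t)) 0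

theorem analyticAt_expQuot : AnalyticAt ℝ expQuot 0 := by
  have h : AnalyticAt ℝ (fun t : ℝ => 1 - Real.exp (-t)) 0 := by fun_prop
  obtain ⟨p, hp⟩ := h
  exact ⟨_, hp.has_fpower_series_dslope_fslope⟩

theorem expQuot_zero : expQuot 0 = 1 := by
  rw [expQuot, dslope_same]
  have : HasDerivAt (fun t : ℝ => 1 - Real.exp (-t)) (-(Real.exp (-0) * (-1))) 0 :=
    (((hasDerivAt_neg (0 : ℝ)).exp).const_sub 1)
  rw [this.deriv]
  simp

theorem mul_expQuot {t : ℝ} (ht : t ≠ 0) : t * expQuot t = 1 - Real.exp (-t) := by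
  rw [expQuot, dslope_of_ne _ ht, slope_def_field]
  simp
  field_simp

/-- `(1 - m²) / t`, where `m = ((1 + ρ) e^{-t} - 1) / ρ`. -/
def radicand (ρ t : ℝ) : ℝ :=
  (1 + ρ) * expQuot t * ((1 + ρ) * Real.exp (-t) - (1 - ρ)) / ρ ^ 2

/-- The smooth amplitude in the Laplace integral. -/
def amplitude (ρ t : ℝ) : ℝ :=
  (1 + ρ) * Real.exp (-t) / ρ * Real.exp (-(1 / 2) * Real.log (radicand ρ t))

theorem radicand_zero {ρ : ℝ} (h0 : 0 < ρ) : radicand ρ 0 = 2 * (1 + ρ) / ρ := by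
  rw [radicand, expQuot_zero, neg_zero, Real.exp_zero]
  field_simp
  ring

/-- The radicand is positive at zero, so its power `-1/2`, written through `exp` and `log`, is
analytic there. -/
theorem analyticAt_amplitude {ρ : ℝ} (h0 : 0 < ρ) : AnalyticAt ℝ (amplitude ρ) 0 := by
  have h1 := analyticAt_expQuot
  have h2 : AnalyticAt ℝ (radicand ρ) 0 := by
    unfold radicand
    have : AnalyticAt ℝ (fun t : ℝ => (1 + ρ) * Real.exp (-t) - (1 - ρ)) 0 := by fun_prop
    exact ((analyticAt_const.mul h1).mul this).div analyticAt_const (by positivity)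
  have h3 := h2.log (by rw [radicand_zero h0]; positivity)
  have h4 : AnalyticAt ℝ (fun t : ℝ => (1 + ρ) * Real.exp (-t) / ρ) 0 := by
    refine AnalyticAt.div (by fun_prop) analyticAt_const h0.ne'
  exact h4.mul (analyticAt_const.mul h3).rexp

theorem amplitude_zero {ρ : ℝ} (h0 : 0 < ρ) :
    amplitude ρ 0 = (1 + ρ) / ρ * (2 * (1 + ρ) / ρ) ^ (-(1 / 2) : ℝ) := by
  rw [amplitude, radicand_zero h0, neg_zero, Real.exp_zero, mul_one,
    Real.rpow_def_of_pos (by positivity), mul_comm (Real.log _)]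

/-- The substitution is `e^(-t) = (1 + ρ cos θ)/(1 + ρ)`, with `t` from `0` to `T` as `θ` runs from
`0` to `π`. The maximum at `θ = 0` contributes the factor `t^(-1/2)`; at `t = T` the Jacobian is
singular too, but only its integrability matters. -/
theorem laplaceInt_expansion {ρ : ℝ} (h0 : 0 < ρ) (h1 : ρ < 1) (J : ℕ) :
    (fun N : ℕ => laplaceInt ρ N -
      ∑ j ∈ Finset.range J, (iteratedDeriv j (amplitude ρ) 0 / j.factorial *
        Real.Gamma (j + 1 / 2)) * (N : ℝ) ^ (-(j : ℝ) - 1 / 2))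
      =O[Filter.atTop] fun N : ℕ => (N : ℝ) ^ (-(J : ℝ) - 1 / 2) := by
  set T := Real.log ((1 + ρ) / (1 - ρ)) with hT
  have hm : 0 < 1 - ρ := by linarith
  have hp : 0 < 1 + ρ := by linarith
  have hT0 : 0 < T := Real.log_pos (by rw [one_lt_div hm]; linarith)
  have hTe : Real.exp (-T) = (1 - ρ) / (1 + ρ) := by
    rw [hT, Real.exp_neg, Real.exp_log (by positivity), inv_div]
  set m : ℝ → ℝ := fun t => ((1 + ρ) * Real.exp (-t) - 1) / ρ with hmdef
  set f : ℝ → ℝ := fun t => Real.arccos (m t) with hf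
  set g : ℝ → ℝ := fun t => (1 + ρ) * Real.exp (-t) / (ρ * Real.sqrt (1 - m t ^ 2)) with hg
  have hexp : ∀ t ∈ Set.Ioo 0 T, Real.exp (-t) < 1 ∧ (1 - ρ) < (1 + ρ) * Real.exp (-t) := by
    intro t ht
    refine ⟨Real.exp_lt_one_iff.2 (by linarith [ht.1]), ?_⟩
    have : Real.exp (-T) < Real.exp (-t) := Real.exp_lt_exp.2 (by linarith [ht.2])
    rw [hTe, div_lt_iff₀ hp] at this
    linarith
  have hm1 : ∀ t ∈ Set.Ioo 0 T, m t < 1 := fun t ht => by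
    simp only [hmdef]
    rw [div_lt_one h0]
    nlinarith [(hexp t ht).1]
  have hm2 : ∀ t ∈ Set.Ioo 0 T, -1 < m t := fun t ht => by
    simp only [hmdef]
    rw [lt_div_iff₀ h0]
    linarith [(hexp t ht).2]
  have hderiv : ∀ t ∈ Set.Ioo 0 T, HasDerivAt f (g t) t := by
    intro t ht
    have hmd : HasDerivAt m ((1 + ρ) * (Real.exp (-t) * (-1)) / ρ) t :=
      ((((hasDerivAt_neg t).exp).const_mul (1 + ρ)).sub_const 1).div_const ρ
    have := (Real.hasDerivAt_arccos (hm2 t ht).ne' (hm1 t ht).ne).comp t hmd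
    refine this.congr_deriv ?_
    have hpos : 0 < 1 - m t ^ 2 := by nlinarith [hm1 t ht, hm2 t ht]
    have := (Real.sqrt_pos.2 hpos).ne'
    simp only [hg]
    field_simp
  have hgpos : ∀ t, 0 ≤ g t := fun t => by
    simp only [hg]
    positivity
  have hcos : ∀ t ∈ Set.Ioo 0 T, (1 + ρ * Real.cos (f t)) / (1 + ρ) = Real.exp (-t) := by
    intro t ht
    simp only [hf]
    rw [Real.cos_arccos (hm2 t ht).le (hm1 t ht).le]
    simp only [hmdef]
    field_simp
    ring
  have hinj : Set.InjOn f (Set.Ioo 0 T) := by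
    intro x hx y hy hxy
    have h2 : Real.exp (-x) = Real.exp (-y) := by rw [← hcos x hx, ← hcos y hy, hxy]
    simpa using h2
  have himage : f '' Set.Ioo 0 T = Set.Ioo 0 Real.pi := by
    ext θ
    constructor
    · rintro ⟨t, ht, rfl⟩
      exact ⟨Real.arccos_pos.2 (hm1 t ht), Real.arccos_lt_pi.2 (hm2 t ht)⟩
    · intro hθ
      have c1 : Real.cos θ < 1 := by
        rw [← Real.cos_zero]
        exact Real.cos_lt_cos_of_nonneg_of_le_pi le_rfl hθ.2.le hθ.1
      have c2 : -1 < Real.cos θ := by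
        rw [← Real.cos_pi]
        exact Real.cos_lt_cos_of_nonneg_of_le_pi hθ.1.le le_rfl hθ.2
      have hpos : 0 < (1 + ρ * Real.cos θ) / (1 + ρ) := by
        have : 0 < 1 + ρ * Real.cos θ := by nlinarith
        positivity
      refine ⟨-Real.log ((1 + ρ * Real.cos θ) / (1 + ρ)), ⟨?_, ?_⟩, ?_⟩
      · rw [neg_pos]
        refine Real.log_neg hpos ?_
        rw [div_lt_one hp]
        nlinarith
      · rw [neg_lt, ← Real.log_exp (-T), hTe]
        refine Real.log_lt_log (by positivity) ?_
        gcongr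
        nlinarith
      · simp only [hf, hmdef]
        rw [neg_neg, Real.exp_log hpos, mul_div_cancel₀ _ hp.ne', add_sub_cancel_left,
          mul_div_cancel_left₀ _ h0.ne', Real.arccos_cos hθ.1.le hθ.2.le]
  have hd' : ∀ t ∈ Set.Ioo 0 T, HasDerivWithinAt f (g t) (Set.Ioo 0 T) t :=
    fun t ht => (hderiv t ht).hasDerivWithinAt
  -- Integrability of the Jacobian is the finiteness of the length of its image `(0, π)`: the change
  -- of variables is applied to the constant one.
  have hint : IntegrableOn g (Set.Ioo 0 T) := by
    have h2 := integrableOn_image_iff_integrableOn_abs_deriv_smul measurableSet_Ioo hd' hinj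
      (fun _ => (1 : ℝ))
    rw [himage] at h2
    have h3 := h2.1 (by simp)
    simpa [abs_of_nonneg (hgpos _)] using h3
  have hval : ∀ N : ℕ, laplaceInt ρ N = ∫ t in Set.Ioo 0 T, Real.exp (-(N * t)) * g t := by
    intro N
    have h2 := integral_image_eq_integral_abs_deriv_smul measurableSet_Ioo hd' hinj
      (fun θ => ((1 + ρ * Real.cos θ) / (1 + ρ)) ^ N)
    rw [himage] at h2
    rw [laplaceInt, intervalIntegral.integral_of_le Real.pi_pos.le, integral_Ioc_eq_integral_Ioo, h2]
    refine setIntegral_congr_fun measurableSet_Ioo fun t ht => ?_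
    rw [hcos t ht, abs_of_nonneg (hgpos t), smul_eq_mul, ← Real.exp_nat_mul, mul_comm,
      mul_neg]
  have hgG : ∀ t ∈ Set.Ioo 0 T, g t = t ^ (-(1 / 2) : ℝ) * amplitude ρ t := by
    intro t ht
    have hpos : 0 < 1 - m t ^ 2 := by nlinarith [hm1 t ht, hm2 t ht]
    -- The simple zero at `t = 0` comes from `1 - m = (1 + ρ)(1 - e^(-t))/ρ`; pulling out `t` leaves
    -- a function analytic at zero.
    have e : 1 - m t ^ 2 = t * radicand ρ t := by
      have := mul_expQuot ht.1.ne'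
      rw [radicand, show t * ((1 + ρ) * expQuot t * ((1 + ρ) * Real.exp (-t) - (1 - ρ)) / ρ ^ 2) =
        (1 + ρ) * (t * expQuot t) * ((1 + ρ) * Real.exp (-t) - (1 - ρ)) / ρ ^ 2 by ring, this]
      simp only [hmdef]
      field_simp
      ring
    have hr : 0 < radicand ρ t := by
      rw [e] at hpos
      exact pos_of_mul_pos_right hpos ht.1.le
    have e2 : Real.exp (-(1 / 2) * Real.log (radicand ρ t)) = radicand ρ t ^ (-(1 / 2) : ℝ) := by
      rw [Real.rpow_def_of_pos hr, mul_comm]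
    simp only [hg, amplitude]
    rw [e, e2, Real.sqrt_eq_rpow, Real.mul_rpow ht.1.le hr.le, Real.rpow_neg ht.1.le,
      Real.rpow_neg hr.le]
    field_simp
  have hw := watson hT0 hint hgG (analyticAt_amplitude h0) J
  simpa only [hval] using hw

/-- The coefficients of the expansion of the norms. -/
def normCoeff (ρ : ℝ) (j : ℕ) : ℝ :=
  (1 - ρ ^ 2) ^ (-(1 / 4) : ℝ) / Real.pi *
    (iteratedDeriv j (amplitude ρ) 0 / j.factorial * Real.Gamma (j + 1 / 2))

theorem normCoeff_zero {ρ : ℝ} (h0 : 0 < ρ) (h1 : ρ < 1) :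
    normCoeff ρ 0 = (2 * Real.pi * ρ) ^ (-(1 / 2 : ℝ)) * ((1 + ρ) / (1 - ρ)) ^ (1 / 4 : ℝ) := by
  have hm : 0 < 1 - ρ := by linarith
  have hp : 0 < 1 + ρ := by linarith
  have hpi := Real.pi_pos
  rw [normCoeff, iteratedDeriv_zero, amplitude_zero h0, Nat.factorial_zero, Nat.cast_one, div_one,
    Nat.cast_zero, zero_add, Real.Gamma_one_half_eq, Real.sqrt_eq_rpow,
    show 1 - ρ ^ 2 = (1 - ρ) * (1 + ρ) by ring, Real.mul_rpow hm.le hp.le,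
    Real.div_rpow (by positivity) h0.le, Real.mul_rpow two_pos.le hp.le,
    Real.mul_rpow (by positivity) h0.le, Real.mul_rpow two_pos.le hpi.le,
    Real.div_rpow hp.le hm.le]
  simp only [Real.rpow_neg hm.le, Real.rpow_neg hp.le, Real.rpow_neg h0.le, Real.rpow_neg hpi.le,
    Real.rpow_neg two_pos.le]
  have hρ : (ρ ^ (1 / 2 : ℝ)) ^ 2 = ρ := by
    rw [← Real.rpow_natCast, ← Real.rpow_mul h0.le]; norm_num
  have hπ : (Real.pi ^ (1 / 2 : ℝ)) ^ 2 = Real.pi := by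
    rw [← Real.rpow_natCast, ← Real.rpow_mul hpi.le]; norm_num
  have h4 : (1 + ρ) ^ (1 / 2 : ℝ) = ((1 + ρ) ^ (1 / 4 : ℝ)) ^ 2 := by
    rw [← Real.rpow_natCast, ← Real.rpow_mul hp.le]; norm_num
  have h5 : ((1 + ρ) ^ (1 / 4 : ℝ)) ^ 4 = 1 + ρ := by
    rw [← Real.rpow_natCast, ← Real.rpow_mul hp.le]; norm_num
  rw [h4]
  have p1 : 0 < ρ ^ (1 / 2 : ℝ) := Real.rpow_pos_of_pos h0 _
  have p2 : 0 < Real.pi ^ (1 / 2 : ℝ) := Real.rpow_pos_of_pos hpi _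
  have p3 : 0 < (1 + ρ) ^ (1 / 4 : ℝ) := Real.rpow_pos_of_pos hp _
  have p4 : 0 < (1 - ρ) ^ (1 / 4 : ℝ) := Real.rpow_pos_of_pos hm _
  have p5 : 0 < (2 : ℝ) ^ (1 / 2 : ℝ) := Real.rpow_pos_of_pos two_pos _
  generalize ρ ^ (1 / 2 : ℝ) = x1 at *
  generalize Real.pi ^ (1 / 2 : ℝ) = x2 at *
  generalize (1 + ρ) ^ (1 / 4 : ℝ) = x3 at *
  generalize (1 - ρ) ^ (1 / 4 : ℝ) = x4 at *
  generalize (2 : ℝ) ^ (1 / 2 : ℝ) = x5 at *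
  rw [← h5, ← hπ]
  field_simp
  rw [hρ]

theorem norm_expansion {ρ : ℝ} (h0 : 0 < ρ) (h1 : ρ < 1) {x : ℕ → ℝ} (hx : ∀ N, 0 ≤ x N)
    (hxe : ∀ N, x N ^ 2 = rightSum ρ N * leftSum ρ N) (J : ℕ) :
    (fun N : ℕ => ((1 - ρ) / (1 + ρ)) ^ ((N : ℝ) / 2) * x N -
      ∑ j ∈ Finset.range J, normCoeff ρ j * (N : ℝ) ^ (-(j : ℝ) - 1 / 2))
      =O[Filter.atTop] fun N : ℕ => (N : ℝ) ^ (-(J : ℝ) - 1 / 2) := by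
  have h := (laplaceInt_expansion h0 h1 J).const_mul_left
    ((1 - ρ ^ 2) ^ (-(1 / 4) : ℝ) / Real.pi)
  refine h.congr_left fun N => ?_
  rw [normalized_norm_eq h0.le h1 N (hx N) (hxe N), mul_sub, Finset.mul_sum]
  congr 1
  refine Finset.sum_congr rfl fun j _ => ?_
  rw [normCoeff]
  ring

end

section

/-! ### Eigenvectors of the Hamilton map -/

variable {q : QuadraticMap ℝ (ℝ × ℝ) ℂ}

theorem hamiltonMap_mulVec_eq_iff (X : Fin 2 → ℂ) (z : ℂ) :
    (hamiltonMap q).mulVec X = z • X ↔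
      coeffXXi q / 2 * X 0 + coeffXiXi q * X 1 = z * X 0 ∧
        -coeffXX q * X 0 - coeffXXi q / 2 * X 1 = z * X 1 := by
  rw [funext_iff, Fin.forall_fin_two]
  simp [hamiltonMap, Matrix.mulVec, dotProduct, Fin.sum_univ_two, sub_eq_add_neg]

/-- A nonnegative real binary quadratic form has zero gradient at its zeros. -/
theorem gradient_eq_zero_of_nonneg {p r s x y : ℝ}
    (h : ∀ x y : ℝ, 0 ≤ p * x ^ 2 + r * (x * y) + s * y ^ 2)
    (h0 : p * x ^ 2 + r * (x * y) + s * y ^ 2 = 0) : 2 * p * x + r * y = 0 := by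
  have hp : 0 ≤ p := by simpa using h 1 0
  -- A step against the partial derivative lowers the form by exactly `(gradient/(p + 1))²`; the
  -- shift by one keeps the denominator positive when `p = 0`.
  have h1 := h (x - (2 * p * x + r * y) / (p + 1)) y
  have hp1 : 0 < p + 1 := by linarith
  have e : p * (x - (2 * p * x + r * y) / (p + 1)) ^ 2 +
      r * ((x - (2 * p * x + r * y) / (p + 1)) * y) + s * y ^ 2 =
      (p * x ^ 2 + r * (x * y) + s * y ^ 2) - ((2 * p * x + r * y) / (p + 1)) ^ 2 := by
    field_simp
    ring
  rw [e, h0, zero_sub] at h1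
  have h2 : (2 * p * x + r * y) / (p + 1) = 0 := by nlinarith [sq_nonneg ((2 * p * x + r * y) / (p + 1))]
  rw [div_eq_zero_iff] at h2
  exact h2.resolve_right hp1.ne'

theorem re_symbol (x ξ : ℝ) : (q (x, ξ)).re =
    (coeffXX q).re * x ^ 2 + (coeffXXi q).re * (x * ξ) + (coeffXiXi q).re * ξ ^ 2 := by
  rw [symbol_eq]
  have e : coeffXX q * (x : ℂ) ^ 2 + coeffXXi q * ((x : ℂ) * ξ) + coeffXiXi q * (ξ : ℂ) ^ 2 =
      coeffXX q * ((x ^ 2 : ℝ) : ℂ) + coeffXXi q * ((x * ξ : ℝ) : ℂ) +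
        coeffXiXi q * ((ξ ^ 2 : ℝ) : ℂ) := by push_cast; rfl
  rw [e]
  simp only [Complex.add_re, Complex.re_mul_ofReal]

/-- Up to symplectic rotation and a factor, `Re F` applied to `u` is the gradient of `Re q`, which
vanishes at a minimum. -/
theorem re_hamiltonMap_mulVec_eq_zero (hq : ∀ X : ℝ × ℝ, 0 ≤ (q X).re) {u : Fin 2 → ℝ}
    (hu : (q (u 0, u 1)).re = 0) : ((hamiltonMap q).map Complex.re).mulVec u = 0 := by
  have hnn : ∀ x y : ℝ, 0 ≤ (coeffXX q).re * x ^ 2 + (coeffXXi q).re * (x * y) +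
      (coeffXiXi q).re * y ^ 2 := fun x y => by
    rw [← re_symbol]
    exact hq _
  rw [re_symbol] at hu
  have h1 := gradient_eq_zero_of_nonneg hnn hu
  have h2 := gradient_eq_zero_of_nonneg (p := (coeffXiXi q).re) (r := (coeffXXi q).re)
    (s := (coeffXX q).re) (x := u 1) (y := u 0) (fun x y => by linarith [hnn y x]) (by linarith)
  have hb : (coeffXXi q / 2).re = (coeffXXi q).re / 2 := Complex.div_ofNat_re _ _
  rw [funext_iff, Fin.forall_fin_two]
  simp only [hamiltonMap, Matrix.mulVec, dotProduct, Fin.sum_univ_two, Matrix.map_apply,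
    Matrix.cons_val', Matrix.cons_val_zero, Matrix.cons_val_one, Matrix.of_apply,
    Matrix.cons_val_fin_one, Pi.zero_apply, Complex.neg_re, hb]
  constructor <;> linarith

theorem mem_singularSpace_iff (u : Fin 2 → ℝ) : u ∈ singularSpace q ↔
    ∀ k : ℕ, ((hamiltonMap q).map Complex.re * (hamiltonMap q).map Complex.im ^ k).mulVec u = 0 := by
  simp only [singularSpace, Submodule.mem_iInf, LinearMap.mem_ker, Matrix.toLin'_apply]

/-- The real part of `q(u) + q(v) = 2iz Im(X₀ X̄₁)`, with `X = u + iv`, gives the weak inequality.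
Equality would make `Re q` vanish at `u` and `v`, and both would then lie in the singular space. -/
theorem im_mul_im_neg (hq : ∀ X : ℝ × ℝ, 0 ≤ (q X).re) (hS : singularSpace q = ⊥)
    {X : Fin 2 → ℂ} {z : ℂ} (hX : X ≠ 0) (h : (hamiltonMap q).mulVec X = z • X) :
    z.im * (X 0 * star (X 1)).im < 0 := by
  set u : Fin 2 → ℝ := fun i => (X i).re with hu
  set v : Fin 2 → ℝ := fun i => (X i).im with hv
  have hXuv : ∀ i, X i = u i + v i * Complex.I := fun i => (Complex.re_add_im (X i)).symm
  obtain ⟨e1, e2⟩ := (hamiltonMap_mulVec_eq_iff X z).1 h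
  have hσ : (X 0 * star (X 1)).im = v 0 * u 1 - u 0 * v 1 := by
    simp only [RCLike.star_def, Complex.mul_im, Complex.conj_re, Complex.conj_im, hu, hv]
    ring
  have hsum : q (u 0, u 1) + q (v 0, v 1) =
      2 * Complex.I * z * ((v 0 * u 1 - u 0 * v 1 : ℝ) : ℂ) := by
    rw [symbol_eq, symbol_eq]
    rw [hXuv 0, hXuv 1] at e1 e2
    push_cast
    linear_combination (-((u 0 : ℂ) - v 0 * Complex.I)) * e2 + ((u 1 : ℂ) - v 1 * Complex.I) * e1 +
      (coeffXX q * (v 0) ^ 2 + coeffXXi q * (v 0) * (v 1) + coeffXiXi q * (v 1) ^ 2) * Complex.I_sq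
  have hre : (q (u 0, u 1)).re + (q (v 0, v 1)).re = -2 * (z.im * (v 0 * u 1 - u 0 * v 1)) := by
    rw [← Complex.add_re, hsum, Complex.re_mul_ofReal]
    simp
    ring
  rw [hσ]
  have h1 := hq (u 0, u 1)
  have h2 := hq (v 0, v 1)
  refine lt_of_le_of_ne (by linarith) fun h0 => hX ?_
  have hu0 := re_hamiltonMap_mulVec_eq_zero hq (u := u) (by nlinarith)
  have hv0 := re_hamiltonMap_mulVec_eq_zero hq (u := v) (by nlinarith)
  -- Once `Re F` kills `u` and `v`, the eigenvalue equation reads `i (Im F) X = z X`, so `Im F`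
  -- preserves their real span and `Re F` kills all iterates.
  have himu : ((hamiltonMap q).map Complex.im).mulVec u = z.im • u + z.re • v ∧
      ((hamiltonMap q).map Complex.im).mulVec v = z.im • v - z.re • u := by
    rw [funext_iff, Fin.forall_fin_two] at hu0 hv0
    have hb : (coeffXXi q / 2).re = (coeffXXi q).re / 2 := Complex.div_ofNat_re _ _
    have hb' : (coeffXXi q / 2).im = (coeffXXi q).im / 2 := Complex.div_ofNat_im _ _
    have r1 := congrArg Complex.re e1
    have r2 := congrArg Complex.re e2
    have i1 := congrArg Complex.im e1
    have i2 := congrArg Complex.im e2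
    rw [funext_iff, Fin.forall_fin_two, funext_iff, Fin.forall_fin_two]
    simp only [hamiltonMap, Matrix.mulVec, dotProduct, Fin.sum_univ_two, Matrix.map_apply,
      Matrix.cons_val', Matrix.cons_val_zero, Matrix.cons_val_one, Matrix.of_apply,
      Matrix.cons_val_fin_one, Pi.zero_apply, Complex.neg_re, Complex.neg_im, hb, hb',
      Complex.add_re, Complex.mul_re, Complex.add_im, Complex.mul_im, Complex.sub_re,
      Complex.sub_im, Pi.add_apply, Pi.sub_apply, Pi.smul_apply, smul_eq_mul, hu, hv]
      at hu0 hv0 r1 r2 i1 i2 ⊢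
    refine ⟨⟨?_, ?_⟩, ?_, ?_⟩ <;> linarith [hu0.1, hu0.2, hv0.1, hv0.2]
  have hker : ∀ k : ℕ,
      ((hamiltonMap q).map Complex.re * (hamiltonMap q).map Complex.im ^ k).mulVec u = 0 ∧
      ((hamiltonMap q).map Complex.re * (hamiltonMap q).map Complex.im ^ k).mulVec v = 0 := by
    intro k
    induction k with
    | zero =>
      rw [pow_zero, mul_one]
      exact ⟨hu0, hv0⟩
    | succ k ih =>
      rw [pow_succ, ← mul_assoc]
      constructor
      · rw [← Matrix.mulVec_mulVec, himu.1, Matrix.mulVec_add, Matrix.mulVec_smul,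
          Matrix.mulVec_smul, ih.1, ih.2, smul_zero, smul_zero, add_zero]
      · rw [← Matrix.mulVec_mulVec, himu.2, Matrix.mulVec_sub, Matrix.mulVec_smul,
          Matrix.mulVec_smul, ih.1, ih.2, smul_zero, smul_zero, sub_zero]
  have hu' : u = 0 := by
    have : u ∈ singularSpace q := (mem_singularSpace_iff u).2 fun k => (hker k).1
    rwa [hS, Submodule.mem_bot] at this
  have hv' : v = 0 := by
    have : v ∈ singularSpace q := (mem_singularSpace_iff v).2 fun k => (hker k).2
    rwa [hS, Submodule.mem_bot] at this
  ext i
  rw [hXuv i, hu', hv']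
  simp

theorem charpoly_hamiltonMap {z : ℂ}
    (hz : z ^ 2 = coeffXXi q ^ 2 / 4 - coeffXX q * coeffXiXi q) :
    (hamiltonMap q).charpoly = (Polynomial.X - Polynomial.C z) * (Polynomial.X - Polynomial.C (-z)) := by
  have hdet : (hamiltonMap q).det = -z ^ 2 := by
    rw [hz, hamiltonMap, Matrix.det_fin_two_of]
    ring
  have htr : (hamiltonMap q).trace = 0 := by
    rw [hamiltonMap, Matrix.trace_fin_two_of]
    ring
  rw [Matrix.charpoly_fin_two, hdet, htr]
  simp only [map_zero, map_neg, map_pow]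
  ring

theorem exists_eigenvector {z : ℂ}
    (hz : z ^ 2 = coeffXXi q ^ 2 / 4 - coeffXX q * coeffXiXi q) :
    ∃ X : Fin 2 → ℂ, X ≠ 0 ∧ (hamiltonMap q).mulVec X = z • X := by
  have hdet : (hamiltonMap q - Matrix.scalar (Fin 2) z).det = 0 := by
    rw [hamiltonMap, Matrix.det_fin_two]
    simp
    linear_combination hz
  obtain ⟨X, hX, h⟩ := Matrix.exists_mulVec_eq_zero_iff.2 hdet
  refine ⟨X, hX, ?_⟩
  rw [Matrix.sub_mulVec, sub_eq_zero] at h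
  rw [h]
  ext i
  simp [Matrix.mulVec_diagonal]

/-- The eigenvalue with positive imaginary part and eigenvectors for it and its negative. -/
theorem exists_eigen_data (hq : ∀ X : ℝ × ℝ, 0 ≤ (q X).re) (hS : singularSpace q = ⊥) :
    ∃ (lam : ℂ) (X Y : Fin 2 → ℂ), 0 < lam.im ∧
      (hamiltonMap q).charpoly.roots.filter (fun z => 0 < z.im) = {lam} ∧
      X ≠ 0 ∧ (hamiltonMap q).mulVec X = lam • X ∧
      Y ≠ 0 ∧ (hamiltonMap q).mulVec Y = (-lam) • Y := by
  obtain ⟨w, hw⟩ := IsAlgClosed.exists_pow_nat_eq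
    (coeffXXi q ^ 2 / 4 - coeffXX q * coeffXiXi q) two_pos
  have hw0 : w.im ≠ 0 := by
    obtain ⟨X, hX, h⟩ := exists_eigenvector hw
    intro h0
    have := im_mul_im_neg hq hS hX h
    rw [h0, zero_mul] at this
    exact lt_irrefl _ this
  obtain ⟨lam, hlam, hpos⟩ : ∃ lam : ℂ, lam ^ 2 = coeffXXi q ^ 2 / 4 - coeffXX q * coeffXiXi q ∧
      0 < lam.im := by
    rcases lt_or_gt_of_ne hw0 with h | h
    · exact ⟨-w, by rw [neg_sq, hw], by simpa using h⟩
    · exact ⟨w, hw, h⟩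
  obtain ⟨X, hX, hX'⟩ := exists_eigenvector hlam
  obtain ⟨Y, hY, hY'⟩ := exists_eigenvector (z := -lam) (by rw [neg_sq, hlam])
  refine ⟨lam, X, Y, hpos, ?_, hX, hX', hY, hY'⟩
  rw [charpoly_hamiltonMap hlam, Polynomial.roots_mul
    (mul_ne_zero (Polynomial.X_sub_C_ne_zero _) (Polynomial.X_sub_C_ne_zero _)),
    Polynomial.roots_X_sub_C, Polynomial.roots_X_sub_C, Multiset.filter_add,
    Multiset.filter_singleton, Multiset.filter_singleton, if_pos hpos, if_neg (by
      rw [Complex.neg_im]; linarith)]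
  rfl

/-- In the eigenbasis `X, Y`, powers of `F - t` scale the `Y`-component of `V` by `(w - t)^k`, which
is nonzero when `t` satisfies `p` and `w` does not. -/
theorem iSup_maxGenEigenspace_eq_span {F : Matrix (Fin 2) (Fin 2) ℂ} {X Y : Fin 2 → ℂ} {z w : ℂ}
    (hX : F.mulVec X = z • X) (hY : F.mulVec Y = w • Y) (hXY : X 0 * Y 1 - X 1 * Y 0 ≠ 0)
    {p : ℂ → Prop} (hz : p z) (hw : ¬ p w) :
    ⨆ (t : ℂ) (_ : p t), Module.End.maxGenEigenspace (Matrix.toLin' F) t =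
      Submodule.span ℂ {X} := by
  have hpow : ∀ (V : Fin 2 → ℂ) (s t : ℂ) (k : ℕ), F.mulVec V = s • V →
      ((Matrix.toLin' F - t • (1 : Module.End ℂ (Fin 2 → ℂ))) ^ k) V = (s - t) ^ k • V := by
    intro V s t k hV
    induction k with
    | zero => simp
    | succ k ih =>
      rw [pow_succ, Module.End.mul_apply, LinearMap.sub_apply, Matrix.toLin'_apply, hV,
        LinearMap.smul_apply, Module.End.one_apply, ← sub_smul, map_smul, ih, smul_smul, pow_succ,
        mul_comm]
  apply le_antisymm
  · refine iSup₂_le fun t ht V hV => ?_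
    obtain ⟨k, hk⟩ := Module.End.mem_maxGenEigenspace _ _ _ |>.1 hV
    set a := (V 0 * Y 1 - V 1 * Y 0) / (X 0 * Y 1 - X 1 * Y 0) with ha
    set b := (X 0 * V 1 - X 1 * V 0) / (X 0 * Y 1 - X 1 * Y 0) with hb
    have hVab : V = a • X + b • Y := by
      rw [funext_iff, Fin.forall_fin_two]
      simp only [Pi.add_apply, Pi.smul_apply, smul_eq_mul, ha, hb]
      constructor <;>
        · rw [div_mul_eq_mul_div, div_mul_eq_mul_div, ← add_div, eq_div_iff hXY]
          ring
    rw [hVab, map_add, map_smul, map_smul, hpow X z t k hX, hpow Y w t k hY] at hk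
    have hb0 : b * (w - t) ^ k = 0 := by
      have h0 := congrFun hk 0
      have h1 := congrFun hk 1
      simp only [Pi.add_apply, Pi.smul_apply, smul_eq_mul, Pi.zero_apply] at h0 h1
      refine (mul_eq_zero.1 (?_ : (b * (w - t) ^ k) * (X 0 * Y 1 - X 1 * Y 0) = 0)).resolve_right hXY
      linear_combination (X 0) * h1 - (X 1) * h0
    have hb1 : b = 0 := by
      refine (mul_eq_zero.1 hb0).resolve_right (pow_ne_zero _ ?_)
      rw [sub_ne_zero]
      rintro rfl
      exact hw ht
    rw [hVab, hb1, zero_smul, add_zero]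
    exact Submodule.smul_mem _ _ (Submodule.mem_span_singleton_self X)
  · rw [Submodule.span_singleton_le_iff_mem]
    refine Submodule.mem_iSup_of_mem z (Submodule.mem_iSup_of_mem hz ?_)
    rw [Module.End.mem_maxGenEigenspace]
    exact ⟨1, by rw [hpow X z z 1 hX]; simp⟩

/-- Proportional vectors cannot belong to both `λ` and `-λ`; `im_mul_im_neg` ensures that the second
coordinates do not vanish. -/
theorem wedge_ne_zero (hq : ∀ X : ℝ × ℝ, 0 ≤ (q X).re) (hS : singularSpace q = ⊥)
    {lam : ℂ} {X Y : Fin 2 → ℂ} (hlam : 0 < lam.im)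
    (hX0 : X ≠ 0) (hX : (hamiltonMap q).mulVec X = lam • X)
    (hY0 : Y ≠ 0) (hY : (hamiltonMap q).mulVec Y = (-lam) • Y) :
    X 0 * Y 1 - X 1 * Y 0 ≠ 0 := by
  intro h0
  have hX1 : X 1 ≠ 0 := fun h1 => by
    have := im_mul_im_neg hq hS hX0 hX
    rw [h1] at this
    simp at this
  have hY1 : Y 1 ≠ 0 := fun h1 => by
    have := im_mul_im_neg hq hS hY0 hY
    rw [h1] at this
    simp at this
  have hl : lam ≠ 0 := by
    rintro rfl
    simp at hlam
  obtain ⟨-, a⟩ := (hamiltonMap_mulVec_eq_iff X lam).1 hX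
  obtain ⟨-, b⟩ := (hamiltonMap_mulVec_eq_iff Y (-lam)).1 hY
  have : 2 * lam * (X 1 * Y 1) = 0 := by
    linear_combination (-(Y 1)) * a + (X 1) * b - coeffXX q * h0
  exact mul_ne_zero (mul_ne_zero two_ne_zero hl) (mul_ne_zero hX1 hY1) this

/-! ### Canonical transformations -/

/-- The complexification of a real matrix of determinant one. -/
abbrev complexify (κ : Matrix.SpecialLinearGroup (Fin 2) ℝ) : Matrix (Fin 2) (Fin 2) ℂ :=
  (κ : Matrix (Fin 2) (Fin 2) ℝ).map Complex.ofReal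

theorem complexify_mulVec (κ : Matrix.SpecialLinearGroup (Fin 2) ℝ) (X : Fin 2 → ℂ) :
    (complexify κ).mulVec X = ![(κ 0 0 : ℂ) * X 0 + κ 0 1 * X 1, κ 1 0 * X 0 + κ 1 1 * X 1] := by
  rw [funext_iff, Fin.forall_fin_two]
  simp [Matrix.mulVec, dotProduct, Fin.sum_univ_two]

theorem det_coe (κ : Matrix.SpecialLinearGroup (Fin 2) ℝ) : κ 0 0 * κ 1 1 - κ 0 1 * κ 1 0 = 1 := by
  have := κ.det_coe
  rwa [Matrix.det_fin_two] at this

/-- Up to a constant the quantity is the symplectic form of `X` and its conjugate, which real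
canonical maps preserve. The sign condition on eigenvectors therefore survives `κ`. -/
theorem im_complexify_mulVec (κ : Matrix.SpecialLinearGroup (Fin 2) ℝ) (X : Fin 2 → ℂ) :
    ((complexify κ).mulVec X 0 * star ((complexify κ).mulVec X 1)).im =
      (X 0 * star (X 1)).im := by
  rw [complexify_mulVec]
  have hd := det_coe κ
  simp only [Matrix.cons_val_zero, Matrix.cons_val_one, RCLike.star_def, Complex.mul_im,
    Complex.conj_re, Complex.conj_im, Complex.add_re, Complex.add_im, Complex.mul_re,
    Complex.ofReal_re, Complex.ofReal_im]
  linear_combination ((X 0).im * (X 1).re - (X 0).re * (X 1).im) * hd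

theorem map_span_complexify (κ : Matrix.SpecialLinearGroup (Fin 2) ℝ) (X : Fin 2 → ℂ) :
    (Submodule.span ℂ {X}).map (Matrix.toLin' (complexify κ)) =
      Submodule.span ℂ {(complexify κ).mulVec X} := by
  rw [Submodule.map_span, Set.image_singleton, Matrix.toLin'_apply]

/-- Eigenvectors of the Hamilton map normalized by a canonical transformation. -/
structure NormalizedData (q : QuadraticMap ℝ (ℝ × ℝ) ℂ) (lam C : ℂ) where
  /-- the canonical transformation -/
  κ : Matrix.SpecialLinearGroup (Fin 2) ℝ
  /-- the slope of the image of `Λ⁺` -/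
  A : ℂ
  /-- the eigenvector for `lam` -/
  X : Fin 2 → ℂ
  /-- the eigenvector for `-lam` -/
  Y : Fin 2 → ℂ
  eigX : (hamiltonMap q).mulVec X = lam • X
  eigY : (hamiltonMap q).mulVec Y = (-lam) • Y
  mapX : (complexify κ).mulVec X = ![1, A]
  mapY : (complexify κ).mulVec Y = ![1, -Complex.I]
  eqC : C = (1 - Complex.I * A)⁻¹ * (1 + Complex.I * A)

theorem exists_normalizedData (hq : ∀ X : ℝ × ℝ, 0 ≤ (q X).re) (hS : singularSpace q = ⊥)
    {lam C : ℂ} {X Y : Fin 2 → ℂ} (hlam : 0 < lam.im)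
    (hX0 : X ≠ 0) (hX : (hamiltonMap q).mulVec X = lam • X)
    (hY0 : Y ≠ 0) (hY : (hamiltonMap q).mulVec Y = (-lam) • Y) (hC : IsCPlus q C) :
    Nonempty (NormalizedData q lam C) := by
  have hw := wedge_ne_zero hq hS hlam hX0 hX hY0 hY
  have hp : lambdaPlus q = Submodule.span ℂ {X} :=
    iSup_maxGenEigenspace_eq_span (p := fun z => 0 < z.im) hX hY hw hlam (by
      rw [Complex.neg_im]; linarith)
  have hm : lambdaMinus q = Submodule.span ℂ {Y} :=
    iSup_maxGenEigenspace_eq_span (p := fun z => z.im < 0) hY hX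
      (fun h => hw (by linear_combination -h)) (by rw [Complex.neg_im]; linarith) (by linarith)
  obtain ⟨κ, A, h1, h2, h3⟩ := hC
  rw [hm, map_span_complexify] at h1
  rw [hp, map_span_complexify] at h2
  have m1 : ![1, -Complex.I] ∈ Submodule.span ℂ {(complexify κ).mulVec Y} := by
    rw [h1]; exact Submodule.mem_span_singleton_self _
  have m2 : ![1, A] ∈ Submodule.span ℂ {(complexify κ).mulVec X} := by
    rw [h2]; exact Submodule.mem_span_singleton_self _
  obtain ⟨s, hs⟩ := Submodule.mem_span_singleton.1 m1
  obtain ⟨t, ht⟩ := Submodule.mem_span_singleton.1 m2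
  exact ⟨⟨κ, A, t • X, s • Y, by rw [Matrix.mulVec_smul, hX, smul_comm],
    by rw [Matrix.mulVec_smul, hY, smul_comm], by rw [Matrix.mulVec_smul, ht],
    by rw [Matrix.mulVec_smul, hs], h3⟩⟩

/-- For the eigenvalue `-λ` the sign lemma gives `σ > 0`, so the real and imaginary parts of `Y`,
divided by `√σ`, form a symplectic basis; `κ` sends `Y` to `√σ (1, -i)`. The image of `X` has
nonzero first coordinate, since the invariant form does not vanish on it. -/
theorem exists_isCPlus (hq : ∀ X : ℝ × ℝ, 0 ≤ (q X).re) (hS : singularSpace q = ⊥)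
    {lam : ℂ} {X Y : Fin 2 → ℂ} (hlam : 0 < lam.im)
    (hX0 : X ≠ 0) (hX : (hamiltonMap q).mulVec X = lam • X)
    (hY0 : Y ≠ 0) (hY : (hamiltonMap q).mulVec Y = (-lam) • Y) : ∃ C, IsCPlus q C := by
  have hw := wedge_ne_zero hq hS hlam hX0 hX hY0 hY
  have hp : lambdaPlus q = Submodule.span ℂ {X} :=
    iSup_maxGenEigenspace_eq_span (p := fun z => 0 < z.im) hX hY hw hlam (by
      rw [Complex.neg_im]; linarith)
  have hm : lambdaMinus q = Submodule.span ℂ {Y} :=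
    iSup_maxGenEigenspace_eq_span (p := fun z => z.im < 0) hY hX
      (fun h => hw (by linear_combination -h)) (by rw [Complex.neg_im]; linarith) (by linarith)
  have sX := im_mul_im_neg hq hS hX0 hX
  have sY := im_mul_im_neg hq hS hY0 hY
  set σ := (Y 0 * star (Y 1)).im with hσ
  have hσ0 : 0 < σ := by
    rw [Complex.neg_im] at sY
    nlinarith
  have hσe : σ = (Y 0).im * (Y 1).re - (Y 0).re * (Y 1).im := by
    rw [hσ]
    simp only [RCLike.star_def, Complex.mul_im, Complex.conj_re, Complex.conj_im]
    ring
  set r := Real.sqrt σ with hr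
  have hr0 : 0 < r := Real.sqrt_pos.2 hσ0
  have hrr : r * r = σ := Real.mul_self_sqrt hσ0.le
  have hdet : Matrix.det !![-(Y 1).im / r, (Y 0).im / r; -(Y 1).re / r, (Y 0).re / r] = 1 := by
    rw [Matrix.det_fin_two_of]
    field_simp
    rw [pow_two, hrr, hσe]
    ring
  set κ : Matrix.SpecialLinearGroup (Fin 2) ℝ := ⟨_, hdet⟩ with hκ
  have hκY : (complexify κ).mulVec Y = (r : ℂ) • ![1, -Complex.I] := by
    have hrc : (r : ℂ) ≠ 0 := by exact_mod_cast hr0.ne'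
    have hrrc : (r : ℂ) * r = ((Y 0).im : ℂ) * (Y 1).re - (Y 0).re * (Y 1).im := by
      rw [← Complex.ofReal_mul, hrr, hσe]
      push_cast
      rfl
    have e0 := (Complex.re_add_im (Y 0)).symm
    have e1 := (Complex.re_add_im (Y 1)).symm
    rw [complexify_mulVec, funext_iff, Fin.forall_fin_two]
    simp only [hκ, Matrix.cons_val_zero, Matrix.cons_val_one, Pi.smul_apply, smul_eq_mul,
      Matrix.SpecialLinearGroup.coe_mk, Matrix.of_apply, Matrix.cons_val', Matrix.cons_val_fin_one,
      Complex.ofReal_div, Complex.ofReal_neg, mul_one]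
    constructor
    · field_simp
      linear_combination (-((Y 1).im : ℂ)) * e0 + ((Y 0).im : ℂ) * e1 - hrrc
    · field_simp
      linear_combination (-((Y 1).re : ℂ)) * e0 + ((Y 0).re : ℂ) * e1 + Complex.I * hrrc
  have him := im_complexify_mulVec κ X
  have h0 : (complexify κ).mulVec X 0 ≠ 0 := by
    intro h0
    rw [h0] at him
    rw [← him] at sX
    simp at sX
  refine ⟨_, κ, (complexify κ).mulVec X 1 / (complexify κ).mulVec X 0, ?_, ?_, rfl⟩
  · rw [hm, map_span_complexify, hκY]
    refine Submodule.span_singleton_smul_eq ?_ _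
    exact isUnit_iff_ne_zero.2 (by exact_mod_cast hr0.ne')
  · rw [hp, map_span_complexify]
    have e : (complexify κ).mulVec X = (complexify κ).mulVec X 0 •
        ![1, (complexify κ).mulVec X 1 / (complexify κ).mulVec X 0] := by
      rw [funext_iff, Fin.forall_fin_two]
      simp only [Pi.smul_apply, Matrix.cons_val_zero, Matrix.cons_val_one, smul_eq_mul, mul_one,
        true_and]
      rw [mul_div_cancel₀ _ h0]
    conv_lhs => rw [e]
    exact Submodule.span_singleton_smul_eq (isUnit_iff_ne_zero.2 h0) _

/-! ### Normal form of the symbol in the adapted ladder variables -/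

namespace NormalizedData

variable {lam C : ℂ}

theorem im_A_pos (d : NormalizedData q lam C) (hq : ∀ X : ℝ × ℝ, 0 ≤ (q X).re)
    (hS : singularSpace q = ⊥) (hlam : 0 < lam.im) : 0 < d.A.im := by
  have hX0 : d.X ≠ 0 := by
    intro h0
    have h := d.mapX
    rw [h0, Matrix.mulVec_zero] at h
    have := congrFun h 0
    simp at this
  have s := im_mul_im_neg hq hS hX0 d.eigX
  rw [← im_complexify_mulVec d.κ, d.mapX] at s
  simp at s
  nlinarith

/-- The Cayley transform carries the upper half-plane to the unit disc. -/
theorem norm_lt_one (d : NormalizedData q lam C) (hA : 0 < d.A.im) : ‖C‖ < 1 := by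
  have h1 : ‖1 + Complex.I * d.A‖ < ‖1 - Complex.I * d.A‖ := by
    refine lt_of_pow_lt_pow_left₀ 2 (norm_nonneg _) ?_
    rw [← Complex.normSq_eq_norm_sq, ← Complex.normSq_eq_norm_sq, Complex.normSq_apply,
      Complex.normSq_apply]
    simp
    nlinarith
  rw [d.eqC, norm_mul, norm_inv, inv_mul_eq_div, div_lt_one ((norm_nonneg _).trans_lt h1)]
  exact h1

/-- The coefficient of `x` in the annihilation operator. -/
def α (d : NormalizedData q lam C) : ℂ := ((d.κ 0 0 : ℂ) + Complex.I * d.κ 1 0) / (Real.sqrt 2 : ℝ)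

/-- The coefficient of `D` in the annihilation operator. -/
def β (d : NormalizedData q lam C) : ℂ := ((d.κ 0 1 : ℂ) + Complex.I * d.κ 1 1) / (Real.sqrt 2 : ℝ)

theorem sqrt_two_ne : ((Real.sqrt 2 : ℝ) : ℂ) ≠ 0 := by
  rw [Complex.ofReal_ne_zero]
  positivity

theorem sqrt_two_sq : ((Real.sqrt 2 : ℝ) : ℂ) ^ 2 = 2 := by
  rw [← Complex.ofReal_pow, Real.sq_sqrt (by norm_num)]
  norm_num

theorem star_α (d : NormalizedData q lam C) :
    star d.α = ((d.κ 0 0 : ℂ) - Complex.I * d.κ 1 0) / (Real.sqrt 2 : ℝ) := by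
  simp [α, sub_eq_add_neg]

theorem star_β (d : NormalizedData q lam C) :
    star d.β = ((d.κ 0 1 : ℂ) - Complex.I * d.κ 1 1) / (Real.sqrt 2 : ℝ) := by
  simp [β, sub_eq_add_neg]

theorem im_α_star_β (d : NormalizedData q lam C) : (d.α * star d.β).im = -1 / 2 := by
  have hd := det_coe d.κ
  have e : d.α * star d.β = (((d.κ 0 0 * d.κ 0 1 + d.κ 1 0 * d.κ 1 1) / 2 : ℝ) : ℂ) +
      ((-1 / 2 : ℝ) : ℂ) * Complex.I := by
    rw [d.star_β, α, div_mul_div_comm, ← pow_two, sqrt_two_sq]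
    have hd' : (d.κ 0 0 : ℂ) * d.κ 1 1 - d.κ 0 1 * d.κ 1 0 = 1 := by exact_mod_cast hd
    push_cast
    linear_combination (-Complex.I / 2) * hd' - (d.κ 1 0 : ℂ) * d.κ 1 1 / 2 * Complex.I_mul_I
  rw [e]
  simp

/-- The form vanishes on both eigenlines, so `(A + i) q = 2λ (X₁x - X₀ξ)(Y₁x - Y₀ξ)`. With `ℓ = αx +
βξ`, the second factor is `-i√2 ℓ̄` and the first is a combination of `ℓ` and `ℓ̄`, whose ratio of
coefficients is `-C`. -/
theorem coeff_eq (d : NormalizedData q lam C) (hA : 0 < d.A.im) :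
    coeffXX q = 2 * lam / Complex.I * (d.α * star d.α - C * star d.α ^ 2) ∧
    coeffXXi q = 2 * lam / Complex.I *
      (d.α * star d.β + star d.α * d.β - 2 * C * star d.α * star d.β) ∧
    coeffXiXi q = 2 * lam / Complex.I * (d.β * star d.β - C * star d.β ^ 2) := by
  have hden : 1 - Complex.I * d.A ≠ 0 := by
    intro h0
    have := congrArg Complex.re h0
    simp at this
    linarith
  have hAi : d.A + Complex.I = Complex.I * (1 - Complex.I * d.A) := by
    linear_combination d.A * Complex.I_mul_I
  have hC : C * (1 - Complex.I * d.A) = 1 + Complex.I * d.A := by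
    refine (congrArg (· * (1 - Complex.I * d.A)) d.eqC).trans ?_
    field_simp
  have hdet : (d.κ 0 0 : ℂ) * d.κ 1 1 - d.κ 0 1 * d.κ 1 0 = 1 := by exact_mod_cast det_coe d.κ
  have mX := d.mapX
  have mY := d.mapY
  rw [complexify_mulVec] at mX mY
  have x0 := congrFun mX 0
  have x1 := congrFun mX 1
  have y0 := congrFun mY 0
  have y1 := congrFun mY 1
  simp only [Matrix.cons_val_zero, Matrix.cons_val_one] at x0 x1 y0 y1
  obtain ⟨p1, p2⟩ := (hamiltonMap_mulVec_eq_iff d.X lam).1 d.eigX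
  obtain ⟨r1, r2⟩ := (hamiltonMap_mulVec_eq_iff d.Y (-lam)).1 d.eigY
  rw [d.star_α, d.star_β, α, β]
  set s : ℂ := ((Real.sqrt 2 : ℝ) : ℂ) with hs
  have hs0 : s ≠ 0 := sqrt_two_ne
  have hs2 : s ^ 2 = 2 := sqrt_two_sq
  generalize (d.κ 0 0 : ℂ) = k at *
  generalize (d.κ 0 1 : ℂ) = l at *
  generalize (d.κ 1 0 : ℂ) = m at *
  generalize (d.κ 1 1 : ℂ) = n at *
  have X0 : d.X 0 = n - l * d.A := by linear_combination n * x0 - l * x1 - d.X 0 * hdet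
  have X1 : d.X 1 = -m + k * d.A := by linear_combination k * x1 - m * x0 - d.X 1 * hdet
  have Y0 : d.Y 0 = n + l * Complex.I := by linear_combination n * y0 - l * y1 - d.Y 0 * hdet
  have Y1 : d.Y 1 = -m - k * Complex.I := by linear_combination k * y1 - m * y0 - d.Y 1 * hdet
  have hwedge : d.X 0 * d.Y 1 - d.X 1 * d.Y 0 = -(d.A + Complex.I) := by
    rw [X0, X1, Y0, Y1]
    linear_combination (-(d.A + Complex.I)) * hdet
  -- These three relations are the factorization, coefficient by coefficient, obtained by
  -- eliminating between the two eigenvector equations.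
  have ea : coeffXX q * (d.A + Complex.I) = 2 * lam * (d.X 1 * d.Y 1) := by
    linear_combination d.Y 1 * p2 - d.X 1 * r2 + coeffXX q * hwedge
  have ed : coeffXiXi q * (d.A + Complex.I) = 2 * lam * (d.X 0 * d.Y 0) := by
    linear_combination (d.Y 0) * p1 - (d.X 0) * r1 + coeffXiXi q * hwedge
  have eb : coeffXXi q * (d.A + Complex.I) = -2 * lam * (d.X 0 * d.Y 1 + d.X 1 * d.Y 0) := by
    linear_combination (-2 * d.Y 1) * p1 + (2 * d.X 1) * r1 + coeffXXi q * hwedge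
  have hAi0 : d.A + Complex.I ≠ 0 := by
    rw [hAi]
    exact mul_ne_zero Complex.I_ne_zero hden
  have key : ∀ U V : ℂ, 2 * lam / Complex.I * (U - C * V) * (d.A + Complex.I) =
      2 * lam * ((1 - Complex.I * d.A) * U - (1 + Complex.I * d.A) * V) := by
    intro U V
    have hI : 2 * lam / Complex.I * (d.A + Complex.I) = 2 * lam * (1 - Complex.I * d.A) := by
      rw [hAi]
      have := Complex.I_ne_zero
      field_simp
    linear_combination (U - C * V) * hI - 2 * lam * V * hC
  have ht : s⁻¹ ^ 2 = 1 / 2 := by rw [inv_pow, hs2, one_div]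
  simp only [div_eq_mul_inv _ s]
  generalize s⁻¹ = t at *
  refine ⟨?_, ?_, ?_⟩ <;> apply mul_right_cancel₀ hAi0
  · rw [key, ea, X1, Y1]
    linear_combination (-2 * lam * ((1 - Complex.I * d.A) * ((k + Complex.I * m) *
      (k - Complex.I * m)) - (1 + Complex.I * d.A) * (k - Complex.I * m) ^ 2)) * ht +
      2 * lam * m * (m - k * d.A) * Complex.I_sq
  · have e : (k + Complex.I * m) * t * ((l - Complex.I * n) * t) +
        (k - Complex.I * m) * t * ((l + Complex.I * n) * t) -
        2 * C * ((k - Complex.I * m) * t) * ((l - Complex.I * n) * t) =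
        ((k + Complex.I * m) * t * ((l - Complex.I * n) * t) +
        (k - Complex.I * m) * t * ((l + Complex.I * n) * t)) -
        C * (2 * ((k - Complex.I * m) * t) * ((l - Complex.I * n) * t)) := by ring
    rw [e, key, eb, X0, X1, Y0, Y1]
    linear_combination (-2 * lam * ((1 - Complex.I * d.A) * ((k + Complex.I * m) *
      (l - Complex.I * n) + (k - Complex.I * m) * (l + Complex.I * n)) -
      (1 + Complex.I * d.A) * (2 * (k - Complex.I * m) * (l - Complex.I * n)))) * ht +
      2 * lam * (m * (n - l * d.A) + n * (m - k * d.A)) * Complex.I_sq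
  · rw [key, ed, X0, Y0]
    linear_combination (-2 * lam * ((1 - Complex.I * d.A) * ((l + Complex.I * n) *
      (l - Complex.I * n)) - (1 + Complex.I * d.A) * (l - Complex.I * n) ^ 2)) * ht +
      2 * lam * n * (n - l * d.A) * Complex.I_sq

end NormalizedData

end

end QuadraticWeyl

end

/-! ### Assembly of the theorem -/

theorem corollary1p6 :
    ∃ c : ℂ → ℕ → ℝ,
      (∀ C : ℂ, C ≠ 0 → ‖C‖ < 1 →
        c C 0 = (2 * Real.pi * ‖C‖) ^ (-(1 / 2 : ℝ)) *
          ((1 + ‖C‖) / (1 - ‖C‖)) ^ (1 / 4 : ℝ)) ∧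
      ∀ q : QuadraticMap ℝ (ℝ × ℝ) ℂ,
        (∀ X : ℝ × ℝ, 0 ≤ (q X).re) →
        singularSpace q = ⊥ →
        ∃ lam : ℂ,
          (hamiltonMap q).charpoly.roots.filter (fun z => 0 < z.im) = {lam} ∧
          (∀ N : ℕ, ∃ P : L2R →L[ℂ] L2R,
            IsSpectralProjection (weylOp q) (lam / Complex.I * (2 * (N : ℂ) + 1)) P) ∧
          (∃ C : ℂ, IsCPlus q C) ∧
          ∀ C : ℂ, IsCPlus q C →
            ‖C‖ < 1 ∧
            (C ≠ 0 →
              ∀ Pi : ℕ → (L2R →L[ℂ] L2R),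
                (∀ N : ℕ, IsSpectralProjection (weylOp q)
                  (lam / Complex.I * (2 * (N : ℂ) + 1)) (Pi N)) →
                ∀ J : ℕ,
                  (fun N : ℕ =>
                    ((1 - ‖C‖) / (1 + ‖C‖)) ^ ((N : ℝ) / 2) * ‖Pi N‖
                      - ∑ j ∈ Finset.range J, c C j * (N : ℝ) ^ (-(j : ℝ) - 1 / 2))
                    =O[Filter.atTop] fun N : ℕ => (N : ℝ) ^ (-(J : ℝ) - 1 / 2)) := by
  refine ⟨fun C j => normCoeff ‖C‖ j, fun C h0 h1 => normCoeff_zero (norm_pos_iff.2 h0) h1,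
    fun q hq hS => ?_⟩
  obtain ⟨lam, X, Y, hlam, hroots, hX0, hX, hY0, hY⟩ := exists_eigen_data hq hS
  have hc : 2 * lam / Complex.I ≠ 0 := by
    refine div_ne_zero (mul_ne_zero two_ne_zero ?_) Complex.I_ne_zero
    rintro rfl
    simp at hlam
  -- The diagonal entries `c (N + 1/2)` with `c = 2λ/i` are exactly the `μ_N`.
  have hmu : ∀ N : ℕ, lam / Complex.I * (2 * (N : ℂ) + 1) =
      2 * lam / Complex.I * ((N : ℂ) + 1 / 2) := fun N => by ring
  have htri : ∀ C, IsCPlus q C → ‖C‖ < 1 ∧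
      ∃ b, IsTriangular b (2 * lam / Complex.I) C (weylOp q) := by
    intro C hC
    obtain ⟨d⟩ := exists_normalizedData hq hS hlam hX0 hX hY0 hY hC
    have hA := d.im_A_pos hq hS hlam
    obtain ⟨hxx, hxxi, hxixi⟩ := d.coeff_eq hA
    exact ⟨d.norm_lt_one hA, hermiteBasis d.im_α_star_β,
      weylOp_graph_iff d.im_α_star_β hxx hxxi hxixi⟩
  have hex := exists_isCPlus hq hS hlam hX0 hX hY0 hY
  refine ⟨lam, hroots, fun N => ?_, hex, fun C hC => ?_⟩
  · obtain ⟨C, hC⟩ := hex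
    obtain ⟨h1, b, hb⟩ := htri C hC
    simpa only [hmu] using exists_isSpectralProjection hb hc h1 N
  · obtain ⟨h1, b, hb⟩ := htri C hC
    refine ⟨h1, fun hC0 Pi hPi J => ?_⟩
    refine norm_expansion (norm_pos_iff.2 hC0) h1 (fun N => norm_nonneg (Pi N)) (fun N => ?_) J
    have hN := hPi N
    rw [hmu N] at hN
    exact hN.norm_sq hb hc h1
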